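/- **Conventions.** Let $\boldsymbol k$ be a field of characteristic $0$ and $c\in\mathbb Z$. All degrees are shifted degrees $|x|'=|x|-1$; words $\vec x=(x_1,\dots,x_n)$ consist of homogeneous elements and $|\vec x|'=\sum|x_i|'$. An $A_\infty$-algebra $A$ is strict ($m_0=0$): operations $m_n:A[1]^{\otimes n}\to A[1]$, $n\ge 1$, of degree one with $\sum(-1)^{|\vec x_1|'}m(\vec x_1,m(\vec x_2),\vec x_3)=0$, the sum over all cuts of a word in three subwords. An $A_\infty$-homomorphism $f:A\to B$ consists of degree zero maps $f_n:A[1]^{\otimes n}\to B[1]$, $n\ge1$, with $\sum m^B(f(\vec x_1),\dots,f(\vec x_r))=\sum(-1)^{|\vec x_1|'}f(\vec x_1,m^A(\vec x_2),\vec x_3)$; it is a quasi-isomorphism if $f_1$ induces an isomorphism on the homology of $m_1$. The dual $A^*$ is the graded dual of $A[1]$, shifted so that an element of degree $e$ is a functional supported on the component of degree $d$ with $d+e+c=0$. It is an $A_\infty$-bimodule over $A$ with $$m^*(\vec x,v^*,\vec y)(w)=(-1)^{1+|v^*|'+|\vec x|'(|v^*|'+|\vec y|'+|w|')}\,v^*\big(m(\vec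 y,w,\vec x)\big).$$ An $A_\infty$-bimodule map $\phi:A\to A^*$ is a family $\phi_{k,l}:A[1]^{\otimes k}\otimes A[1]\otimes A[1]^{\otimes l}\to A^*$ of degree zero with $\phi\circ\widehat m=m^*\circ\widehat\phi$. For an $A_\infty$-homomorphism $f:A\to B$ and $\chi:B\to B^*$, let $f^\sharp\chi:A\to A^*$ be the composition $A\xrightarrow{\tilde f}B\xrightarrow{\tilde\chi}B^*\xrightarrow{\tilde f^*}A^*$ of families over $A$, where $\tilde f_{k,l}=f_{k+l+1}$, $\tilde\chi(\vec x,v,\vec y)=\chi(\widehat f(\vec x),v,\widehat f(\vec y))$ and $\tilde f^*(\vec x,v^*,\vec y)(w)=(-1)^{|\vec x|'(|v^*|'+|\vec y|'+|w|')}v^*(\tilde f(\vec y,w,\vec x))$. A cyclic symmetric inner product of degree $c$ on an $A_\infty$-algebra $B$ is a bilinear pairing on $B[1]$ with $\langle x,y\rangle=0$ unless $|x|'+|y|'+c=0$, with $\langle x,y\rangle=-(-1)^{|x|'|y|'}\langle y,x\rangle$, with $\langle m_k(x_1,\dots,x_k),x_{k+1}\rangle=(-1)^{|x_1|'(|x_2|'+\dots+|x_{k+1}|')}\langle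 m_k(x_2,\dots,x_{k+1}),x_1\rangle$ for $k\ge1$, and non-degenerate in the sense that it identifies the component of degree $d$ with the dual of the component of degree $-c-d$, for every $d$. It defines $\psi:B\to B^*$ with $\psi_{0,0}(x)(y)=\langle x,y\rangle$ and $\psi_{k,l}=0$ for $(k,l)\neq(0,0)$. An $A_\infty$-bimodule map $\phi:A\to A^*$ is a *strong homotopy inner product* (of degree $c$) if there are an $A_\infty$-algebra $B$ with a cyclic symmetric inner product of degree $c$ and an $A_\infty$-quasi-isomorphism $f:A\to B$ with $\phi=f^\sharp\psi$. **Theorem.** Let $A$ be an $A_\infty$-algebra over $\boldsymbol k$ whose homology $H^*(A)$ is finite dimensional in every degree. Then $A$ has a strong homotopy inner product of degree $c$ if and only if there is an $A_\infty$-bimodule map $\phi:A\to A^*$ with the following three properties. 1. (Skew symmetry) $\phi_{k,l}(\vec a,v,\vec b)(w)=-(-1)^{(|\vec a|'+|v|')(|\vec b|'+|w|')}\phi_{l,k}(\vec b,w,\vec a)(v)$. 2. (Closedness) For every family $(a_1,\dots,a_n)$ and all $1\le i<j<k\le n$, $$(-1)^{K_j}\phi(\dots,\underline{a_i},\dots)(a_j)+(-1)^{K_k}\phi(\dots,\underline{a_j},\dots)(a_k)+(-1)^{K_i}\phi(\dots,\underline{a_k},\dots)(a_i)=0,$$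 where the module argument is underlined, the arguments, read with the last one, are the cyclic rotation of the family that ends in that last argument, e.g. $\phi(a_{j+1},\dots,a_n,a_1,\dots,\underline{a_i},\dots,a_{j-1})(a_j)$, and $K_s=(|a_1|'+\dots+|a_s|')(|a_{s+1}|'+\dots+|a_n|')$ is the Koszul sign of the rotation. 3. (Homological non-degeneracy) For every non-zero $[a]\in H^*(A)$ there is $[b]\in H^*(A)$ with $\phi_{0,0}(a)(b)\neq0$. Moreover, every strong homotopy inner product $\phi$ has the properties 1–3. Conversely, if an $A_\infty$-bimodule map $\phi:A\to A^*$ has the properties 1–3, then there are a minimal $A_\infty$-algebra $H$ (that is, $m_1=0$) and $A_\infty$-quasi-isomorphisms $h:H\to A$, $w:A\to H$ with $w\circ h=\mathrm{id}_H$ such that $\phi'=w^\sharp(h^\sharp\phi)$ is a strong homotopy inner product; and if $\phi_{0,0}$ is non-degenerate at chain level, i.e. an isomorphism from $A[1]$ to the graded dual $A^*$, then $\phi$ itself is a strong homotopy inner product. -/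

import Mathlib

universe v u u₁ u₂ u₃

namespace AInf

noncomputable section

/-! ### Graded vector spaces, words of homogeneous elements, signs -/

/-- A `ℤ`-graded vector space over `𝕜`. For an `A∞`-algebra `A` the graded space that is used is
`A[1]`, so that all degrees below are the shifted degrees `|x|' = |x| - 1`. -/
structure GradedSpace (𝕜 : Type v) [Field 𝕜] where
  /-- the homogeneous component of each degree -/
  carrier : ℤ → Type u
  [addCommGroup : ∀ d, AddCommGroup (carrier d)]
  [module : ∀ d, Module 𝕜 (carrier d)]

attribute [instance] GradedSpace.addCommGroup GradedSpace.module

/-- A homogeneous element, together with its degree. -/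
abbrev GradedSpace.El {𝕜 : Type v} [Field 𝕜] (V : GradedSpace.{v, u} 𝕜) : Type u :=
  Σ d : ℤ, V.carrier d

/-- A word `x₁ ⊗ ⋯ ⊗ xₙ` of homogeneous elements. -/
abbrev GradedSpace.Word {𝕜 : Type v} [Field 𝕜] (V : GradedSpace.{v, u} 𝕜) : Type u :=
  List V.El

/-- The total degree of a word. -/
def wdeg {𝕜 : Type v} [Field 𝕜] {V : GradedSpace.{v, u} 𝕜} (w : V.Word) : ℤ :=
  (w.map Sigma.fst).sum

/-- The sign `(-1)^n` as a scalar. -/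
def sgn (𝕜 : Type v) [Field 𝕜] (n : ℤ) : 𝕜 := ((n.negOnePow : ℤ) : 𝕜)

/-- All ways `w = w₁ w₂` to cut a word in two (possibly empty) parts. -/
def cuts {α : Type u} : List α → List (List α × List α)
  | [] => [([], [])]
  | x :: xs => ([], x :: xs) :: (cuts xs).map fun p => (x :: p.1, p.2)

/-- All ways `w = w₁ w₂ w₃` to cut a word in three (possibly empty) parts. -/
def cuts₃ {α : Type u} (w : List α) : List (List α × List α × List α) :=
  (cuts w).flatMap fun p => (cuts p.2).map fun q => (p.1, q.1, q.2)

/-- All ways to cut a word into consecutive nonempty blocks. -/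
def blocks {α : Type u} : List α → List (List (List α))
  | [] => [[]]
  | x :: xs => (blocks xs).flatMap fun p =>
      match p with
      | [] => [[[x]]]
      | b :: bs => [[x] :: b :: bs, (x :: b) :: bs]

/-- Linearity of a function of words in every letter. -/
def WordLinear {𝕜 : Type v} [Field 𝕜] {V : GradedSpace.{v, u₁} 𝕜} {N : Type u₂}
    [AddCommGroup N] [Module 𝕜 N] (F : V.Word → N) : Prop :=
  ∀ (xs ys : V.Word) (d : ℤ) (r : 𝕜) (a b : V.carrier d),
    F (xs ++ ⟨d, r • a + b⟩ :: ys) = r • F (xs ++ ⟨d, a⟩ :: ys) + F (xs ++ ⟨d, b⟩ :: ys)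

section Words

variable {𝕜 : Type v} [Field 𝕜] {V : GradedSpace.{v, u₁} 𝕜} {N : Type u₂}
  [AddCommGroup N] [Module 𝕜 N]

@[simp] theorem wdeg_nil : wdeg ([] : V.Word) = 0 := rfl

@[simp] theorem wdeg_cons (x : V.El) (w : V.Word) : wdeg (x :: w) = x.1 + wdeg w := by
  simp [wdeg]

@[simp] theorem wdeg_append (w w' : V.Word) : wdeg (w ++ w') = wdeg w + wdeg w' := by
  simp [wdeg]

theorem append_of_mem_cuts {α : Type u} {w : List α} {p : List α × List α}
    (h : p ∈ cuts w) : p.1 ++ p.2 = w := by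
  induction w generalizing p with
  | nil => simp only [cuts, List.mem_singleton] at h; subst h; rfl
  | cons x xs ih =>
    simp only [cuts, List.mem_cons, List.mem_map] at h
    rcases h with rfl | ⟨q, hq, rfl⟩
    · rfl
    · simp [ih hq]

theorem flatten_of_mem_blocks {α : Type u} {w : List α} {p : List (List α)}
    (h : p ∈ blocks w) : p.flatten = w := by
  induction w generalizing p with
  | nil => simp only [blocks, List.mem_singleton] at h; subst h; rfl
  | cons x xs ih =>
    simp only [blocks, List.mem_flatMap] at h
    obtain ⟨q, hq, hp⟩ := h
    have := ih hq
    cases q with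
    | nil => simp only [List.mem_singleton] at hp; subst hp; simpa using this
    | cons b bs =>
      simp only [List.mem_cons, List.not_mem_nil, or_false] at hp
      rcases hp with rfl | rfl <;> simpa using this

theorem wdeg_of_mem_cuts {w : V.Word} {p : V.Word × V.Word} (h : p ∈ cuts w) :
    wdeg p.1 + wdeg p.2 = wdeg w := by
  rw [← wdeg_append, append_of_mem_cuts h]

theorem sum_linear {ι : Type u} (l : List ι) (r : 𝕜) (F G H : ι → N)
    (h : ∀ i, F i = r • G i + H i) :
    (l.map F).sum = r • (l.map G).sum + (l.map H).sum := by
  induction l with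
  | nil => simp
  | cons i l ih =>
    simp only [List.map_cons, List.sum_cons, ih, h i, smul_add]
    abel

theorem sum_eq_zero {ι : Type u} (l : List ι) (F : ι → N) (h : ∀ i ∈ l, F i = 0) :
    (l.map F).sum = 0 := by
  apply List.sum_eq_zero
  intro x hx
  obtain ⟨i, hi, rfl⟩ := List.mem_map.1 hx
  exact h i hi

theorem WordLinear.zero : WordLinear (fun _ : V.Word => (0 : N)) := by
  intro xs ys d r a b; simp

theorem WordLinear.add {F G : V.Word → N} (hF : WordLinear F) (hG : WordLinear G) :
    WordLinear (fun w => F w + G w) := by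
  intro xs ys d r a b
  simp only [hF xs ys d r a b, hG xs ys d r a b, smul_add]
  abel

theorem WordLinear.sum {ι : Type u} {F : ι → V.Word → N} (l : List ι)
    (h : ∀ i, WordLinear (F i)) : WordLinear (fun w => (l.map fun i => F i w).sum) := by
  intro xs ys d r a b
  exact sum_linear l r _ _ _ fun i => h i xs ys d r a b

theorem WordLinear.cons {F : V.Word → N} (h : WordLinear F) (x : V.El) :
    WordLinear (fun w => F (x :: w)) := fun xs => h (x :: xs)

theorem WordLinear.append_left {F : V.Word → N} (h : WordLinear F) (w' : V.Word) :
    WordLinear (fun w => F (w' ++ w)) := by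
  intro xs ys d r a b
  simpa only [List.append_assoc] using h (w' ++ xs) ys d r a b

theorem WordLinear.append_right {F : V.Word → N} (h : WordLinear F) (w' : V.Word) :
    WordLinear (fun w => F (w ++ w')) := by
  intro xs ys d r a b
  simpa only [List.append_assoc, List.cons_append] using h xs (ys ++ w') d r a b

theorem WordLinear.sum_cuts {G : V.Word → V.Word → N}
    (h₁ : ∀ w₂, WordLinear fun w₁ => G w₁ w₂) (h₂ : ∀ w₁, WordLinear fun w₂ => G w₁ w₂) :
    WordLinear fun w => ((cuts w).map fun p => G p.1 p.2).sum := by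
  intro xs
  induction xs generalizing G with
  | nil =>
    intro ys d r a b
    simp only [List.nil_append, cuts, List.map_cons, List.map_map, List.sum_cons,
      Function.comp_def]
    have e₁ := h₂ [] [] ys d r a b
    have e₂ := sum_linear (cuts ys) r _ _ _ fun p => h₁ p.2 [] p.1 d r a b
    simp only [List.nil_append] at e₁ e₂
    rw [e₁, e₂]
    simp only [smul_add]
    abel
  | cons x xs ih =>
    intro ys d r a b
    simp only [List.cons_append, cuts, List.map_cons, List.map_map, List.sum_cons,
      Function.comp_def]
    have e₁ := h₂ [] (x :: xs) ys d r a b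
    have e₂ := @ih (fun w₁ w₂ => G (x :: w₁) w₂) (fun w₂ => (h₁ w₂).cons x)
      (fun w₁ => h₂ (x :: w₁)) ys d r a b
    simp only [List.cons_append] at e₁ e₂
    rw [e₁, e₂]
    simp only [smul_add]
    abel

theorem WordLinear.sum_blocks {F : List V.Word → N}
    (h : ∀ P Q, WordLinear fun w => F (P ++ w :: Q)) :
    WordLinear fun w => ((blocks w).map F).sum := by
  have key : ∀ (G : List V.Word → N) (x : V.El) (w : V.Word),
      ((blocks (x :: w)).map G).sum = ((blocks w).map fun p =>
        (match p with
          | [] => G [[x]]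
          | b :: bs => G ([x] :: b :: bs) + G ((x :: b) :: bs))).sum := by
    intro G x w
    simp only [blocks]
    induction blocks w with
    | nil => simp
    | cons p l ih =>
      simp only [List.flatMap_cons, List.map_append, List.sum_append, List.map_cons,
        List.sum_cons, ih]
      cases p <;> simp
  intro xs
  induction xs generalizing F with
  | nil =>
    intro ys d r a b
    simp only [List.nil_append, key]
    apply sum_linear
    intro p
    cases p with
    | nil => simpa using h [] [] [] [] d r a b
    | cons c cs =>
      have e₁ := h [] (c :: cs) [] [] d r a b
      have e₂ := h [] cs [] c d r a b
      simp only [List.nil_append] at e₁ e₂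
      simp only [e₁, e₂, smul_add]
      abel
  | cons x xs ih =>
    intro ys d r a b
    simp only [List.cons_append, key]
    refine ih ?_ ys d r a b
    intro P Q
    cases P with
    | nil =>
      simp only [List.nil_append]
      exact (h [[x]] Q).add ((h [] Q).cons x)
    | cons c cs =>
      simp only [List.cons_append]
      exact (h ([x] :: c :: cs) Q).add (h ((x :: c) :: cs) Q)

end Words

/-! ### Multilinear operations -/

/-- A family of multilinear maps `V^{⊗ n} → W` (`n ≥ 0`), homogeneous of degree `p`.
`toFun w e` is the component in degree `e` of the value on the word `w`; the only component that
can be nonzero is the one of degree `|w| + p`. -/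
@[ext]
structure MultiMap {𝕜 : Type v} [Field 𝕜] (V : GradedSpace.{v, u₁} 𝕜)
    (W : GradedSpace.{v, u₂} 𝕜) (p : ℤ) where
  toFun : V.Word → ∀ e : ℤ, W.carrier e
  linear : ∀ e, WordLinear fun w => toFun w e
  degree : ∀ w e, e ≠ wdeg w + p → toFun w e = 0

/-- The value on a word, as a homogeneous element. -/
def MultiMap.el {𝕜 : Type v} [Field 𝕜] {V : GradedSpace.{v, u₁} 𝕜}
    {W : GradedSpace.{v, u₂} 𝕜} {p : ℤ} (f : MultiMap V W p) (w : V.Word) : W.El :=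
  ⟨wdeg w + p, f.toFun w (wdeg w + p)⟩

theorem MultiMap.el_eq {𝕜 : Type v} [Field 𝕜] {V : GradedSpace.{v, u₁} 𝕜}
    {W : GradedSpace.{v, u₂} 𝕜} {p : ℤ} (f : MultiMap V W p) (w : V.Word) (e : ℤ)
    (h : wdeg w + p = e) : f.el w = ⟨e, f.toFun w e⟩ := by
  subst h; rfl

/-- A family of multilinear maps `A^{⊗ k} ⊗ M ⊗ A^{⊗ l} → N` (`k, l ≥ 0`), homogeneous of degree
`p`. `toFun x v y e` is the component in degree `e` of the value on `x ⊗ v ⊗ y`, where `x` and `y`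
are words in `A`; the only component that can be nonzero is the one of degree
`|x| + |v| + |y| + p`. -/
@[ext]
structure BiMap {𝕜 : Type v} [Field 𝕜] (A : GradedSpace.{v, u₁} 𝕜) (M : GradedSpace.{v, u₂} 𝕜)
    (N : GradedSpace.{v, u₃} 𝕜) (p : ℤ) where
  toFun : A.Word → M.El → A.Word → ∀ e : ℤ, N.carrier e
  left_linear : ∀ v y e, WordLinear fun x => toFun x v y e
  mid_linear : ∀ (x y : A.Word) (d : ℤ) (r : 𝕜) (a b : M.carrier d) (e : ℤ),
    toFun x ⟨d, r • a + b⟩ y e = r • toFun x ⟨d, a⟩ y e + toFun x ⟨d, b⟩ y e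
  right_linear : ∀ x v e, WordLinear fun y => toFun x v y e
  degree : ∀ x v y e, e ≠ wdeg x + v.1 + wdeg y + p → toFun x v y e = 0

namespace BiMap

variable {𝕜 : Type v} [Field 𝕜]

/-- The value on `x ⊗ v ⊗ y`, as a homogeneous element. -/
def el {A : GradedSpace.{v, u₁} 𝕜} {M : GradedSpace.{v, u₂} 𝕜} {N : GradedSpace.{v, u₃} 𝕜}
    {p : ℤ} (f : BiMap A M N p) (x : A.Word) (v : M.El) (y : A.Word) : N.El :=
  ⟨wdeg x + v.1 + wdeg y + p, f.toFun x v y (wdeg x + v.1 + wdeg y + p)⟩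

theorem el_eq {A : GradedSpace.{v, u₁} 𝕜} {M : GradedSpace.{v, u₂} 𝕜}
    {N : GradedSpace.{v, u₃} 𝕜} {p : ℤ} (f : BiMap A M N p) (x : A.Word) (v : M.El)
    (y : A.Word) (e : ℤ) (h : wdeg x + v.1 + wdeg y + p = e) :
    f.el x v y = ⟨e, f.toFun x v y e⟩ := by
  subst h; rfl

/-- The composition `h ∘ ĝ`, where
`ĝ(x ⊗ v ⊗ y) = ∑ x₁ ⊗ g(x₂ ⊗ v ⊗ y₁) ⊗ y₂` over all cuts `x = x₁ x₂`, `y = y₁ y₂`. -/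
def comp {A : GradedSpace.{v, u} 𝕜} {M : GradedSpace.{v, u₁} 𝕜} {N : GradedSpace.{v, u₂} 𝕜}
    {L : GradedSpace.{v, u₃} 𝕜} (h : BiMap A N L 0) (g : BiMap A M N 0) : BiMap A M L 0 where
  toFun x v y e := ((cuts x).map fun p => ((cuts y).map fun q =>
    h.toFun p.1 (g.el p.2 v q.1) q.2 e).sum).sum
  left_linear v y e := by
    apply WordLinear.sum_cuts (G := fun x₁ x₂ => ((cuts y).map fun q =>
      h.toFun x₁ (g.el x₂ v q.1) q.2 e).sum)
    · intro x₂
      exact WordLinear.sum _ fun q => h.left_linear _ _ _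
    · intro x₁
      refine WordLinear.sum _ fun q => ?_
      intro xs ys d r a b
      have := g.left_linear v q.1 (wdeg xs + d + wdeg ys + v.1 + wdeg q.1) xs ys d r a b
      simp only at this ⊢
      iterate 3 rw [g.el_eq _ _ _ (wdeg xs + d + wdeg ys + v.1 + wdeg q.1) (by simp; ring)]
      rw [this, h.mid_linear]
  mid_linear x y d r a b e := by
    refine sum_linear _ _ _ _ _ fun p => sum_linear _ _ _ _ _ fun q => ?_
    iterate 3 rw [g.el_eq _ _ _ (wdeg p.2 + d + wdeg q.1) (by simp)]
    rw [g.mid_linear, h.mid_linear]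
  right_linear x v e := by
    refine WordLinear.sum _ fun p => ?_
    apply WordLinear.sum_cuts (G := fun y₁ y₂ => h.toFun p.1 (g.el p.2 v y₁) y₂ e)
    · intro y₂ xs ys d r a b
      have := g.right_linear p.2 v (wdeg xs + d + wdeg ys + v.1 + wdeg p.2) xs ys d r a b
      simp only at this ⊢
      iterate 3 rw [g.el_eq _ _ _ (wdeg xs + d + wdeg ys + v.1 + wdeg p.2) (by simp; ring)]
      rw [this, h.mid_linear]
    · intro y₁
      exact h.right_linear _ _ _
  degree x v y e he := by
    refine sum_eq_zero _ _ fun p hp => sum_eq_zero _ _ fun q hq => h.degree _ _ _ _ ?_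
    have h₁ := wdeg_of_mem_cuts hp
    have h₂ := wdeg_of_mem_cuts hq
    simp only [el]
    omega

/-- Pullback along a degree zero family `f`, in particular along an `A∞`-homomorphism `f : A → B`:
`(x, v, y) ↦ χ(f̂(x) ⊗ v ⊗ f̂(y))`, where `f̂(x) = ∑ f(x₁) ⊗ ⋯ ⊗ f(xᵣ)` over all ways to cut `x` in
consecutive nonempty blocks. Applied to the structure maps of an `A∞`-bimodule over `B`, it gives
the induced `A∞`-bimodule over `A`; applied to a map of `A∞`-bimodules over `B`, it gives the
induced map of `A∞`-bimodules over `A`. -/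
def pull {A : GradedSpace.{v, u} 𝕜} {B : GradedSpace.{v, u₁} 𝕜} {M : GradedSpace.{v, u₂} 𝕜}
    {N : GradedSpace.{v, u₃} 𝕜} {p : ℤ} (f : MultiMap A B 0) (χ : BiMap B M N p) :
    BiMap A M N p where
  toFun x v y e := ((blocks x).map fun s => ((blocks y).map fun t =>
    χ.toFun (s.map f.el) v (t.map f.el) e).sum).sum
  left_linear v y e := by
    apply WordLinear.sum_blocks (F := fun s => ((blocks y).map fun t =>
      χ.toFun (s.map f.el) v (t.map f.el) e).sum)
    intro P Q
    refine WordLinear.sum _ fun t => ?_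
    intro xs ys d r a b
    have := f.linear (wdeg xs + d + wdeg ys) xs ys d r a b
    simp only [List.map_append, List.map_cons] at this ⊢
    iterate 3 rw [f.el_eq _ (wdeg xs + d + wdeg ys) (by simp; ring)]
    rw [this]
    exact χ.left_linear _ _ _ _ _ _ _ _ _
  mid_linear x y d r a b e :=
    sum_linear _ _ _ _ _ fun s => sum_linear _ _ _ _ _ fun t => χ.mid_linear _ _ _ _ _ _ _
  right_linear x v e := by
    refine WordLinear.sum _ fun s => ?_
    apply WordLinear.sum_blocks (F := fun t => χ.toFun (s.map f.el) v (t.map f.el) e)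
    intro P Q xs ys d r a b
    have := f.linear (wdeg xs + d + wdeg ys) xs ys d r a b
    simp only [List.map_append, List.map_cons] at this ⊢
    iterate 3 rw [f.el_eq _ (wdeg xs + d + wdeg ys) (by simp; ring)]
    rw [this]
    exact χ.right_linear _ _ _ _ _ _ _ _ _
  degree x v y e he := by
    have key : ∀ s : List A.Word, wdeg (s.map f.el) = wdeg s.flatten := by
      intro s
      induction s with
      | nil => rfl
      | cons b s ih => simp [ih, MultiMap.el]
    refine sum_eq_zero _ _ fun s hs => sum_eq_zero _ _ fun t ht => χ.degree _ _ _ _ ?_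
    rw [key, key, flatten_of_mem_blocks hs, flatten_of_mem_blocks ht]
    exact he

end BiMap

/-- The map `A^{⊗ k} ⊗ A ⊗ A^{⊗ l} → B` given by `f_{k+l+1}`. For the structure maps `m` of an
`A∞`-algebra these are the structure maps of `A` as an `A∞`-bimodule over itself; for an
`A∞`-homomorphism `f` it is the induced bimodule map `f̃`. -/
def MultiMap.diag {𝕜 : Type v} [Field 𝕜] {A : GradedSpace.{v, u₁} 𝕜}
    {B : GradedSpace.{v, u₂} 𝕜} {p : ℤ} (f : MultiMap A B p) : BiMap A A B p where
  toFun x v y e := f.toFun (x ++ v :: y) e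
  left_linear v y e := (f.linear e).append_right (v :: y)
  mid_linear x y d r a b e := f.linear e x y d r a b
  right_linear x v e := by
    intro xs ys d r a b
    simpa only [List.append_assoc, List.cons_append] using f.linear e (x ++ v :: xs) ys d r a b
  degree x v y e he := f.degree _ _ (by simp only [wdeg_append, wdeg_cons]; omega)

/-! ### Dual spaces -/

/-- The (shifted) graded dual of `V`: a homogeneous element of degree `e` is a linear functional on
`V` that vanishes on all components except the one of degree `d` with `d + e + c = 0`. -/
def GradedSpace.dual {𝕜 : Type v} [Field 𝕜] (V : GradedSpace.{v, u} 𝕜) (c : ℤ) :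
    GradedSpace.{v, max u v} 𝕜 where
  carrier e := ({ carrier := {φ : ∀ d, V.carrier d →ₗ[𝕜] 𝕜 | ∀ d, d + e + c ≠ 0 → φ d = 0}
                  add_mem' := fun ha hb d hd => by simp [ha d hd, hb d hd]
                  zero_mem' := fun d _ => rfl
                  smul_mem' := fun r a ha d hd => by simp [ha d hd] } :
    Submodule 𝕜 (∀ d, V.carrier d →ₗ[𝕜] 𝕜))

/-- The value of a functional on a homogeneous element. -/
def GradedSpace.dualEval {𝕜 : Type v} [Field 𝕜] {V : GradedSpace.{v, u} 𝕜} {c e : ℤ}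
    (φ : (V.dual c).carrier e) (x : V.El) : 𝕜 := φ.1 x.1 x.2

section Dual

variable {𝕜 : Type v} [Field 𝕜] {V : GradedSpace.{v, u} 𝕜} {c e : ℤ}

theorem GradedSpace.dualEval_add_smul (φ : (V.dual c).carrier e) (d : ℤ) (r : 𝕜)
    (a b : V.carrier d) : GradedSpace.dualEval φ ⟨d, r • a + b⟩ =
      r * GradedSpace.dualEval φ ⟨d, a⟩ + GradedSpace.dualEval φ ⟨d, b⟩ :=
  ((φ.1 d).map_add (r • a) b).trans (congrArg (· + φ.1 d b) ((φ.1 d).map_smul r a))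

theorem GradedSpace.add_smul_dualEval (φ ψ : (V.dual c).carrier e) (r : 𝕜) (x : V.El) :
    GradedSpace.dualEval (r • φ + ψ) x =
      r * GradedSpace.dualEval φ x + GradedSpace.dualEval ψ x := rfl

theorem GradedSpace.dualEval_zero (x : V.El) :
    GradedSpace.dualEval (0 : (V.dual c).carrier e) x = 0 := rfl

theorem GradedSpace.dualEval_eq_zero (φ : (V.dual c).carrier e) (x : V.El)
    (h : x.1 + e + c ≠ 0) : GradedSpace.dualEval φ x = 0 :=
  LinearMap.congr_fun (φ.2 x.1 h) x.2

theorem GradedSpace.dual_ext {φ ψ : (V.dual c).carrier e}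
    (h : ∀ x : V.El, GradedSpace.dualEval φ x = GradedSpace.dualEval ψ x) : φ = ψ :=
  Subtype.ext (funext fun d => LinearMap.ext fun x => h ⟨d, x⟩)

/-- A function on homogeneous elements that is linear on every component and supported in the right
degree, as a functional. -/
def GradedSpace.dualMk (F : V.El → 𝕜)
    (hF : ∀ (d : ℤ) (r : 𝕜) (a b : V.carrier d), F ⟨d, r • a + b⟩ = r * F ⟨d, a⟩ + F ⟨d, b⟩)
    (h₀ : ∀ x : V.El, x.1 + e + c ≠ 0 → F x = 0) : (V.dual c).carrier e :=
  ⟨fun d =>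
    { toFun := fun a => F ⟨d, a⟩
      map_add' := fun a b => by simpa using hF d 1 a b
      map_smul' := fun r a => by
        have h := hF d 1 0 0
        have h' := hF d r a 0
        simp only [smul_zero, add_zero, one_mul, left_eq_add] at h h'
        simpa [h] using h' },
    fun d hd => LinearMap.ext fun a => h₀ ⟨d, a⟩ hd⟩

@[simp] theorem GradedSpace.dualEval_dualMk (F : V.El → 𝕜)
    (hF : ∀ (d : ℤ) (r : 𝕜) (a b : V.carrier d), F ⟨d, r • a + b⟩ = r * F ⟨d, a⟩ + F ⟨d, b⟩)
    (h₀ : ∀ x : V.El, x.1 + e + c ≠ 0 → F x = 0) (x : V.El) :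
    GradedSpace.dualEval (GradedSpace.dualMk (c := c) (e := e) F hF h₀) x = F x := rfl

end Dual

section Transpose

open GradedSpace

variable {𝕜 : Type v} [Field 𝕜] {A : GradedSpace.{v, u₁} 𝕜} {M : GradedSpace.{v, u₂} 𝕜}
  {N : GradedSpace.{v, u₃} 𝕜} {p : ℤ}

/-- `(-1)^{p (1 + |φ|) + |x| (|φ| + |y| + |w|)} φ(g(y ⊗ w ⊗ x))` -/
def BiMap.transposeVal {c : ℤ} (g : BiMap A M N p) (x : A.Word) (φ : (N.dual c).El) (y : A.Word)
    (w : M.El) : 𝕜 :=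
  sgn 𝕜 (p * (1 + φ.1) + wdeg x * (φ.1 + wdeg y + w.1)) * dualEval φ.2 (g.el y w x)

theorem BiMap.transposeVal_eq_zero {c : ℤ} (g : BiMap A M N p) (x : A.Word) (φ : (N.dual c).El)
    (y : A.Word) (w : M.El) (e : ℤ) (h : w.1 + e + c ≠ 0)
    (he : e = wdeg x + φ.1 + wdeg y + p) : g.transposeVal x φ y w = 0 := by
  rw [transposeVal, dualEval_eq_zero, mul_zero]
  simp only [BiMap.el]
  omega

theorem BiMap.transposeVal_left {c : ℤ} (g : BiMap A M N p) (φ : (N.dual c).El) (y : A.Word)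
    (w : M.El) : WordLinear fun x => g.transposeVal x φ y w := by
  intro xs ys d r a b
  have := g.right_linear y w (wdeg y + w.1 + (wdeg xs + d + wdeg ys) + p) xs ys d r a b
  simp only [transposeVal] at this ⊢
  iterate 3 rw [g.el_eq _ _ _ (wdeg y + w.1 + (wdeg xs + d + wdeg ys) + p) (by simp; ring)]
  rw [this, dualEval_add_smul]
  simp only [wdeg_append, wdeg_cons, smul_eq_mul]
  ring

theorem BiMap.transposeVal_right {c : ℤ} (g : BiMap A M N p) (x : A.Word) (φ : (N.dual c).El)
    (w : M.El) : WordLinear fun y => g.transposeVal x φ y w := by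
  intro xs ys d r a b
  have := g.left_linear w x ((wdeg xs + d + wdeg ys) + w.1 + wdeg x + p) xs ys d r a b
  simp only [transposeVal] at this ⊢
  iterate 3 rw [g.el_eq _ _ _ ((wdeg xs + d + wdeg ys) + w.1 + wdeg x + p) (by simp; ring)]
  rw [this, dualEval_add_smul]
  simp only [wdeg_append, wdeg_cons, smul_eq_mul]
  ring

theorem BiMap.transposeVal_arg {c : ℤ} (g : BiMap A M N p) (x : A.Word) (φ : (N.dual c).El)
    (y : A.Word) (d : ℤ) (r : 𝕜) (a b : M.carrier d) :
    g.transposeVal x φ y ⟨d, r • a + b⟩ =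
      r * g.transposeVal x φ y ⟨d, a⟩ + g.transposeVal x φ y ⟨d, b⟩ := by
  simp only [transposeVal, BiMap.el, g.mid_linear, dualEval_add_smul]
  ring

/-- The transpose `N^* → M^*` of a family `g : M → N` of degree `p`,
`g^*(x ⊗ φ ⊗ y)(w) = (-1)^{p (1 + |φ|) + |x| (|φ| + |y| + |w|)} φ(g(y ⊗ w ⊗ x))`.
For `p = 0` this is the dual of a map of `A∞`-bimodules. For `p = 1` and the structure maps `b` of
an `A∞`-bimodule `M` these are the structure maps `b^*` of the dual `A∞`-bimodule `M^*`. -/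
def BiMap.transpose (c : ℤ) (g : BiMap A M N p) : BiMap A (N.dual c) (M.dual c) p where
  toFun x φ y e :=
    if he : e = wdeg x + φ.1 + wdeg y + p then
      dualMk (g.transposeVal x φ y) (g.transposeVal_arg x φ y)
        fun w hw => g.transposeVal_eq_zero x φ y w e hw he
    else 0
  left_linear φ y e := by
    intro xs ys d r a b
    have h : ∀ z : A.carrier d, wdeg (xs ++ ⟨d, z⟩ :: ys) = wdeg xs + (d + wdeg ys) := by
      simp
    by_cases he : e = wdeg xs + (d + wdeg ys) + φ.1 + wdeg y + p
    · simp only [h, dif_pos he]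
      exact dual_ext fun w => g.transposeVal_left φ y w xs ys d r a b
    · simp [h, dif_neg he]
  mid_linear x y d r a b e := by
    by_cases he : e = wdeg x + d + wdeg y + p
    · simp only [dif_pos he]
      refine dual_ext fun w => ?_
      simp only [add_smul_dualEval, dualEval_dualMk, transposeVal]
      ring
    · simp [dif_neg he]
  right_linear x φ e := by
    intro xs ys d r a b
    have h : ∀ z : A.carrier d, wdeg (xs ++ ⟨d, z⟩ :: ys) = wdeg xs + (d + wdeg ys) := by
      simp
    by_cases he : e = wdeg x + φ.1 + (wdeg xs + (d + wdeg ys)) + p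
    · simp only [h, dif_pos he]
      exact dual_ext fun w => g.transposeVal_right x φ w xs ys d r a b
    · simp [h, dif_neg he]
  degree x φ y e he := dif_neg he

end Transpose

/-! ### `A∞`-algebras -/

/-- A strict `A∞`-algebra (`m₀ = 0`), in the shifted convention: operations `mₙ` of degree one on
`A[1]` with `∑ (-1)^{|x₁|} m(x₁ ⊗ m(x₂) ⊗ x₃) = 0`, the sum over all cuts of a word in three
subwords. -/
structure AInfAlgebra (𝕜 : Type v) [Field 𝕜] where
  /-- the graded space `A[1]` -/
  space : GradedSpace.{v, u} 𝕜
  /-- the operations -/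
  m : MultiMap space space 1
  m_nil : ∀ e, m.toFun [] e = 0
  relation : ∀ (w : space.Word) (e : ℤ),
    ((cuts₃ w).map fun p =>
      sgn 𝕜 (wdeg p.1) • m.toFun (p.1 ++ m.el p.2.1 :: p.2.2) e).sum = 0

/-- An `A∞`-homomorphism: a family `fₙ` (`n ≥ 1`) of degree zero with
`∑ m^B(f(x₁) ⊗ ⋯ ⊗ f(xᵣ)) = ∑ (-1)^{|x₁|} f(x₁ ⊗ m^A(x₂) ⊗ x₃)`. -/
structure AInfHom {𝕜 : Type v} [Field 𝕜] (A : AInfAlgebra.{v, u₁} 𝕜)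
    (B : AInfAlgebra.{v, u₂} 𝕜) where
  /-- the family of multilinear maps -/
  f : MultiMap A.space B.space 0
  f_nil : ∀ e, f.toFun [] e = 0
  relation : ∀ (w : A.space.Word) (e : ℤ),
    ((blocks w).map fun s => B.m.toFun (s.map f.el) e).sum =
      ((cuts₃ w).map fun p =>
        sgn 𝕜 (wdeg p.1) • f.toFun (p.1 ++ A.m.el p.2.1 :: p.2.2) e).sum

/-- The linear part of a family of multilinear maps: its component `V_d → W_e`. -/
def MultiMap.linearPart {𝕜 : Type v} [Field 𝕜] {V : GradedSpace.{v, u₁} 𝕜}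
    {W : GradedSpace.{v, u₂} 𝕜} {p : ℤ} (f : MultiMap V W p) (d e : ℤ) :
    V.carrier d →ₗ[𝕜] W.carrier e where
  toFun x := f.toFun [⟨d, x⟩] e
  map_add' x y := by simpa using f.linear e [] [] d 1 x y
  map_smul' r x := by
    have h := f.linear e [] [] d 1 0 0
    have h' := f.linear e [] [] d r x 0
    simp only [List.nil_append, smul_zero, add_zero, one_smul, left_eq_add] at h h'
    simpa [h] using h'

namespace AInfAlgebra

variable {𝕜 : Type v} [Field 𝕜] (A : AInfAlgebra.{v, u} 𝕜)

/-- The cycles of the differential `m₁` in degree `d`. -/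
def cycles (d : ℤ) : Submodule 𝕜 (A.space.carrier d) :=
  LinearMap.ker (A.m.linearPart d (d + 1))

/-- The boundaries of the differential `m₁` in degree `d`. -/
def boundaries (d : ℤ) : Submodule 𝕜 (A.space.carrier d) :=
  LinearMap.range (A.m.linearPart (d - 1) d)

/-- The homology of `(A, m₁)` in (shifted) degree `d`. -/
abbrev Homology (d : ℤ) : Type u :=
  A.cycles d ⧸ (A.boundaries d).submoduleOf (A.cycles d)

/-- An `A∞`-algebra is minimal if `m₁ = 0`. -/
def IsMinimal : Prop := ∀ d e, A.m.linearPart d e = 0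

end AInfAlgebra

/-- An `A∞`-quasi-isomorphism: `f₁` induces a bijection on homology. -/
structure AInfHom.IsQuasiIso {𝕜 : Type v} [Field 𝕜] {A : AInfAlgebra.{v, u₁} 𝕜}
    {B : AInfAlgebra.{v, u₂} 𝕜} (f : AInfHom A B) : Prop where
  injective : ∀ d, ∀ x ∈ A.cycles d, f.f.linearPart d d x ∈ B.boundaries d → x ∈ A.boundaries d
  surjective : ∀ d, ∀ y ∈ B.cycles d, ∃ x ∈ A.cycles d, y - f.f.linearPart d d x ∈ B.boundaries d

/-- `w ∘ h = id` for `A∞`-homomorphisms `h : A → B` and `w : B → A`: the composition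
`∑ w(h(x₁) ⊗ ⋯ ⊗ h(xᵣ))` over all cuts of a word in nonempty blocks is the identity on words of
length one and zero on all longer words. -/
def AInfHom.IsLeftInverse {𝕜 : Type v} [Field 𝕜] {A : AInfAlgebra.{v, u₁} 𝕜}
    {B : AInfAlgebra.{v, u₂} 𝕜} (w : AInfHom B A) (h : AInfHom A B) : Prop :=
  (∀ d (x : A.space.carrier d),
    ((blocks [(⟨d, x⟩ : A.space.El)]).map fun s => w.f.toFun (s.map h.f.el) d).sum = x) ∧
  ∀ xs : A.space.Word, 2 ≤ xs.length → ∀ e,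
    ((blocks xs).map fun s => w.f.toFun (s.map h.f.el) e).sum = 0

/-! ### `A∞`-bimodule maps -/

/-- `φ : M → N` is a map of `A∞`-bimodules over `A`, where `bM` and `bN` are the structure maps of
`M` and `N`: it satisfies `φ ∘ b̂M = bN ∘ φ̂`. The three sums on the left are the terms of `b̂M` in
which `m` is applied to the left of the element of `M`, `bM` is applied, and `m` is applied to the
right. -/
def IsBimoduleMap {𝕜 : Type v} [Field 𝕜] (A : AInfAlgebra.{v, u₁} 𝕜) {M : GradedSpace.{v, u₂} 𝕜}
    {N : GradedSpace.{v, u₃} 𝕜} (bM : BiMap A.space M M 1) (bN : BiMap A.space N N 1)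
    (φ : BiMap A.space M N 0) : Prop :=
  ∀ (x : A.space.Word) (v : M.El) (y : A.space.Word) (e : ℤ),
    ((cuts₃ x).map fun p =>
        sgn 𝕜 (wdeg p.1) • φ.toFun (p.1 ++ A.m.el p.2.1 :: p.2.2) v y e).sum +
      ((cuts x).map fun p => ((cuts y).map fun q =>
        sgn 𝕜 (wdeg p.1) • φ.toFun p.1 (bM.el p.2 v q.1) q.2 e).sum).sum +
      ((cuts₃ y).map fun q =>
        sgn 𝕜 (wdeg x + v.1 + wdeg q.1) •
          φ.toFun x v (q.1 ++ A.m.el q.2.1 :: q.2.2) e).sum =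
    ((cuts x).map fun p => ((cuts y).map fun q =>
      bN.toFun p.1 (φ.el p.2 v q.1) q.2 e).sum).sum

/-- Families of multilinear maps `A^{⊗ k} ⊗ A ⊗ A^{⊗ l} → A^*`, of degree zero with respect to the
shift of the dual by `c`; that is, `φ(x ⊗ v ⊗ y)(w)` is zero unless `|x| + |v| + |y| + |w| + c = 0`
(with the shifted degrees). -/
abbrev DualFamily {𝕜 : Type v} [Field 𝕜] (A : AInfAlgebra.{v, u} 𝕜) (c : ℤ) : Type (max u v) :=
  BiMap A.space A.space (A.space.dual c) 0

namespace DualFamily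

open GradedSpace

variable {𝕜 : Type v} [Field 𝕜] {A : AInfAlgebra.{v, u₁} 𝕜} {B : AInfAlgebra.{v, u₂} 𝕜} {c : ℤ}

/-- The scalar `φ(x ⊗ v ⊗ y)(w)`. -/
def form (φ : DualFamily A c) (x : A.space.Word) (v : A.space.El) (y : A.space.Word)
    (w : A.space.El) : 𝕜 := dualEval (φ.el x v y).2 w

/-- `φ : A → A^*` is a map of `A∞`-bimodules over `A`. -/
def IsBimoduleMap (φ : DualFamily A c) : Prop :=
  AInf.IsBimoduleMap A A.m.diag (A.m.diag.transpose c) φ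

/-- For an `A∞`-homomorphism `f : A → B` and `χ : B → B^*`, the composition
`A → B → B^* → A^*` of `f̃`, of the map induced by `χ`, and of the dual of `f̃`. -/
def pullback (f : AInfHom A B) (χ : DualFamily B c) : DualFamily A c :=
  BiMap.comp (f.f.diag.transpose c) (BiMap.comp (BiMap.pull f.f χ) f.f.diag)

/-- Skew symmetry. -/
def IsSkew (φ : DualFamily A c) : Prop :=
  ∀ (x y : A.space.Word) (v w : A.space.El),
    φ.form x v y w = -(sgn 𝕜 ((wdeg x + v.1) * (wdeg y + w.1)) * φ.form y w x v)

/-- Closedness. The family `(a₁, …, aₙ)` is written as `P, a, Q, b, R, d, S`, where `a`, `b`, `d`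
are its entries at the chosen places `i < j < k`. The sign of every term is the Koszul sign of the
cyclic rotation that takes the family to the order in which it appears in that term. -/
def IsClosed (φ : DualFamily A c) : Prop :=
  ∀ (P Q R S : A.space.Word) (a b d : A.space.El),
    sgn 𝕜 (wdeg (P ++ a :: Q ++ [b]) * wdeg (R ++ d :: S)) * φ.form (R ++ d :: S ++ P) a Q b +
    sgn 𝕜 (wdeg (P ++ a :: Q ++ b :: R ++ [d]) * wdeg S) * φ.form (S ++ P ++ a :: Q) b R d +
    sgn 𝕜 (wdeg (P ++ [a]) * wdeg (Q ++ b :: R ++ d :: S)) * φ.form (Q ++ b :: R) d (S ++ P) a = 0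

/-- Homological non-degeneracy: for every nonzero homology class `[a]` there is a homology class
`[b]` with `φ₀₀(a)(b) ≠ 0`. -/
def IsHomologicallyNondegenerate (φ : DualFamily A c) : Prop :=
  ∀ d, ∀ a ∈ A.cycles d, a ∉ A.boundaries d →
    ∃ e, ∃ b ∈ A.cycles e, φ.form [] ⟨d, a⟩ [] ⟨e, b⟩ ≠ 0

/-- Chain level non-degeneracy: `φ₀₀` is an isomorphism from `A` to its graded dual. -/
def IsNondegenerate (φ : DualFamily A c) : Prop :=
  ∀ d, Function.Bijective fun a : A.space.carrier d => φ.toFun [] ⟨d, a⟩ [] d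

end DualFamily

/-! ### Cyclic symmetric inner products -/

/-- A cyclic symmetric inner product of degree `c` on (the shifted space of) an `A∞`-algebra. The
pairing is non-degenerate in the sense that it identifies every component `B_d` with the dual of
`B_e`, where `d + e + c = 0`. -/
structure CyclicInnerProduct {𝕜 : Type v} [Field 𝕜] (B : AInfAlgebra.{v, u} 𝕜) (c : ℤ) where
  /-- the pairing `⟨x, y⟩` -/
  pair : ∀ d e : ℤ, B.space.carrier d →ₗ[𝕜] B.space.carrier e →ₗ[𝕜] 𝕜
  degree : ∀ d e, d + e + c ≠ 0 → pair d e = 0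
  skew : ∀ d e x y, pair d e x y = -(sgn 𝕜 (d * e) * pair e d y x)
  nondegenerate : ∀ d e, d + e + c = 0 → Function.Bijective (pair d e)
  cyclic : ∀ (x : B.space.El) (w : B.space.Word) (y : B.space.El),
    pair _ _ (B.m.el (x :: w)).2 y.2 =
      sgn 𝕜 (x.1 * (wdeg w + y.1)) * pair _ _ (B.m.el (w ++ [y])).2 x.2

/-- The map `ψ : B → B^*` of an inner product: `ψ₀₀(x)(y) = ⟨x, y⟩` and `ψₖₗ = 0` for
`(k, l) ≠ (0, 0)`. -/
def CyclicInnerProduct.toDualFamily {𝕜 : Type v} [Field 𝕜] {B : AInfAlgebra.{v, u} 𝕜} {c : ℤ}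
    (P : CyclicInnerProduct B c) : DualFamily B c where
  toFun x v y e :=
    if h : x = [] ∧ y = [] ∧ e = v.1 then
      GradedSpace.dualMk (fun w => P.pair v.1 w.1 v.2 w.2)
        (fun d r a b => by simp only [map_add, map_smul, smul_eq_mul])
        (fun w hw => by rw [P.degree v.1 w.1 (by omega)]; rfl)
    else 0
  left_linear v y e := by
    intro xs ys d r a b
    simp
  mid_linear x y d r a b e := by
    by_cases h : x = [] ∧ y = [] ∧ e = d
    · rw [dif_pos h, dif_pos h, dif_pos h]
      refine GradedSpace.dual_ext fun w => ?_
      simp only [GradedSpace.add_smul_dualEval, GradedSpace.dualEval_dualMk, map_add, map_smul,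
        LinearMap.add_apply, LinearMap.smul_apply, smul_eq_mul]
    · rw [dif_neg h, dif_neg h, dif_neg h, smul_zero, add_zero]
  right_linear x v e := by
    intro xs ys d r a b
    simp
  degree x v y e he := by
    apply dif_neg
    rintro ⟨rfl, rfl, h⟩
    simp at he
    exact he h

/-- `φ : A → A^*` is a strong homotopy inner product: it is a map of `A∞`-bimodules over `A`, and
there are an `A∞`-algebra `B` with a cyclic symmetric inner product and an `A∞`-quasi-isomorphism
`f : A → B` such that `φ` is the composition `A → B → B^* → A^*`. -/
def DualFamily.IsStrongHomotopyInnerProduct {𝕜 : Type v} [Field 𝕜] {A : AInfAlgebra.{v, u} 𝕜}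
    {c : ℤ} (φ : DualFamily A c) : Prop :=
  φ.IsBimoduleMap ∧
    ∃ (B : AInfAlgebra.{v, u} 𝕜) (P : CyclicInnerProduct B c) (f : AInfHom A B),
      f.IsQuasiIso ∧ φ = DualFamily.pullback f P.toDualFamily

end

end AInf

namespace AInf

/-! ### Signs -/

section Signs

variable {𝕜 : Type v} [Field 𝕜]

/-! A family φ with skew symmetry and closedness is a closed two-form in noncommutative geometry: a
function of cyclic words with two marked letters. The operations m act as a vector field of square
zero, and φ is a bimodule map exactly when its Lie derivative along m vanishes
(`DualFamily.isBimoduleMap_iff`). The composition `pullback f χ` is the pullback of two-forms along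
f. It preserves skew symmetry and closedness (`SkewForm.pbf`, `ClosedForm.pbf`) and commutes with
Lie derivatives whenever f intertwines the operations (`Intertwines.pbf_lieForm`). A cyclic inner
product is an invariant non-degenerate form with constant coefficients.

A constant skew form is trivially closed, and a cyclic pairing is homologically non-degenerate
because a functional that vanishes on the boundaries is represented by a cycle. Both facts survive
pullback along a quasi-isomorphism, so every strong homotopy inner product has the three properties.

For the converse, homological perturbation theory gives a minimal model H with h : H → A and w : A →
H, w ∘ h = id (`AInfAlgebra.exists_minimalModel`). On H the differential is zero and every component
is finite dimensional, so a dimension count makes the pulled back form non-degenerate at chain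
level. It remains to treat a form φ that is non-degenerate at chain level.

Such a form is reduced to its constant part φ₀ by a Darboux theorem (`exists_darboux`): φ = g^♯ φ₀
for a formal map g with identity linear part. The components of g are found by recursion on the word
length. At each length the error φ - g^♯ φ₀ is closed, the Poincaré lemma `ClosedForm.ms_sub_ms`
gives it a primitive after division by the number of letters, which is where characteristic zero
enters, and non-degeneracy of φ₀ turns the primitive into the next component of g.

Next, m is transported along g to a structure m' (`IsAInf.exists_transfer`). Pullback along g is
injective (`eq_zero_of_pbf_eq_zero`) and takes the Lie derivative of φ₀ along m' to that of φ along
m, which is zero. Hence φ₀ is invariant under m', and for a constant form this is cyclicity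
(`IsConstForm.cyclic`). On H this yields h^♯ φ = g^♯ ψ with ψ cyclic, and w^♯ (g^♯ ψ) = (g ∘ w)^♯ ψ
by `pullback_pullback`. -/

@[simp] theorem sgn_zero : sgn 𝕜 0 = 1 := by simp [sgn]

theorem sgn_add (a b : ℤ) : sgn 𝕜 (a + b) = sgn 𝕜 a * sgn 𝕜 b := by
  simp [sgn, Int.negOnePow_add]

/-- Only the parity of an exponent matters. Comparing exponents in `ZMod 2` turns the Koszul sign
checks below into polynomial identities in characteristic two. -/
theorem sgn_congr {a b : ℤ} (h : (a : ZMod 2) = b) : sgn 𝕜 a = sgn 𝕜 b := by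
  have : Even (a - b) := by
    rw [← ZMod.intCast_eq_zero_iff_even]; push_cast; rw [h, sub_self]
  rw [sgn, sgn, (Int.negOnePow_eq_iff a b).2 this]

theorem sgn_one : sgn 𝕜 1 = -1 := by simp [sgn]

theorem neg_sgn (a : ℤ) : -sgn 𝕜 a = sgn 𝕜 (a + 1) := by
  rw [sgn_add, sgn_one]; ring

@[simp] theorem sgn_mul_self (a : ℤ) : sgn 𝕜 a * sgn 𝕜 a = 1 := by
  rw [← sgn_add, ← sgn_zero]
  exact sgn_congr (by push_cast; grind)

theorem sgn_ne_zero (a : ℤ) : sgn 𝕜 a ≠ 0 := by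
  intro h
  have := sgn_mul_self (𝕜 := 𝕜) a
  rw [h] at this
  simp at this

end Signs

/-! ### Sums over cuts -/

section Cuts

variable {α : Type u} {β : Type u₁} {M : Type u₂} [AddCommGroup M]

/-- The sum of `K a b` over all cuts `x = a b`. -/
def cs (K : List α → List α → M) (x : List α) : M := ((cuts x).map fun p => K p.1 p.2).sum

/-- The sum of `K a b c` over all cuts `x = a b c`. -/
def cs3 (K : List α → List α → List α → M) (x : List α) : M :=
  cs (fun a r => cs (fun b c => K a b c) r) x

@[simp] theorem cs_nil (K : List α → List α → M) : cs K [] = K [] [] := by simp [cs, cuts]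

theorem cs_cons (K : List α → List α → M) (a : α) (x : List α) :
    cs K (a :: x) = K [] (a :: x) + cs (fun p q => K (a :: p) q) x := by
  simp [cs, cuts, Function.comp_def]

theorem cs_congr {K K' : List α → List α → M} {x : List α}
    (h : ∀ a b, a ++ b = x → K a b = K' a b) : cs K x = cs K' x := by
  unfold cs
  congr 1
  exact List.map_congr_left fun p hp => h _ _ (append_of_mem_cuts hp)

theorem cs_eq_zero {K : List α → List α → M} {x : List α}
    (h : ∀ a b, a ++ b = x → K a b = 0) : cs K x = 0 := by
  rw [cs_congr (K' := fun _ _ => 0) h]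
  simp [cs]

theorem cs_add (K K' : List α → List α → M) (x : List α) :
    cs (fun a b => K a b + K' a b) x = cs K x + cs K' x := by
  induction x generalizing K K' with
  | nil => simp
  | cons a x ih => simp only [cs_cons, ih]; abel

theorem map_cs {N : Type u₃} [AddCommGroup N] {F : Type*} [FunLike F M N]
    [AddMonoidHomClass F M N] (φ : F) (K : List α → List α → M) (x : List α) :
    φ (cs K x) = cs (fun a b => φ (K a b)) x := by
  induction x generalizing K with
  | nil => simp
  | cons a x ih => simp only [cs_cons, map_add, ih]

theorem cs_neg (K : List α → List α → M) (x : List α) :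
    cs (fun a b => -K a b) x = -cs K x :=
  (map_cs (negAddMonoidHom : M →+ M) K x).symm

theorem cs_sub (K K' : List α → List α → M) (x : List α) :
    cs (fun a b => K a b - K' a b) x = cs K x - cs K' x := by
  simp only [sub_eq_add_neg, cs_add, cs_neg]

theorem cs_smul {𝕜 : Type v} [Semiring 𝕜] [Module 𝕜 M] (r : 𝕜) (K : List α → List α → M)
    (x : List α) : cs (fun a b => r • K a b) x = r • cs K x := by
  induction x generalizing K with
  | nil => simp
  | cons a x ih => simp only [cs_cons, ih, smul_add]

/-- A cut of `x v y` is made either at or before the letter `v`, inside `x`, or after it, inside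
`y`. -/
theorem cs_append_cons (K : List α → List α → M) (x : List α) (v : α) (y : List α) :
    cs K (x ++ v :: y) =
      cs (fun p q => K p (q ++ v :: y)) x + cs (fun p q => K (x ++ v :: p) q) y := by
  induction x generalizing K with
  | nil => simp [cs_cons]
  | cons a x ih => simp only [List.cons_append, cs_cons, ih, add_assoc]

/-- Coassociativity of deconcatenation. -/
theorem cs_assoc (K : List α → List α → List α → M) (x : List α) :
    cs (fun r c => cs (fun a b => K a b c) r) x = cs3 K x := by
  unfold cs3
  induction x generalizing K with
  | nil => simp
  | cons a x ih => simp only [cs_cons, cs_add, cs_nil, ih, add_assoc]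

theorem cs_comm (K : List α → List α → List β → List β → M) (x : List α) (y : List β) :
    cs (fun a b => cs (fun c d => K a b c d) y) x =
      cs (fun c d => cs (fun a b => K a b c d) x) y := by
  induction x generalizing K with
  | nil => simp
  | cons a x ih => simp only [cs_cons, cs_add, ih]

/-- The three terms are distinguished by the part that contains `v`: the third, the second or the
first. -/
theorem cs3_append_cons (K : List α → List α → List α → M) (x : List α) (v : α) (y : List α) :
    cs3 K (x ++ v :: y) = cs3 (fun a b c => K a b (c ++ v :: y)) x +
      cs (fun a p => cs (fun q c => K a (p ++ v :: q) c) y) x +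
      cs3 (fun a b c => K (x ++ v :: a) b c) y := by
  simp only [cs3, cs_append_cons, cs_add]

theorem cs3_congr {K K' : List α → List α → List α → M} {x : List α}
    (h : ∀ a b c, a ++ (b ++ c) = x → K a b c = K' a b c) : cs3 K x = cs3 K' x :=
  cs_congr fun a r hr => cs_congr fun b c hb => h a b c (by rw [hb, hr])

theorem cs3_eq_zero {K : List α → List α → List α → M} {x : List α}
    (h : ∀ a b c, a ++ (b ++ c) = x → K a b c = 0) : cs3 K x = 0 :=
  cs_eq_zero fun a r hr => cs_eq_zero fun b c hb => h a b c (by rw [hb, hr])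

theorem cs3_add (K K' : List α → List α → List α → M) (x : List α) :
    cs3 (fun a b c => K a b c + K' a b c) x = cs3 K x + cs3 K' x := by
  simp only [cs3, cs_add]

theorem cs3_sub (K K' : List α → List α → List α → M) (x : List α) :
    cs3 (fun a b c => K a b c - K' a b c) x = cs3 K x - cs3 K' x := by
  simp only [cs3, cs_sub]

theorem cs3_neg (K : List α → List α → List α → M) (x : List α) :
    cs3 (fun a b c => -K a b c) x = -cs3 K x := by
  simp only [cs3, cs_neg]

theorem cs3_smul {𝕜 : Type v} [Semiring 𝕜] [Module 𝕜 M] (r : 𝕜)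
    (K : List α → List α → List α → M) (x : List α) :
    cs3 (fun a b c => r • K a b c) x = r • cs3 K x := by
  simp only [cs3, cs_smul]

theorem map_cs3 {N : Type u₃} [AddCommGroup N] {F : Type*} [FunLike F M N]
    [AddMonoidHomClass F M N] (φ : F) (K : List α → List α → List α → M) (x : List α) :
    φ (cs3 K x) = cs3 (fun a b c => φ (K a b c)) x := by
  simp only [cs3, map_cs]

theorem cs3_cs_comm (K : List α → List α → List α → List β → List β → M) (x : List α)
    (y : List β) :
    cs3 (fun a b c => cs (fun d e => K a b c d e) y) x =
      cs (fun d e => cs3 (fun a b c => K a b c d e) x) y := by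
  simp only [cs3]
  rw [cs_comm]
  exact cs_congr fun a r _ => by rw [cs_comm]

theorem cs3_comm (K : List α → List α → List α → List β → List β → List β → M) (x : List α)
    (y : List β) :
    cs3 (fun a b c => cs3 (fun d e f => K a b c d e f) y) x =
      cs3 (fun d e f => cs3 (fun a b c => K a b c d e f) x) y :=
  (cs3_cs_comm (fun a b c d r => cs (fun e f => K a b c d e f) r) x y).trans
    (cs_congr fun d r _ => cs3_cs_comm (fun a b c e f => K a b c d e f) x r)

end Cuts

/-! ### Sums over blocks -/

section Blocks

variable {α : Type u} {β : Type u₁} {γ : Type u₂} {M : Type u₃} [AddCommGroup M]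

/-- The sum of `K [f b₁, …, f bᵣ]` over all ways to cut `x` in nonempty blocks `b₁, …, bᵣ`. -/
def hat (f : List α → β) (K : List β → M) (x : List α) : M :=
  ((blocks x).map fun s => K (s.map f)).sum

/-- The recursion that defines `blocks` decides letter by letter whether to join the next block.
Here it is unrolled into the choice of the whole first block `a :: p`, the form used in all later
inductions. -/
theorem blocks_sum_cons (G : List (List α) → M) (a : α) (x : List α) :
    ((blocks (a :: x)).map G).sum =
      cs (fun p q => ((blocks q).map fun s => G ((a :: p) :: s)).sum) x := by
  have key : ∀ (G : List (List α) → M) (a : α) (x : List α),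
      ((blocks (a :: x)).map G).sum = ((blocks x).map fun p => G ([a] :: p)).sum +
        ((blocks x).map fun p => (match p with
          | [] => 0
          | b :: bs => G ((a :: b) :: bs))).sum := by
    intro G a x
    simp only [blocks]
    induction blocks x with
    | nil => simp
    | cons p l ih =>
      simp only [List.flatMap_cons, List.map_append, List.sum_append, List.map_cons,
        List.sum_cons, ih]
      cases p <;> simp <;> abel
  induction x generalizing a G with
  | nil => simp [blocks]
  | cons c x ih =>
    rw [key, cs_cons]
    congr 1
    exact ih (fun p => match p with
      | [] => 0
      | b :: bs => G ((a :: b) :: bs)) c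

@[simp] theorem hat_nil (f : List α → β) (K : List β → M) : hat f K [] = K [] := by
  simp [hat, blocks]

theorem hat_cons (f : List α → β) (K : List β → M) (a : α) (x : List α) :
    hat f K (a :: x) = cs (fun p q => hat f (fun s => K (f (a :: p) :: s)) q) x := by
  simp only [hat, blocks_sum_cons, List.map_cons]

theorem hat_singleton (f : List α → β) (K : List β → M) (a : α) :
    hat f K [a] = K [f [a]] := by
  simp [hat_cons]

theorem map_hat {N : Type*} [AddCommGroup N] {F : Type*} [FunLike F M N]
    [AddMonoidHomClass F M N] (φ : F) (f : List α → β) (K : List β → M) (x : List α) :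
    φ (hat f K x) = hat f (fun s => φ (K s)) x := by
  simp [hat, map_list_sum, Function.comp_def]

theorem hat_add (f : List α → β) (K K' : List β → M) (x : List α) :
    hat f (fun s => K s + K' s) x = hat f K x + hat f K' x := by
  simp [hat, List.sum_map_add]

theorem hat_neg (f : List α → β) (K : List β → M) (x : List α) :
    hat f (fun s => -K s) x = -hat f K x :=
  (map_hat (negAddMonoidHom : M →+ M) f K x).symm

theorem hat_sub (f : List α → β) (K K' : List β → M) (x : List α) :
    hat f (fun s => K s - K' s) x = hat f K x - hat f K' x := by
  simp only [sub_eq_add_neg, hat_add, hat_neg]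

theorem hat_smul {𝕜 : Type v} [Semiring 𝕜] [Module 𝕜 M] (r : 𝕜) (f : List α → β)
    (K : List β → M) (x : List α) : hat f (fun s => r • K s) x = r • hat f K x := by
  simp only [hat]
  induction blocks x with
  | nil => simp
  | cons a x ih => simp only [List.map_cons, List.sum_cons, ih, smul_add]

theorem hat_congr {f : List α → β} {K K' : List β → M} {x : List α}
    (h : ∀ t : List (List α), t.flatten = x → K (t.map f) = K' (t.map f)) :
    hat f K x = hat f K' x := by
  unfold hat
  congr 1
  exact List.map_congr_left fun p hp => h _ (flatten_of_mem_blocks hp)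

theorem hat_zero (f : List α → β) (x : List α) : hat f (fun _ => (0 : M)) x = 0 := by
  simp [hat]

theorem hat_cs_comm (f : List α → β) (K : List β → List γ → List γ → M) (x : List α)
    (y : List γ) :
    hat f (fun s => cs (fun c d => K s c d) y) x =
        cs (fun c d => hat f (fun s => K s c d) x) y := by
  induction y generalizing K with
  | nil => simp
  | cons a y ih => simp only [cs_cons, hat_add, ih]

theorem hat_cs3_comm (f : List α → β) (K : List β → List γ → List γ → List γ → M) (x : List α)
    (y : List γ) : hat f (fun s => cs3 (fun b c d => K s b c d) y) x =
      cs3 (fun b c d => hat f (fun s => K s b c d) x) y := by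
  simp only [cs3, hat_cs_comm]

theorem hat_comm {δ : Type*} (f : List α → β) (g : List γ → δ) (K : List β → List δ → M)
    (x : List α) (y : List γ) :
    hat f (fun s => hat g (fun t => K s t) y) x = hat g (fun t => hat f (fun s => K s t) x) y := by
  simp only [hat]
  induction blocks x with
  | nil => simp
  | cons p l ih =>
    simp only [List.map_cons, List.sum_cons, ih]
    rw [← List.sum_map_add]

/-- Substitution of blocks is a coalgebra map for deconcatenation: cutting the list of blocks
amounts to cutting the word first and then each part in blocks. -/
theorem hat_cs (f : List α → β) (K : List β → List β → M) (x : List α) :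
    hat f (cs K) x = cs (fun a b => hat f (fun s => hat f (fun t => K s t) b) a) x := by
  induction hn : x.length using Nat.strong_induction_on generalizing x K with
  | _ n ih =>
    cases x with
    | nil => simp
    | cons a x =>
      simp only [hat_cons, cs_cons, hat_add, cs_add, hat_nil]
      congr 1
      calc cs (fun p q => hat f (fun s => cs (fun b c => K (f (a :: p) :: b) c) s) q) x
          = cs (fun p q => cs (fun b c => hat f (fun s => hat f (fun t =>
              K (f (a :: p) :: s) t) c) b) q) x := by
            refine cs_congr fun p q hpq => ?_
            refine ih q.length ?_ _ _ rfl
            subst hn hpq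
            simp only [List.length_cons, List.length_append]
            omega
        _ = _ := (cs_assoc _ _).symm

theorem hat_cs3 (f : List α → β) (K : List β → List β → List β → M) (x : List α) :
    hat f (cs3 K) x = cs3 (fun a b c =>
      hat f (fun s => hat f (fun t => hat f (fun r => K s t r) c) b) a) x := by
  unfold cs3
  rw [hat_cs]
  refine cs_congr fun a r _ => ?_
  rw [← hat_cs_comm]
  congr 1; funext s
  exact hat_cs f _ _

/-- The letter `v` lies in exactly one block `x₂ v y₁`; the blocks before and after it are cut
freely from `x₁` and `y₂`. -/
theorem hat_append_cons (f : List α → β) (K : List β → M) (x : List α) (v : α) (y : List α) :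
    hat f K (x ++ v :: y) = cs (fun x₁ x₂ => cs (fun y₁ y₂ => hat f (fun s => hat f (fun t =>
      K (s ++ f (x₂ ++ v :: y₁) :: t)) y₂) x₁) y) x := by
  induction hn : x.length using Nat.strong_induction_on generalizing x K with
  | _ n ih =>
    cases x with
    | nil => simp [hat_cons]
    | cons a x =>
      simp only [List.cons_append, hat_cons, cs_append_cons, cs_cons, hat_nil, List.nil_append]
      rw [add_comm]
      congr 1
      calc cs (fun p q => hat f (fun s => K (f (a :: p) :: s)) (q ++ v :: y)) x
          = cs (fun p q => cs (fun x₁ x₂ => cs (fun y₁ y₂ => hat f (fun s => hat f (fun t =>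
              K (f (a :: p) :: (s ++ f (x₂ ++ v :: y₁) :: t))) y₂) x₁) y) q) x := by
            refine cs_congr fun p q hpq => ?_
            refine ih q.length ?_ _ _ rfl
            subst hn hpq
            simp only [List.length_cons, List.length_append]
            omega
        _ = _ := by
            refine (cs_assoc _ _).symm.trans ?_
            simp only [cs_comm (y := y)]

theorem hat_eq_zero {f : List α → β} {K : List β → M} {x : List α}
    (h : ∀ s, s.length ≤ x.length → K s = 0) : hat f K x = 0 := by
  induction hn : x.length using Nat.strong_induction_on generalizing x K with
  | _ n ih =>
    cases x with
    | nil => simpa using h [] (by simp)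
    | cons a x =>
      rw [hat_cons]
      refine cs_eq_zero fun p q hpq => ?_
      subst hn hpq
      simp only [List.length_cons, List.length_append] at h ih
      refine ih q.length (by omega) (fun s hs => h _ ?_) rfl
      simp only [List.length_cons]
      omega

/-- Triangularity: the only cut with as many blocks as letters is the one in single letters, and `f`
fixes these. -/
theorem hat_eq_self {f : List α → α} (hf : ∀ a, f [a] = a) {K : List α → M} {x : List α}
    (h : ∀ s, s.length < x.length → K s = 0) : hat f K x = K x := by
  induction x generalizing K with
  | nil => simp
  | cons a x ih =>
    rw [hat_cons]
    have : ∀ p q, p ++ q = x → p ≠ [] → hat f (fun s => K (f (a :: p) :: s)) q = 0 := by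
      intro p q hpq hp
      refine hat_eq_zero fun s hs => h _ ?_
      subst hpq
      have := List.length_pos_of_ne_nil hp
      simp only [List.length_cons, List.length_append]
      omega
    have e₁ : hat f (fun s => K (a :: s)) x = K (a :: x) :=
      ih fun s hs => h _ (by simpa using hs)
    cases x with
    | nil => simp [hf]
    | cons b x =>
      rw [cs_cons, hf, e₁, cs_eq_zero, add_zero]
      intro p q hpq
      exact this _ _ (by simp [hpq]) (by simp)

theorem hat_congr_fun {f f' : List α → β} {K : List β → M} {n : ℕ} {x : List α}
    (hf : ∀ b, b.length < n → f b = f' b) (hx : x.length < n) : hat f K x = hat f' K x := by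
  induction hm : x.length using Nat.strong_induction_on generalizing x K with
  | _ m ih =>
    cases x with
    | nil => simp
    | cons a x =>
      simp only [hat_cons]
      refine cs_congr fun p q hpq => ?_
      subst hm hpq
      simp only [List.length_cons, List.length_append] at ih hx
      rw [hf _ (by simp only [List.length_cons]; omega)]
      exact ih q.length (by omega) (by omega) rfl

/-- The value of `f` on the whole word enters only through the one-block cut, where `K` vanishes.
This makes recursions through the operations with at least two inputs well founded. -/
theorem hat_congr_fun_of_singleton {f f' : List α → β} {K : List β → M} {n : ℕ} {x : List α}
    (hf : ∀ b, b.length < n → f b = f' b) (hK : ∀ z, K [z] = 0) (hx : x.length ≤ n) :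
    hat f K x = hat f' K x := by
  cases x with
  | nil => simp
  | cons a x =>
    simp only [hat_cons]
    refine cs_congr fun p q hpq => ?_
    subst hpq
    simp only [List.length_cons, List.length_append] at hx
    cases q with
    | nil => simp [hK]
    | cons b q =>
      simp only [List.length_cons] at hx
      rw [hf _ (by simp only [List.length_cons]; omega)]
      exact hat_congr_fun hf (by simp only [List.length_cons]; omega)

end Blocks

/-! ### Regrouping of iterated cuts -/

section Regroup

variable {α : Type u} {M : Type u₂} [AddCommGroup M]

theorem cuts₃_sum (K : List α → List α → List α → M) (x : List α) :
    ((cuts₃ x).map fun p => K p.1 p.2.1 p.2.2).sum = cs3 K x := by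
  simp only [cuts₃, cs3, cs]
  induction cuts x with
  | nil => simp
  | cons p l ih =>
    simp only [List.flatMap_cons, List.map_append, List.sum_append, List.map_cons, List.sum_cons,
      ih, List.map_map, Function.comp_def]

theorem cs3_regroup_mid (G : List α → List α → List α → List α → List α → M) (x : List α) :
    cs3 (fun a b c => cs (fun a₁ a₂ => cs (fun c₁ c₂ => G a₁ a₂ b c₁ c₂) c) a) x =
      cs3 (fun a y c => cs3 (fun a₂ b c₁ => G a a₂ b c₁ c) y) x := by
  have e₁ : ∀ a r : List α,
      cs (fun b c => cs (fun a₁ a₂ => cs (fun c₁ c₂ => G a₁ a₂ b c₁ c₂) c) a) r =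
      cs (fun a₁ a₂ => cs (fun b c => cs (fun c₁ c₂ => G a₁ a₂ b c₁ c₂) c) r) a :=
    fun a r => cs_comm _ _ _
  unfold cs3
  simp only [e₁]
  refine (cs_assoc _ _).trans (cs_congr fun a R _ => ?_)
  refine Eq.trans ?_ (cs_assoc (fun a₂ z c₂ => cs (fun b c₁ => G a a₂ b c₁ c₂) z) R).symm
  exact cs_congr fun a₂ r _ => (cs_assoc (fun b c₁ c₂ => G a a₂ b c₁ c₂) r).symm

theorem cs3_regroup_left (G : List α → List α → List α → List α → List α → M) (x : List α) :
    cs3 (fun a b c => cs3 (fun p q r => G p q r b c) a) x =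
      cs3 (fun p q z => cs3 (fun r b c => G p q r b c) z) x := by
  have e₁ : ∀ a R : List α,
      cs (fun b c => cs (fun p z => cs (fun q r => G p q r b c) z) a) R =
      cs (fun p z => cs (fun q r => cs (fun b c => G p q r b c) R) z) a := by
    intro a R
    rw [cs_comm]
    exact cs_congr fun p z _ => cs_comm _ _ _
  unfold cs3
  simp only [e₁]
  refine (cs_assoc _ _).trans (cs_congr fun p Y _ => ?_)
  exact cs_assoc (fun q r R => cs (fun b c => G p q r b c) R) Y

end Regroup

/-! ### Signed insertion of an operation in a word -/

section Der

variable {𝕜 : Type v} [Field 𝕜] {V : GradedSpace.{v, u} 𝕜} {M : Type u₂} [AddCommGroup M]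
  [Module 𝕜 M]

/-- The sum of `(-1)^{|a|} K (a ⊗ m(b) ⊗ c)` over all cuts `x = a b c`. -/
def der (m : V.Word → V.El) (K : V.Word → M) (x : V.Word) : M :=
  cs3 (fun a b c => sgn 𝕜 (wdeg a) • K (a ++ m b :: c)) x

variable (m : V.Word → V.El)

theorem der_nil (K : V.Word → M) : der m K [] = K [m []] := by simp [der, cs3]

theorem der_cons (K : V.Word → M) (v : V.El) (x : V.Word) :
    der m K (v :: x) = cs (fun b c => K (m b :: c)) (v :: x) +
      sgn 𝕜 v.1 • der m (fun s => K (v :: s)) x := by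
  simp only [der, cs3]
  rw [cs_cons]
  simp only [wdeg_nil, sgn_zero, one_smul, List.nil_append, wdeg_cons, sgn_add, ← cs_smul,
    smul_smul, List.cons_append]

theorem map_der {N : Type u₃} [AddCommGroup N] [Module 𝕜 N] (φ : M →ₗ[𝕜] N) (K : V.Word → M)
    (x : V.Word) : φ (der m K x) = der m (fun s => φ (K s)) x := by
  simp only [der, map_cs3, map_smul]

theorem der_add (K K' : V.Word → M) (x : V.Word) :
    der m (fun s => K s + K' s) x = der m K x + der m K' x := by
  simp only [der, smul_add, cs3_add]

theorem der_neg (K : V.Word → M) (x : V.Word) :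
    der m (fun s => -K s) x = -der m K x := by
  simp only [der, smul_neg, cs3_neg]

theorem der_sub (K K' : V.Word → M) (x : V.Word) :
    der m (fun s => K s - K' s) x = der m K x - der m K' x := by
  simp only [sub_eq_add_neg, der_add, der_neg]

theorem der_smul (r : 𝕜) (K : V.Word → M) (x : V.Word) :
    der m (fun s => r • K s) x = r • der m K x :=
  (map_der m (r • LinearMap.id) K x).symm

theorem der_cs_comm {β : Type u₁} (K : V.Word → List β → List β → M) (x : V.Word) (y : List β) :
    der m (fun s => cs (fun c d => K s c d) y) x =
        cs (fun c d => der m (fun s => K s c d) x) y := by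
  simp only [der, ← cs_smul, cs3_cs_comm]

theorem der_hat_comm {α : Type u₁} {β : Type u₃} (f : List α → β) (K : V.Word → List β → M)
    (x : V.Word) (y : List α) : der m (fun s => hat f (fun t => K s t) y) x =
      hat f (fun t => der m (fun s => K s t) x) y := by
  simp only [der, hat_cs3_comm, hat_smul]

/-- The inserted operation lies to the left of `v`, absorbs `v`, or lies to its right. In the last
case the sign has to pass `x` and `v`. -/
theorem der_append_cons (K : V.Word → M) (x : V.Word) (v : V.El) (y : V.Word) :
    der m K (x ++ v :: y) = der m (fun s => K (s ++ v :: y)) x +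
      cs (fun x₁ x₂ => cs (fun y₁ y₂ =>
        sgn 𝕜 (wdeg x₁) • K (x₁ ++ m (x₂ ++ v :: y₁) :: y₂)) y) x +
      sgn 𝕜 (wdeg x + v.1) • der m (fun t => K (x ++ v :: t)) y := by
  simp only [der, cs3_append_cons, List.append_assoc, List.cons_append, ← cs3_smul, smul_smul,
    wdeg_append, wdeg_cons, sgn_add, mul_assoc]

/-- The signed insertion is a coderivation of deconcatenation. The sign in the second term comes
from moving the operation past the first part. -/
theorem der_cs (K : V.Word → V.Word → M) (x : V.Word) :
    der m (cs K) x = cs (fun a b => der m (fun s => K s b) a +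
      sgn 𝕜 (wdeg a) • der m (fun t => K a t) b) x := by
  have e₁ : der m (cs K) x = cs3 (fun a b c => cs (fun a₁ a₂ =>
      sgn 𝕜 (wdeg a) • K a₁ (a₂ ++ m b :: c)) a) x + cs3 (fun a b c => cs (fun c₁ c₂ =>
      sgn 𝕜 (wdeg a) • K (a ++ m b :: c₁) c₂) c) x := by
    simp only [der, cs_append_cons, smul_add, ← cs_smul, cs3_add]
  rw [e₁, cs_add, add_comm]
  congr 1
  · simp only [der, cs3]
    refine Eq.symm ((cs_assoc (fun a r b => cs (fun b₁ c => sgn 𝕜 (wdeg a) •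
      K (a ++ m b₁ :: c) b) r) x).trans (cs_congr fun a R _ => ?_))
    exact cs_assoc _ _
  · simp only [der]
    have e₂ : cs3 (fun a b c => cs (fun a₁ a₂ =>
        sgn 𝕜 (wdeg a) • K a₁ (a₂ ++ m b :: c)) a) x = cs3 (fun a b c => cs (fun a₁ a₂ =>
        sgn 𝕜 (wdeg a₁) • sgn 𝕜 (wdeg a₂) • K a₁ (a₂ ++ m b :: c)) a) x := by
      refine cs3_congr fun a b c _ => cs_congr fun a₁ a₂ h => ?_
      rw [← h, wdeg_append, sgn_add, smul_smul]
    rw [e₂]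
    simp only [← cs3_smul]
    unfold cs3
    have e₃ : ∀ a r : V.Word, cs (fun b c => cs (fun a₁ a₂ =>
        sgn 𝕜 (wdeg a₁) • sgn 𝕜 (wdeg a₂) • K a₁ (a₂ ++ m b :: c)) a) r = cs (fun a₁ a₂ =>
        cs (fun b c => sgn 𝕜 (wdeg a₁) • sgn 𝕜 (wdeg a₂) • K a₁ (a₂ ++ m b :: c)) r) a :=
      fun a r => cs_comm _ _ _
    simp only [e₃]
    exact cs_assoc _ _

end Der

/-! ### Multilinear families -/

section Letters

variable {𝕜 : Type v} [Field 𝕜] {V : GradedSpace.{v, u} 𝕜} {W : GradedSpace.{v, u₁} 𝕜}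
  {U : GradedSpace.{v, u₃} 𝕜} {M : Type u₂} [AddCommGroup M] [Module 𝕜 M] {p q : ℤ}

/-- Linearity of a function of homogeneous elements on every component. -/
def LetterLinear (L : V.El → M) : Prop :=
  ∀ (d : ℤ) (r : 𝕜) (a b : V.carrier d), L ⟨d, r • a + b⟩ = r • L ⟨d, a⟩ + L ⟨d, b⟩

theorem WordLinear.letter {F : V.Word → M} (h : WordLinear F) (x y : V.Word) :
    LetterLinear fun z => F (x ++ z :: y) := h x y

theorem WordLinear.letter_head {F : V.Word → M} (h : WordLinear F) (y : V.Word) :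
    LetterLinear fun z => F (z :: y) := h [] y

/-- The linear map on a component. -/
def LetterLinear.toLinear {L : V.El → M} (h : LetterLinear L) (d : ℤ) : V.carrier d →ₗ[𝕜] M where
  toFun a := L ⟨d, a⟩
  map_add' a b := by simpa using h d 1 a b
  map_smul' r a := by
    have h₁ := h d 1 0 0
    have h₂ := h d r a 0
    simp only [smul_zero, add_zero, one_smul, left_eq_add] at h₁ h₂
    simpa [h₁] using h₂

theorem LetterLinear.toLinear_apply {L : V.El → M} (h : LetterLinear L) (d : ℤ)
    (a : V.carrier d) : h.toLinear d a = L ⟨d, a⟩ := rfl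

theorem LetterLinear.map_zero {L : V.El → M} (h : LetterLinear L) (d : ℤ) :
    L ⟨d, 0⟩ = 0 := (h.toLinear d).map_zero

/-- The bundled value `f.el w` carries a degree that depends on `w`. Naming this degree `e` turns
`L` into a linear map on one fixed component, which can be pulled out of sums. -/
theorem LetterLinear.el {L : V.El → M} (h : LetterLinear L) (f : MultiMap W V p) (w : W.Word)
    (e : ℤ) (he : wdeg w + p = e) : L (f.el w) = h.toLinear e (f.toFun w e) := by
  rw [f.el_eq w e he]; rfl

theorem LetterLinear.el_eq_zero {L : V.El → M} (h : LetterLinear L) (f : MultiMap W V p)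
    (w : W.Word) (hw : ∀ e, f.toFun w e = 0) : L (f.el w) = 0 := by
  rw [h.el f w _ rfl, hw, _root_.map_zero]

theorem LetterLinear.el_linear {L : V.El → M} (h : LetterLinear L) (f : MultiMap W V p) :
    WordLinear fun w => L (f.el w) := by
  intro xs ys d r a b
  have := f.linear (wdeg xs + d + wdeg ys + p) xs ys d r a b
  simp only at this ⊢
  iterate 3 rw [h.el f _ (wdeg xs + d + wdeg ys + p) (by simp; ring)]
  rw [this, map_add, map_smul]

theorem wdeg_map_el (f : MultiMap V W 0) (s : List V.Word) :
    wdeg (s.map f.el) = wdeg s.flatten := by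
  induction s with
  | nil => rfl
  | cons b s ih => simp [ih, MultiMap.el]

/-- A family of degree zero preserves the total degree, so a sign that depends on the substituted
word may be replaced by one that depends on `x`. -/
theorem hat_congr_wdeg {N : Type u₂} [AddCommGroup N] {f : MultiMap V W 0} {K K' : W.Word → N}
    {x : V.Word} (h : ∀ s, wdeg s = wdeg x → K s = K' s) : hat f.el K x = hat f.el K' x :=
  hat_congr fun t ht => h _ (by rw [wdeg_map_el, ht])

theorem der_congr_wdeg {m : MultiMap V V q} {K K' : V.Word → M} {x : V.Word}
    (h : ∀ s, wdeg s = wdeg x + q → K s = K' s) : der m.el K x = der m.el K' x :=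
  cs3_congr fun a b c hx => by
    rw [h]
    rw [← hx]
    simp only [wdeg_append, wdeg_cons, MultiMap.el]
    ring

theorem LetterLinear.hat_el {L : U.El → M} (h : LetterLinear L) (m : MultiMap W U p)
    (f : MultiMap V W 0) (x : V.Word) (e : ℤ) (he : wdeg x + p = e) :
    hat f.el (fun s => L (m.el s)) x = h.toLinear e (hat f.el (fun s => m.toFun s e) x) := by
  rw [map_hat]
  exact hat_congr_wdeg fun s hs => h.el m s e (by rw [hs, he])

theorem LetterLinear.der_el {L : W.El → M} (h : LetterLinear L) (f : MultiMap V W p)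
    (m : MultiMap V V q) (x : V.Word) (e : ℤ) (he : wdeg x + q + p = e) :
    der m.el (fun s => L (f.el s)) x = h.toLinear e (der m.el (fun s => f.toFun s e) x) := by
  rw [map_der]
  exact der_congr_wdeg fun s hs => h.el f s e (by rw [hs, he])

theorem WordLinear.cs3 {G : V.Word → V.Word → V.Word → M}
    (h₁ : ∀ b c, WordLinear fun a => G a b c) (h₂ : ∀ a c, WordLinear fun b => G a b c)
    (h₃ : ∀ a b, WordLinear fun c => G a b c) : WordLinear (AInf.cs3 G) :=
  WordLinear.sum_cuts (G := fun a r => cs (fun b c => G a b c) r)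
    (fun _ => WordLinear.sum _ fun p => h₁ p.1 p.2)
    (fun a => WordLinear.sum_cuts (fun c => h₂ a c) (fun b => h₃ a b))

theorem WordLinear.hat {F : W.Word → M} (hF : WordLinear F) (f : MultiMap V W 0) :
    WordLinear (AInf.hat f.el F) := by
  apply WordLinear.sum_blocks (F := fun s => F (s.map f.el))
  intro P Q
  simp only [List.map_append, List.map_cons]
  exact (hF.letter _ _).el_linear f

theorem WordLinear.smul_wdeg {F : V.Word → M} (hF : WordLinear F) (c : ℤ → 𝕜) :
    WordLinear fun w => c (wdeg w) • F w := by
  intro xs ys d r a b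
  have := hF xs ys d r a b
  simp only [wdeg_append, wdeg_cons] at this ⊢
  rw [this, smul_add, smul_comm]

theorem WordLinear.smul {F : V.Word → M} (hF : WordLinear F) (c : 𝕜) :
    WordLinear fun w => c • F w := hF.smul_wdeg fun _ => c

theorem WordLinear.neg {F : V.Word → M} (hF : WordLinear F) : WordLinear fun w => -F w := by
  simpa using hF.smul (-1)

theorem WordLinear.sub {F G : V.Word → M} (hF : WordLinear F) (hG : WordLinear G) :
    WordLinear fun w => F w - G w := by
  simpa only [sub_eq_add_neg] using hF.add hG.neg

theorem WordLinear.der {F : V.Word → M} (hF : WordLinear F) (m : MultiMap V V q) :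
    WordLinear (AInf.der m.el F) := by
  apply WordLinear.cs3
  · exact fun b c => (hF.append_right (m.el b :: c)).smul_wdeg (sgn 𝕜)
  · exact fun a c => ((hF.letter a c).el_linear m).smul _
  · intro a b
    have := hF.append_left (a ++ [m.el b])
    simp only [List.append_assoc, List.singleton_append] at this
    exact this.smul _

theorem WordLinear.linearMap_comp {N : Type*} [AddCommGroup N] [Module 𝕜 N] {F : V.Word → M}
    (hF : WordLinear F) (φ : M →ₗ[𝕜] N) : WordLinear fun w => φ (F w) := by
  intro xs ys d r a b
  have := hF xs ys d r a b
  simp only at this ⊢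
  rw [this, map_add, map_smul]

namespace MultiMap

theorem toFun_letterLinear (f : MultiMap V W p) (x y : V.Word) (e : ℤ) :
    LetterLinear fun z => f.toFun (x ++ z :: y) e := f.linear e x y

/-- The composition `∑ m(f(x₁) ⊗ ⋯ ⊗ f(xᵣ))`. -/
def compHat (m : MultiMap W U p) (f : MultiMap V W 0) : MultiMap V U p where
  toFun x e := hat f.el (fun s => m.toFun s e) x
  linear e := WordLinear.hat (m.linear e) f
  degree x e he := by
    rw [hat_congr_wdeg (K' := fun _ => 0), hat_zero]
    exact fun s hs => m.degree s e (by rwa [hs])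

/-- The sum of the values on a word in which an operation has been inserted. -/
def compDer (f : MultiMap V W p) (m : MultiMap V V q) (r : ℤ) (hr : q + p = r) :
    MultiMap V W r where
  toFun x e := der m.el (fun s => f.toFun s e) x
  linear e := WordLinear.der (f.linear e) m
  degree x e he := by
    rw [der_congr_wdeg (K' := fun _ => 0)]
    · simp only [der, smul_zero]
      exact cs3_eq_zero fun _ _ _ _ => rfl
    · exact fun s hs => f.degree s e (by omega)

/-- The restriction to the words whose length satisfies `P`. -/
def restr (P : ℕ → Prop) [DecidablePred P] (f : MultiMap V W p) : MultiMap V W p where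
  toFun x e := if P x.length then f.toFun x e else 0
  linear e xs ys d r a b := by
    simp only [List.length_append, List.length_cons]
    split_ifs
    · exact f.linear e xs ys d r a b
    · simp
  degree x e he := by
    split_ifs
    · exact f.degree x e he
    · rfl

theorem restr_pos {P : ℕ → Prop} [DecidablePred P] (f : MultiMap V W p) {x : V.Word}
    (h : P x.length) (e : ℤ) : (f.restr P).toFun x e = f.toFun x e := if_pos h

theorem restr_neg {P : ℕ → Prop} [DecidablePred P] (f : MultiMap V W p) {x : V.Word}
    (h : ¬P x.length) (e : ℤ) : (f.restr P).toFun x e = 0 := if_neg h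

theorem el_congr {f g : MultiMap V W p} {x : V.Word} (h : ∀ e, f.toFun x e = g.toFun x e) :
    f.el x = g.el x := by
  simp only [el, h]

instance : Zero (MultiMap V W p) :=
  ⟨{ toFun := fun _ _ => 0
     linear := fun _ => WordLinear.zero
     degree := fun _ _ _ => rfl }⟩

/-- A degree preserving contractive operation on multilinear families has a fixed point. -/
theorem exists_fixedPoint (Φ : MultiMap V W p → MultiMap V W p)
    (hΦ : ∀ (f g : MultiMap V W p) (w : V.Word),
      (∀ x : V.Word, x.length < w.length → ∀ e, f.toFun x e = g.toFun x e) →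
      ∀ e, (Φ f).toFun w e = (Φ g).toFun w e) :
    ∃ f : MultiMap V W p, ∀ w e, f.toFun w e = (Φ f).toFun w e := by
  have stable : ∀ (n j k : ℕ) (w : V.Word), w.length < n → n ≤ j → n ≤ k → ∀ e,
      (Φ^[j] 0).toFun w e = (Φ^[k] 0).toFun w e := by
    intro n
    induction n with
    | zero => intro j k w h; omega
    | succ n ih =>
      intro j k w h hj hk e
      obtain ⟨j, rfl⟩ := Nat.exists_eq_add_of_le' (Nat.one_le_of_lt hj)
      obtain ⟨k, rfl⟩ := Nat.exists_eq_add_of_le' (Nat.one_le_of_lt hk)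
      rw [Function.iterate_succ_apply', Function.iterate_succ_apply']
      exact hΦ _ _ w (fun x hx => ih j k x (by omega) (by omega) (by omega)) e
  -- On words shorter than n the iterates agree from the n-th one on, so the limit on `w` can be
  -- read off at iterate `w.length + 1`.
  refine ⟨⟨fun w e => (Φ^[w.length + 1] 0).toFun w e, ?_, ?_⟩, ?_⟩
  · intro e xs ys d r a b
    simp only [List.length_append, List.length_cons]
    exact (Φ^[xs.length + (ys.length + 1) + 1] 0).linear e xs ys d r a b
  · exact fun w e he => (Φ^[w.length + 1] 0).degree w e he
  · intro w e
    simp only [Function.iterate_succ_apply']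
    apply hΦ
    intro x hx e
    refine (stable (x.length + 1) w.length (x.length + 1) x (by omega) (by omega) le_rfl e).trans ?_
    rw [Function.iterate_succ_apply']

/-- A family of linear maps of degree `p`, as a family of multilinear maps. -/
def ofLinear (L : ∀ d e, V.carrier d →ₗ[𝕜] W.carrier e) (p : ℤ)
    (hL : ∀ d e, e ≠ d + p → L d e = 0) : MultiMap V W p where
  toFun x e := match x with
    | [a] => L a.1 e a.2
    | _ => 0
  linear e xs ys d r a b := by
    cases xs with
    | nil => cases ys <;> simp
    | cons c xs => cases xs <;> simp
  degree x e he := by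
    match x with
    | [] => rfl
    | [a] => simp [hL a.1 e (by simpa using he)]
    | _ :: _ :: _ => rfl

theorem ofLinear_of_length_ne (L : ∀ d e, V.carrier d →ₗ[𝕜] W.carrier e) (p : ℤ)
    (hL : ∀ d e, e ≠ d + p → L d e = 0) {x : V.Word} (hx : x.length ≠ 1) (e : ℤ) :
    (ofLinear L p hL).toFun x e = 0 := by
  match x with
  | [] => rfl
  | [a] => simp at hx
  | _ :: _ :: _ => rfl

end MultiMap

/-! ### Compositions of insertions and substitutions -/

theorem hat_der_expand (f : MultiMap V W 0) (m : W.Word → W.El) (K : W.Word → M) (x : V.Word) :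
    hat f.el (der m K) x = cs3 (fun a b c => sgn 𝕜 (wdeg a) • hat f.el (fun s =>
      hat f.el (fun t => hat f.el (fun r => K (s ++ m r :: t)) b) c) a) x := by
  refine (hat_cs3 _ _ _).trans (cs3_congr fun a b c _ => ?_)
  rw [← hat_smul]
  refine hat_congr_wdeg fun s hs => ?_
  simp only [hat_smul, hs]
  rw [hat_comm]

/-- The block that receives the inserted operation is singled out as `b`. Together with
`hat_der_expand` this reduces the comparison of the two compositions to one block at a time. -/
theorem der_hat_expand (f : MultiMap V W 0) (m : V.Word → V.El) (K : W.Word → M) (x : V.Word) :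
    der m (hat f.el K) x = cs3 (fun a b c => sgn 𝕜 (wdeg a) • hat f.el (fun s =>
      hat f.el (fun t => der m (fun r => K (s ++ f.el r :: t)) b) c) a) x := by
  simp only [der, hat_append_cons]
  have e₁ : ∀ a b c : V.Word, sgn 𝕜 (wdeg a) • cs (fun x₁ x₂ => cs (fun y₁ y₂ => hat f.el
      (fun s => hat f.el (fun t => K (s ++ f.el (x₂ ++ m b :: y₁) :: t)) y₂) x₁) c) a =
      cs (fun a₁ a₂ => cs (fun c₁ c₂ => sgn 𝕜 (wdeg a₁) • sgn 𝕜 (wdeg a₂) • hat f.el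
      (fun s => hat f.el (fun t => K (s ++ f.el (a₂ ++ m b :: c₁) :: t)) c₂) a₁) c) a := by
    intro a b c
    rw [← cs_smul]
    refine cs_congr fun a₁ a₂ h => ?_
    rw [← cs_smul]
    simp only [← h, wdeg_append, sgn_add, smul_smul]
  simp only [e₁]
  refine (cs3_regroup_mid _ _).trans (cs3_congr fun a b c _ => ?_)
  simp only [hat_cs3_comm, ← cs3_smul, hat_smul]

/-- If `f` intertwines `m` and `m'` on all subwords that occur, then the induced maps on words
commute. -/
theorem hat_der_of {f : MultiMap V W 0} {m : MultiMap V V q} {m' : MultiMap W W q} {F : W.Word → M}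
    (hF : WordLinear F) {x : V.Word}
    (h : ∀ a b c, a ++ (b ++ c) = x → (∀ e, hat f.el (fun s => m'.toFun s e) b =
      der m.el (fun s => f.toFun s e) b) ∨
      (a = [] ∧ c = [] ∧ ∀ z, F [z] = 0)) :
    hat f.el (der m'.el F) x = der m.el (hat f.el F) x := by
  rw [hat_der_expand, der_hat_expand]
  refine cs3_congr fun a b c hx => ?_
  congr 1
  rcases h a b c hx with h | ⟨rfl, rfl, h⟩
  · congr 1; funext s
    congr 1; funext t
    rw [(hF.letter s t).hat_el m' f b (wdeg b + q) rfl,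
      (hF.letter s t).der_el f m b (wdeg b + q) (by ring), h]
  · simp only [hat_nil, List.nil_append, h, hat_zero]
    simp only [der, smul_zero]
    exact (cs3_eq_zero fun _ _ _ _ => rfl).symm

/-- Two insertions are disjoint or nested. Disjoint ones occur in both orders with opposite signs
and cancel; nested ones add up to the relation on the subword. -/
theorem der_der_of {m : MultiMap V V 1} (hm : ∀ x e, der m.el (fun s => m.toFun s e) x = 0)
    {F : V.Word → M} (hF : WordLinear F) (x : V.Word) : der m.el (der m.el F) x = 0 := by
  -- For the operation applied to `b`, the three sums collect the second operations that lie to the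
  -- left of it, contain it, or lie to the right of it.
  have e₁ : der m.el (der m.el F) x =
      cs3 (fun a b c => cs3 (fun p q r => sgn 𝕜 (wdeg q + wdeg r) •
        F (p ++ m.el q :: (r ++ m.el b :: c))) a) x +
      cs3 (fun a b c => cs (fun a₁ a₂ => cs (fun c₁ c₂ => sgn 𝕜 (wdeg a₁) • sgn 𝕜 (wdeg a₁) •
        sgn 𝕜 (wdeg a₂) • F (a₁ ++ m.el (a₂ ++ m.el b :: c₁) :: c₂)) c) a) x -
      cs3 (fun a b c => cs3 (fun p q r => sgn 𝕜 (wdeg b + wdeg p) •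
        F (a ++ m.el b :: (p ++ m.el q :: r))) c) x := by
    rw [← cs3_add, ← cs3_sub]
    refine cs3_congr fun a b c _ => ?_
    rw [der_append_cons, smul_add, smul_add, sub_eq_add_neg, ← cs3_neg]
    congr 1; congr 1
    · simp only [der, ← cs3_smul, smul_smul, ← sgn_add]
      refine cs3_congr fun p q r h => ?_
      simp only [List.append_assoc, List.cons_append]
      congr 1
      rw [← h]
      apply sgn_congr
      simp only [wdeg_append]; push_cast; grind
    · simp only [← cs_smul, smul_smul, ← sgn_add]
      refine cs_congr fun a₁ a₂ h => cs_congr fun _ _ _ => ?_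
      congr 1
      rw [← h]
      apply sgn_congr
      simp only [wdeg_append]; push_cast; grind
    · simp only [der, ← cs3_smul, smul_smul, ← sgn_add, ← neg_smul, neg_sgn]
      refine cs3_congr fun p q r h => ?_
      congr 1
      apply sgn_congr
      simp only [MultiMap.el]; push_cast; grind
  -- After regrouping, the first and the third sum are literally the same five-fold sum.
  rw [e₁, cs3_regroup_left, cs3_regroup_mid, add_sub_right_comm, sub_self, zero_add]
  refine cs3_eq_zero fun a y c _ => ?_
  simp only [cs3_smul]
  have := (hF.letter a c).der_el m m y _ rfl
  rw [hm, map_zero] at this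
  simp only [der] at this
  rw [this, smul_zero, smul_zero]

end Letters

/-! ### Functions that are supported on words of length at most one -/

section Single

variable {α : Type u} {β : Type u₁} {M : Type u₂} [AddCommGroup M]

theorem cs_eq_right {K : List α → List α → M} {x : List α}
    (h : ∀ a b, b ≠ [] → K a b = 0) : cs K x = K x [] := by
  induction x generalizing K with
  | nil => simp
  | cons a x ih => rw [cs_cons, h _ _ (by simp), zero_add, ih fun _ _ hb => h _ _ hb]

theorem cs_eq_left {K : List α → List α → M} {x : List α}
    (h : ∀ a b, a ≠ [] → K a b = 0) : cs K x = K [] x := by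
  cases x with
  | nil => simp
  | cons a x => rw [cs_cons, cs_eq_zero fun _ _ _ => h _ _ (by simp), add_zero]

theorem hat_of_nil (f : List α → β) {K : List β → M} (hK : ∀ a s, K (a :: s) = 0) {x : List α}
    (hx : x ≠ []) : hat f K x = 0 := by
  cases x with
  | nil => exact absurd rfl hx
  | cons a x =>
    rw [hat_cons]
    exact cs_eq_zero fun p q _ => by simp only [hK, hat_zero]

theorem hat_of_single (f : List α → β) {K : List β → M} (hK : ∀ s, s.length ≠ 1 → K s = 0)
    {x : List α} (hx : x ≠ []) : hat f K x = K [f x] := by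
  cases x with
  | nil => exact absurd rfl hx
  | cons a x =>
    rw [hat_cons, cs_eq_right, hat_nil]
    exact fun p q hq => hat_of_nil f
      (K := fun s => K (f (a :: p) :: s)) (fun b s => hK _ (by simp)) hq

/-- Inserting an operation leaves a word of one letter only if it absorbs the whole word. -/
theorem der_of_single {𝕜 : Type v} [Field 𝕜] {V : GradedSpace.{v, u} 𝕜} [Module 𝕜 M]
    (m : V.Word → V.El) {K : V.Word → M} (hK : ∀ s, s.length ≠ 1 → K s = 0) (x : V.Word) :
    der m K x = K [m x] := by
  unfold der cs3
  rw [cs_eq_left, cs_eq_right]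
  · simp
  · intro b c hc
    beta_reduce
    rw [hK, smul_zero]
    simpa using hc
  · intro a r ha
    refine cs_eq_zero fun b c _ => ?_
    beta_reduce
    rw [hK, smul_zero]
    have := List.length_pos_of_ne_nil ha
    simp only [List.length_append, List.length_cons]
    omega

end Single

namespace MultiMap

variable {𝕜 : Type v} [Field 𝕜] {V : GradedSpace.{v, u} 𝕜} {W : GradedSpace.{v, u₁} 𝕜}
  {U : GradedSpace.{v, u₃} 𝕜} {p q : ℤ}

instance : Sub (MultiMap V W p) :=
  ⟨fun f g =>
    { toFun := fun x e => f.toFun x e - g.toFun x e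
      linear := fun e => (f.linear e).sub (g.linear e)
      degree := fun x e he => by rw [f.degree x e he, g.degree x e he, sub_zero] }⟩

theorem sub_toFun (f g : MultiMap V W p) (x : V.Word) (e : ℤ) :
    (f - g).toFun x e = f.toFun x e - g.toFun x e := rfl

/-- The composition of a family with the linear part of another one. -/
def postComp (s : MultiMap W U q) (f : MultiMap V W p) (r : ℤ) (hr : p + q = r) :
    MultiMap V U r where
  toFun x e := s.toFun [f.el x] e
  linear e := ((s.linear e).letter [] []).el_linear f
  degree x e he := s.degree _ _ (by simp only [wdeg_cons, wdeg_nil, el]; omega)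

theorem postComp_el (s : MultiMap W U q) (f : MultiMap V W p) (r : ℤ) (hr : p + q = r)
    (x : V.Word) : (s.postComp f r hr).el x = s.el [f.el x] := by
  rw [s.el_eq [f.el x] (wdeg x + r) (by simp only [wdeg_cons, wdeg_nil, el]; omega)]
  rfl

end MultiMap

/-! ### Structures and homomorphisms as identities between substitutions and insertions -/

section Letters

variable {𝕜 : Type v} [Field 𝕜] {V : GradedSpace.{v, u} 𝕜} {W : GradedSpace.{v, u₁} 𝕜}
  {U : GradedSpace.{v, u₃} 𝕜} {M : Type u₂} [AddCommGroup M] [Module 𝕜 M] {p q : ℤ}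

theorem LetterLinear.comp_el {L : U.El → M} (hL : LetterLinear L) (s : MultiMap V U p) :
    LetterLinear fun z => L (s.el [z]) := (hL.el_linear s).letter [] []

theorem LetterLinear.compHat_el {L : U.El → M} (h : LetterLinear L) (m : MultiMap W U p)
    (f : MultiMap V W 0) (x : V.Word) :
    L ((m.compHat f).el x) = hat f.el (fun s => L (m.el s)) x :=
  (h.hat_el m f x _ rfl).symm

theorem LetterLinear.el_add {L : U.El → M} (h : LetterLinear L) {f g k : MultiMap V U p}
    {x : V.Word} (hx : ∀ e, f.toFun x e = g.toFun x e + k.toFun x e) :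
    L (f.el x) = L (g.el x) + L (k.el x) := by
  simp only [h.el _ x _ rfl, hx, map_add]

theorem LetterLinear.el_sub {L : U.El → M} (h : LetterLinear L) {f g k : MultiMap V U p}
    {x : V.Word} (hx : ∀ e, f.toFun x e = g.toFun x e - k.toFun x e) :
    L (f.el x) = L (g.el x) - L (k.el x) := by
  simp only [h.el _ x _ rfl, hx, map_sub]

theorem MultiMap.letterLinear (f : MultiMap V W p) (e : ℤ) :
    LetterLinear fun z => f.toFun [z] e := f.toFun_letterLinear [] [] e

/-- An `A∞`-structure on a graded space: `m ∘ m̂ = 0` and `m₀ = 0`. -/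
structure IsAInf (m : MultiMap V V 1) : Prop where
  nil : ∀ e, m.toFun [] e = 0
  relation : ∀ x e, der m.el (fun s => m.toFun s e) x = 0

theorem AInfAlgebra.isAInf (A : AInfAlgebra.{v, u} 𝕜) : IsAInf A.m where
  nil := A.m_nil
  relation x e := by
    rw [← A.relation x e]
    exact (cuts₃_sum (fun a b c => sgn 𝕜 (wdeg a) • A.m.toFun (a ++ A.m.el b :: c) e) x).symm

/-- The `A∞`-algebra of an `A∞`-structure on a graded space. -/
def IsAInf.toAlgebra {m : MultiMap V V 1} (h : IsAInf m) : AInfAlgebra.{v, u} 𝕜 where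
  space := V
  m := m
  m_nil := h.nil
  relation x e := by
    rw [← h.relation x e]
    exact cuts₃_sum (fun a b c => sgn 𝕜 (wdeg a) • m.toFun (a ++ m.el b :: c) e) x

/-- The relation of an `A∞`-homomorphism. -/
def Intertwines (f : MultiMap V W 0) (m : MultiMap V V 1) (m' : MultiMap W W 1) : Prop :=
  ∀ x e, hat f.el (fun s => m'.toFun s e) x = der m.el (fun s => f.toFun s e) x

theorem AInfHom.intertwines {A : AInfAlgebra.{v, u} 𝕜} {B : AInfAlgebra.{v, u₁} 𝕜}
    (f : AInfHom A B) : Intertwines f.f A.m B.m := fun x e =>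
  (f.relation x e).trans
    (cuts₃_sum (fun a b c => sgn 𝕜 (wdeg a) • f.f.toFun (a ++ A.m.el b :: c) e) x)

/-- The `A∞`-homomorphism given by a family that satisfies the relation. -/
def Intertwines.toHom {A : AInfAlgebra.{v, u} 𝕜} {B : AInfAlgebra.{v, u₁} 𝕜}
    {f : MultiMap A.space B.space 0} (h : Intertwines f A.m B.m) (h₀ : ∀ e, f.toFun [] e = 0) :
    AInfHom A B where
  f := f
  f_nil := h₀
  relation x e := (h x e).trans
    (cuts₃_sum (fun a b c => sgn 𝕜 (wdeg a) • f.toFun (a ++ A.m.el b :: c) e) x).symm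

theorem Intertwines.hat_der {f : MultiMap V W 0} {m : MultiMap V V 1} {m' : MultiMap W W 1}
    (h : Intertwines f m m') {F : W.Word → M} (hF : WordLinear F) (x : V.Word) :
    hat f.el (der m'.el F) x = der m.el (hat f.el F) x :=
  hat_der_of hF fun _ _ _ _ => Or.inl fun e => h _ e

theorem Intertwines.letter {f : MultiMap V W 0} {m : MultiMap V V 1} {m' : MultiMap W W 1}
    (h : Intertwines f m m') {L : W.El → M} (hL : LetterLinear L) (x : V.Word) :
    hat f.el (fun s => L (m'.el s)) x = der m.el (fun s => L (f.el s)) x := by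
  rw [hL.hat_el m' f x _ rfl, hL.der_el f m x (wdeg x + 1) (by ring), h]

theorem IsAInf.letter {m : MultiMap V V 1} (h : IsAInf m) {L : V.El → M} (hL : LetterLinear L)
    (x : V.Word) : der m.el (fun s => L (m.el s)) x = 0 := by
  rw [hL.der_el m m x _ rfl, h.relation, map_zero]

theorem der_singleton {m : MultiMap V V p} (h : ∀ e, m.toFun [] e = 0) {F : V.Word → M}
    (hF : WordLinear F) (a : V.El) : der m.el F [a] = F [m.el [a]] := by
  rw [der_cons, der_nil, cs_cons, cs_nil]
  have e₁ := (hF.letter [] [a]).el_eq_zero m [] h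
  have e₂ := (hF.letter [a] []).el_eq_zero m [] h
  simp only [List.nil_append, List.singleton_append] at e₁ e₂
  rw [e₁, e₂, smul_zero, zero_add, add_zero]

theorem IsAInf.m_m {m : MultiMap V V 1} (h : IsAInf m) (a : V.El) (e : ℤ) :
    m.toFun [m.el [a]] e = 0 := by
  rw [← h.relation [a] e, der_singleton h.nil (m.linear e)]

/-- The linear part of the structure maps. -/
def MultiMap.linPart (m : MultiMap V W p) : MultiMap V W p := m.restr (· = 1)

/-- The part of the structure maps that consists of the operations with at least two inputs. -/
def MultiMap.highPart (m : MultiMap V W p) : MultiMap V W p := m.restr (2 ≤ ·)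

theorem MultiMap.linPart_add_highPart {m : MultiMap V W p} (h : ∀ e, m.toFun [] e = 0)
    (x : V.Word) (e : ℤ) : m.toFun x e = m.linPart.toFun x e + m.highPart.toFun x e := by
  simp only [linPart, highPart, restr]
  match x with
  | [] => simp [h]
  | [a] => simp
  | _ :: _ :: _ => simp

theorem MultiMap.highPart_singleton (m : MultiMap V W p) (a : V.El) (e : ℤ) :
    m.highPart.toFun [a] e = 0 := restr_neg m (by simp) e

theorem MultiMap.linPart_of_ne (m : MultiMap V W p) {x : V.Word} (hx : x.length ≠ 1) (e : ℤ) :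
    m.linPart.toFun x e = 0 := restr_neg m hx e

/-- Split the outer operation in the relation as linear part plus higher part. The linear part
contributes m₁ applied to m(x), and m₁ m₁ = 0 leaves only m₁ of the higher part. -/
theorem IsAInf.der_highPart {m : MultiMap V V 1} (h : IsAInf m) {L : V.El → M}
    (hL : LetterLinear L) (x : V.Word) : der m.el (fun s => L (m.highPart.el s)) x =
      -L (m.el [m.highPart.el x]) := by
  have e₁ := h.letter hL x
  have e₂ : ∀ s, L (m.el s) = L (m.linPart.el s) + L (m.highPart.el s) := fun s =>
    hL.el_add (m.linPart_add_highPart h.nil s)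
  have e₃ : ∀ s : V.Word, s.length ≠ 1 → L (m.linPart.el s) = 0 := fun s hs =>
    hL.el_eq_zero _ _ (m.linPart_of_ne hs)
  simp only [e₂, der_add] at e₁
  rw [der_of_single m.el e₃] at e₁
  have e₄ : L (m.linPart.el [m.el x]) = L (m.el [m.el x]) := by
    congr 1
  have e₅ := (hL.comp_el m).el_add (m.linPart_add_highPart h.nil x)
  have e₆ : L (m.el [m.linPart.el x]) = 0 := by
    by_cases hx : x.length = 1
    · obtain ⟨a, rfl⟩ := List.length_eq_one_iff.1 hx
      apply hL.el_eq_zero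
      intro e
      have : m.linPart.el [a] = m.el [a] := MultiMap.el_congr fun e => m.restr_pos rfl e
      rw [this, h.m_m]
    · exact (hL.comp_el m).el_eq_zero _ _ (m.linPart_of_ne hx)
  rw [e₄, e₅, e₆, zero_add] at e₁
  exact eq_neg_of_add_eq_zero_right e₁

end Letters

/-! ### Contractions and the inclusion of the minimal model -/

/-- A contraction of the complex `(V, m₁)` onto a graded space `H`, with the side conditions. -/
structure Contraction {𝕜 : Type v} [Field 𝕜] {V : GradedSpace.{v, u} 𝕜} (m : MultiMap V V 1)
    (H : GradedSpace.{v, u} 𝕜) where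
  /-- the inclusion -/
  i : MultiMap H V 0
  /-- the projection -/
  p : MultiMap V H 0
  /-- the homotopy -/
  s : MultiMap V V (-1)
  i_of_ne : ∀ x : H.Word, x.length ≠ 1 → ∀ e, i.toFun x e = 0
  p_of_ne : ∀ x : V.Word, x.length ≠ 1 → ∀ e, p.toFun x e = 0
  m_i : ∀ a e, m.toFun [i.el [a]] e = 0
  p_m : ∀ a e, p.toFun [m.el [a]] e = 0
  p_i : ∀ a, p.el [i.el [a]] = a
  s_s : ∀ a e, s.toFun [s.el [a]] e = 0
  s_i : ∀ a e, s.toFun [i.el [a]] e = 0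
  p_s : ∀ a e, p.toFun [s.el [a]] e = 0
  homotopy : ∀ d (x : V.carrier d), m.toFun [s.el [⟨d, x⟩]] d + s.toFun [m.el [⟨d, x⟩]] d =
    x - i.toFun [p.el [⟨d, x⟩]] d

namespace Contraction

variable {𝕜 : Type v} [Field 𝕜] {V : GradedSpace.{v, u} 𝕜} {m : MultiMap V V 1}
  {H : GradedSpace.{v, u} 𝕜} (C : Contraction m H) {M : Type u₂} [AddCommGroup M] [Module 𝕜 M]

/-- One step of the recursion for the inclusion of the minimal model. -/
def inclStep (h : MultiMap H V 0) : MultiMap H V 0 :=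
  C.i - C.s.postComp (m.highPart.compHat h) 0 (by norm_num)

theorem exists_incl : ∃ h : MultiMap H V 0, ∀ x e, h.toFun x e = (C.inclStep h).toFun x e := by
  refine MultiMap.exists_fixedPoint _ fun f g w hfg e => ?_
  simp only [inclStep, MultiMap.sub_toFun, MultiMap.postComp]
  congr 3
  refine MultiMap.el_congr fun e => ?_
  exact hat_congr_fun_of_singleton (fun b hb => MultiMap.el_congr (hfg b hb))
    (K := fun s => m.highPart.toFun s e) (fun z => m.highPart_singleton z e) le_rfl

/-- The inclusion of the minimal model. -/
noncomputable def incl : MultiMap H V 0 := C.exists_incl.choose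

/-- The value of the higher operations on the inclusion of the minimal model. -/
noncomputable def core : MultiMap H V 1 := m.highPart.compHat C.incl

/-- The operations of the minimal model. -/
noncomputable def mMin : MultiMap H H 1 := C.p.postComp C.core 1 (by norm_num)

theorem incl_toFun (x : H.Word) (e : ℤ) :
    C.incl.toFun x e = C.i.toFun x e - C.s.toFun [C.core.el x] e :=
  C.exists_incl.choose_spec x e

theorem mMin_el (x : H.Word) : C.mMin.el x = C.p.el [C.core.el x] :=
  MultiMap.postComp_el _ _ _ _ _

theorem core_nil (e : ℤ) : C.core.toFun [] e = 0 := by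
  simp only [core, MultiMap.compHat, hat_nil]
  exact m.restr_neg (by simp) e

theorem core_singleton (a : H.El) (e : ℤ) : C.core.toFun [a] e = 0 := by
  simp only [core, MultiMap.compHat, hat_singleton]
  exact m.highPart_singleton _ _

theorem mMin_nil (e : ℤ) : C.mMin.toFun [] e = 0 :=
  (C.p.letterLinear e).el_eq_zero _ _ C.core_nil

theorem mMin_singleton (a : H.El) (e : ℤ) : C.mMin.toFun [a] e = 0 :=
  (C.p.letterLinear e).el_eq_zero _ _ (C.core_singleton a)

theorem incl_nil (e : ℤ) : C.incl.toFun [] e = 0 := by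
  rw [incl_toFun, C.i_of_ne [] (by simp), (C.s.letterLinear e).el_eq_zero _ _ C.core_nil, sub_zero]

theorem incl_singleton (a : H.El) (e : ℤ) : C.incl.toFun [a] e = C.i.toFun [a] e := by
  rw [incl_toFun, (C.s.letterLinear e).el_eq_zero _ _ (C.core_singleton a), sub_zero]

theorem letter_incl {L : V.El → M} (hL : LetterLinear L) (x : H.Word) :
    L (C.incl.el x) = L (C.i.el x) - L (C.s.el [C.core.el x]) := by
  rw [← MultiMap.postComp_el C.s C.core 0 (by norm_num)]
  exact hL.el_sub (C.incl_toFun x)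

theorem letter_i {L : V.El → M} (hL : LetterLinear L) (h : ∀ a, L (C.i.el [a]) = 0) (x : H.Word) :
    L (C.i.el x) = 0 := by
  by_cases hx : x.length = 1
  · obtain ⟨a, rfl⟩ := List.length_eq_one_iff.1 hx
    exact h a
  · exact hL.el_eq_zero _ _ (C.i_of_ne x hx)

/-- Intertwining turns `core` ∘ m̂_H into the higher operations applied after m̂ and the inclusion,
to which `IsAInf.der_highPart` applies. The relation is needed on shorter words only, because the
higher part vanishes on single letters. -/
theorem der_core (hm : IsAInf m) {L : V.El → M} (hL : LetterLinear L) (x : H.Word)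
    (ih : ∀ y : H.Word, y.length < x.length → ∀ e, hat C.incl.el (fun s => m.toFun s e) y =
      der C.mMin.el (fun s => C.incl.toFun s e) y) :
    der C.mMin.el (fun u => L (C.core.el u)) x = -L (m.el [C.core.el x]) := by
  simp only [core, hL.compHat_el]
  rw [← hat_der_of (m' := m) (hL.el_linear _)]
  · rw [hat_congr (K' := fun t => -L (m.el [m.highPart.el t])) fun t _ =>
      hm.der_highPart hL _, hat_neg]
    rw [(hL.comp_el m).compHat_el]
  · intro a b c habc
    by_cases h : a = [] ∧ c = []
    · exact Or.inr ⟨h.1, h.2, fun z => hL.el_eq_zero _ _ (m.highPart_singleton z)⟩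
    · refine Or.inl (ih b ?_)
      subst habc
      simp only [List.length_append]
      rcases not_and_or.1 h with h | h
      · have := List.length_pos_of_ne_nil h; omega
      · have := List.length_pos_of_ne_nil h; omega

/-- Write c for `core` and h = i - s c. The two sides on a word are c - m₁ s c and i p c + s m₁ c,
the latter by `der_core`. They agree by the homotopy identity m₁ s + s m₁ = 1 - i p applied to c. -/
theorem incl_relation (hm : IsAInf m) : Intertwines C.incl C.mMin m := by
  intro x
  induction hn : x.length using Nat.strong_induction_on generalizing x with
  | _ n IH =>
    subst hn
    have ih : ∀ y : H.Word, y.length < x.length → ∀ e, hat C.incl.el (fun s => m.toFun s e) y =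
      der C.mMin.el (fun s => C.incl.toFun s e) y := fun y hy => IH _ hy y rfl
    intro e
    -- Both sides are homogeneous of degree one, so only this component needs an argument.
    by_cases he : e = wdeg x + 1
    swap
    · rw [show hat C.incl.el (fun s => m.toFun s e) x = 0 from (m.compHat C.incl).degree x e he]
      exact ((C.incl.compDer C.mMin 1 (by norm_num)).degree x e he).symm
    subst he
    by_cases hx : x = []
    · subst hx
      rw [hat_nil, der_nil, hm.nil, (C.incl.letterLinear _).el_eq_zero _ _ C.mMin_nil]
    have e₁ : hat C.incl.el (fun s => m.toFun s (wdeg x + 1)) x =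
        m.toFun [C.incl.el x] (wdeg x + 1) + C.core.toFun x (wdeg x + 1) := by
      simp only [m.linPart_add_highPart hm.nil, hat_add]
      rw [hat_of_single _ (fun s hs => m.linPart_of_ne hs _) hx]
      simp only [m.highPart_singleton, add_zero]
      rfl
    have e₂ := C.letter_incl (m.letterLinear (wdeg x + 1)) x
    rw [C.letter_i (m.letterLinear _) (fun a => C.m_i a _), zero_sub] at e₂
    have e₃ : der C.mMin.el (fun s => C.incl.toFun s (wdeg x + 1)) x =
        C.i.toFun [C.mMin.el x] (wdeg x + 1) + C.s.toFun [m.el [C.core.el x]] (wdeg x + 1) := by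
      simp only [incl_toFun, der_sub]
      rw [der_of_single _ (fun s hs => C.i_of_ne s hs _),
        C.der_core hm (C.s.letterLinear (wdeg x + 1)) x ih, sub_neg_eq_add]
    rw [e₁, e₂, e₃, mMin_el]
    have := C.homotopy _ (C.core.el x).2
    change m.toFun [C.s.el [C.core.el x]] (wdeg x + 1) + C.s.toFun [m.el [C.core.el x]] (wdeg x + 1)
      = C.core.toFun x (wdeg x + 1) - C.i.toFun [C.p.el [C.core.el x]] (wdeg x + 1) at this
    rw [eq_sub_iff_add_eq] at this
    rw [← this]
    abel

/-- Apply p to `der_core`: the right-hand side dies because p m₁ = 0. -/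
theorem isAInf_mMin (hm : IsAInf m) : IsAInf C.mMin where
  nil := C.mMin_nil
  relation x e := by
    have := C.der_core hm (C.p.letterLinear e) x (fun y _ => C.incl_relation hm y)
    rw [C.p_m, neg_zero] at this
    exact this

end Contraction

/-! ### Composition of substitutions, linear and higher insertions, and the homotopy on words -/

section Functoriality

variable {𝕜 : Type v} [Field 𝕜] {V : GradedSpace.{v, u} 𝕜} {W : GradedSpace.{v, u₁} 𝕜}
  {U : GradedSpace.{v, u₃} 𝕜} {M : Type u₂} [AddCommGroup M] [Module 𝕜 M] {p q : ℤ}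

theorem LetterLinear.hat {G : V.El → W.Word → M} (h : ∀ s, LetterLinear fun z => G z s)
    {α : Type*} (f : List α → W.El) (x : List α) :
    LetterLinear fun z => AInf.hat f (fun s => G z s) x := by
  intro d r a b
  simp only [h _ d r a b, hat_add, hat_smul]

theorem LetterLinear.der {G : V.El → W.Word → M} (h : ∀ s, LetterLinear fun z => G z s)
    (m : W.Word → W.El) (x : W.Word) :
    LetterLinear fun z => AInf.der m (fun s => G z s) x := by
  intro d r a b
  simp only [h _ d r a b, der_add, der_smul]

/-- Substitution is compatible with composition. -/
theorem hat_hat (f : MultiMap V W 0) (g : MultiMap W U 0) {F : U.Word → M} (hF : WordLinear F)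
    (x : V.Word) : hat f.el (hat g.el F) x = hat (g.compHat f).el F x := by
  induction hn : x.length using Nat.strong_induction_on generalizing x F with
  | _ n ih =>
    cases x with
    | nil => simp
    | cons a x =>
      have e₁ : ∀ B Q : V.Word, hat (g.compHat f).el
          (fun s => F ((g.compHat f).el (a :: B) :: s)) Q = cs (fun b c => hat f.el (fun s =>
            hat (g.compHat f).el (fun t => F (g.el (f.el (a :: b) :: s) :: t)) Q) c) B := by
        intro B Q
        have hL : LetterLinear fun z => hat (g.compHat f).el (fun s => F (z :: s)) Q :=
          LetterLinear.hat (fun s => hF.letter_head s) _ _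
        refine (hL.compHat_el g f (a :: B)).trans ?_
        rw [hat_cons]
      rw [hat_cons, hat_cons]
      simp only [e₁]
      refine Eq.trans ?_ (cs_assoc (fun b c Q => hat f.el (fun s => hat (g.compHat f).el
        (fun t => F (g.el (f.el (a :: b) :: s) :: t)) Q) c) x).symm
      refine cs_congr fun b q hbq => ?_
      simp only [hat_cons]
      rw [hat_cs]
      refine cs_congr fun q₁ q₂ hq => ?_
      congr 1; funext s
      refine ih q₂.length ?_ (hF.cons _) _ rfl
      subst hn hbq hq
      simp only [List.length_cons, List.length_append]
      omega

theorem hat_of_ne_nil {f : MultiMap V W 0} (hf : ∀ e, f.toFun [] e = 0) {F : W.Word → M}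
    (hF : WordLinear F) {x : V.Word} (hx : x ≠ []) :
    hat f.el F x = cs (fun p q => hat f.el (fun s => F (f.el p :: s)) q) x := by
  cases x with
  | nil => exact absurd rfl hx
  | cons a x =>
    rw [hat_cons, cs_cons]
    simp only [(hF.letter_head _).el_eq_zero f [] hf, hat_zero, zero_add]

theorem der_congr_ne_nil {m : V.Word → V.El} {K K' : V.Word → M} {x : V.Word}
    (h : ∀ s, s ≠ [] → K s = K' s) : der m K x = der m K' x :=
  cs3_congr fun a b c _ => by rw [h _ (by simp)]

/-- An operation with at least two inputs shortens the word. Since the homotopy on words preserves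
the length, this makes the recursion for the projection onto the minimal model well founded. -/
theorem der_congr_highPart {m : MultiMap V V q} {K K' : V.Word → M} (hK : WordLinear K)
    (hK' : WordLinear K') {x : V.Word} (h : ∀ s : V.Word, s.length < x.length → K s = K' s) :
    der m.highPart.el K x = der m.highPart.el K' x := by
  refine cs3_congr fun a b c hx => ?_
  by_cases hb : 2 ≤ b.length
  · rw [h]
    subst hx
    simp only [List.length_append, List.length_cons]
    omega
  · have e₁ := (hK.letter a c).el_eq_zero m.highPart b (m.restr_neg hb)
    have e₂ := (hK'.letter a c).el_eq_zero m.highPart b (m.restr_neg hb)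
    beta_reduce at e₁ e₂
    rw [e₁, e₂]

theorem der_zero (m : V.Word → V.El) (x : V.Word) : der m (fun _ => (0 : M)) x = 0 :=
  cs3_eq_zero fun _ _ _ _ => smul_zero _

theorem der_linPart_nil {m : MultiMap V V q} {F : V.Word → M} (hF : WordLinear F) :
    der m.linPart.el F [] = 0 := by
  rw [der_nil]
  exact (hF.letter_head []).el_eq_zero _ [] (m.linPart_of_ne (by simp))

theorem der_linPart_cons {m : MultiMap V V q} {F : V.Word → M} (hF : WordLinear F) (a : V.El)
    (x : V.Word) : der m.linPart.el F (a :: x) = F (m.el [a] :: x) +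
      sgn 𝕜 a.1 • der m.linPart.el (fun s => F (a :: s)) x := by
  have : ∀ b : V.Word, b.length ≠ 1 → ∀ c, F (m.linPart.el b :: c) = 0 := fun b hb c =>
    (hF.letter_head c).el_eq_zero _ b (m.linPart_of_ne hb)
  rw [der_cons, cs_cons, this [] (by simp), zero_add, cs_eq_left]
  · rw [show m.linPart.el [a] = m.el [a] from
      MultiMap.el_congr fun e => m.restr_pos rfl e]
  · exact fun p q hp => this _ (by simpa using hp) _

theorem der_eq_linPart_add_highPart {m : MultiMap V V q} (h : ∀ e, m.toFun [] e = 0)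
    {F : V.Word → M} (hF : WordLinear F) (x : V.Word) :
    der m.el F x = der m.linPart.el F x + der m.highPart.el F x := by
  unfold der
  rw [← cs3_add]
  refine cs3_congr fun a b c _ => ?_
  rw [← smul_add]
  congr 1
  exact (hF.letter a c).el_add (m.linPart_add_highPart h b)

theorem IsAInf.der_linPart_linPart {m : MultiMap V V 1} (h : IsAInf m) {F : V.Word → M}
    (hF : WordLinear F) (x : V.Word) : der m.linPart.el (der m.linPart.el F) x = 0 := by
  refine der_der_of (fun x e => ?_) hF x
  rw [der_of_single _ fun s hs => m.linPart_of_ne hs e]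
  by_cases hx : x.length = 1
  · obtain ⟨a, rfl⟩ := List.length_eq_one_iff.1 hx
    rw [show m.linPart.el [a] = m.el [a] from
      MultiMap.el_congr fun e => m.restr_pos rfl e]
    exact (m.restr_pos rfl e).trans (h.m_m a e)
  · exact (m.linPart.letterLinear e).el_eq_zero _ _ (m.linPart_of_ne hx)

/-- The sum of `(-1)^{|y|} K (π(y) ⊗ s(a) ⊗ z)` over all ways to write `x = y a z`. -/
def sop (π s : V.El → V.El) : (V.Word → M) → V.Word → M
  | _, [] => 0
  | K, a :: x => K (s a :: x) + sgn 𝕜 a.1 • sop π s (fun t => K (π a :: t)) x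

variable (π s : V.El → V.El)

theorem sop_nil (K : V.Word → M) : sop π s K [] = 0 := rfl

theorem sop_cons (K : V.Word → M) (a : V.El) (x : V.Word) : sop π s K (a :: x) =
    K (s a :: x) + sgn 𝕜 a.1 • sop π s (fun t => K (π a :: t)) x := rfl

theorem sop_add (K K' : V.Word → M) (x : V.Word) :
    sop π s (fun t => K t + K' t) x = sop π s K x + sop π s K' x := by
  induction x generalizing K K' with
  | nil => simp [sop_nil]
  | cons a x ih => simp only [sop_cons, ih, smul_add]; abel

theorem map_sop {N : Type*} [AddCommGroup N] [Module 𝕜 N] (φ : M →ₗ[𝕜] N) (K : V.Word → M)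
    (x : V.Word) : φ (sop π s K x) = sop π s (fun t => φ (K t)) x := by
  induction x generalizing K with
  | nil => simp [sop_nil]
  | cons a x ih => simp only [sop_cons, map_add, map_smul, ih]

theorem sop_smul (r : 𝕜) (K : V.Word → M) (x : V.Word) :
    sop π s (fun t => r • K t) x = r • sop π s K x :=
  (map_sop π s (r • LinearMap.id) K x).symm

theorem sop_neg (K : V.Word → M) (x : V.Word) :
    sop π s (fun t => -K t) x = -sop π s K x := by
  simpa using sop_smul π s (-1) K x

theorem sop_sub (K K' : V.Word → M) (x : V.Word) :
    sop π s (fun t => K t - K' t) x = sop π s K x - sop π s K' x := by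
  simp only [sub_eq_add_neg, sop_add, sop_neg]

theorem sop_zero (x : V.Word) : sop π s (fun _ => (0 : M)) x = 0 := by
  simpa using sop_smul π s 0 (fun _ => (0 : M)) x

theorem sop_der_comm {m : W.Word → W.El} (K : V.Word → W.Word → M) (x : V.Word)
    (y : W.Word) : sop π s (fun t => der m (fun u => K t u) y) x =
      der m (fun u => sop π s (fun t => K t u) x) y := by
  induction x generalizing K with
  | nil =>
    simp only [sop_nil, der, smul_zero]
    exact (cs3_eq_zero fun _ _ _ _ => rfl).symm
  | cons a x ih => simp only [sop_cons, ih, der_add, der_smul]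

/-- The homotopy acts either on the first part, leaving the second one unchanged, or on the second
part. In the second case every letter of the first part is projected. -/
theorem sop_cs (K : V.Word → V.Word → M) (x : V.Word) : sop π s (cs K) x =
    cs (fun a b => sop π s (fun t => K t b) a +
      sgn 𝕜 (wdeg a) • sop π s (fun t => K (a.map π) t) b) x := by
  induction x generalizing K with
  | nil => simp [sop_nil]
  | cons a x ih =>
    simp only [sop_cons, cs_cons, sop_add, sop_nil, wdeg_nil, sgn_zero, one_smul, zero_add,
      List.map_nil, wdeg_cons, sgn_add, List.map_cons, smul_add, mul_smul]
    rw [show sop π s (fun t => cs (fun p q => K (π a :: p) q) t) x =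
      sop π s (cs fun p q => K (π a :: p) q) x from rfl, ih]
    simp only [← cs_smul, smul_add, cs_add]
    abel

variable {π s}

theorem sop_congr (hπ : ∀ a, (π a).1 = a.1) (hs : ∀ a, (s a).1 = a.1 - 1) {K K' : V.Word → M}
    {x : V.Word} (h : ∀ t : V.Word, t.length = x.length → wdeg t = wdeg x - 1 → K t = K' t) :
    sop π s K x = sop π s K' x := by
  induction x generalizing K K' with
  | nil => rfl
  | cons a x ih =>
    rw [sop_cons, sop_cons, h (s a :: x) (by simp) (by simp [hs]; ring), ih]
    intro t ht ht'
    exact h _ (by simp [ht]) (by simp [ht', hπ]; ring)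

end Functoriality

/-! ### The projection onto the minimal model -/

namespace Contraction

variable {𝕜 : Type v} [Field 𝕜] {V : GradedSpace.{v, u} 𝕜} {m : MultiMap V V 1}
  {H : GradedSpace.{v, u} 𝕜} (C : Contraction m H) {M : Type u₂} [AddCommGroup M] [Module 𝕜 M]

/-- The projection onto the image of `H`. -/
def proj (a : V.El) : V.El := C.i.el [C.p.el [a]]

/-- The homotopy on homogeneous elements. -/
def hom (a : V.El) : V.El := C.s.el [a]

theorem proj_fst (a : V.El) : (C.proj a).1 = a.1 := by simp [proj, MultiMap.el]

theorem hom_fst (a : V.El) : (C.hom a).1 = a.1 - 1 := by simp [hom, MultiMap.el]; ring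

theorem proj_linear {L : V.El → M} (hL : LetterLinear L) : LetterLinear fun z => L (C.proj z) :=
  (hL.comp_el C.i).comp_el C.p

theorem hom_linear {L : V.El → M} (hL : LetterLinear L) : LetterLinear fun z => L (C.hom z) :=
  hL.comp_el C.s

variable {C} in
theorem proj_m {L : V.El → M} (hL : LetterLinear L) (a : V.El) : L (C.proj (m.el [a])) = 0 :=
  (hL.comp_el C.i).el_eq_zero C.p _ (C.p_m a)

variable {C} in
theorem proj_hom {L : V.El → M} (hL : LetterLinear L) (a : V.El) : L (C.proj (C.hom a)) = 0 :=
  (hL.comp_el C.i).el_eq_zero C.p _ (C.p_s a)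

variable {C} in
theorem hom_hom {L : V.El → M} (hL : LetterLinear L) (a : V.El) : L (C.hom (C.hom a)) = 0 :=
  hL.el_eq_zero C.s _ (C.s_s a)

variable {C} in
theorem hom_proj {L : V.El → M} (hL : LetterLinear L) (a : V.El) : L (C.hom (C.proj a)) = 0 :=
  hL.el_eq_zero C.s _ (C.s_i _)

variable {C} in
theorem m_proj {L : V.El → M} (hL : LetterLinear L) (a : V.El) : L (m.el [C.proj a]) = 0 :=
  hL.el_eq_zero m _ (C.m_i _)

theorem p_proj (a : V.El) : C.p.el [C.proj a] = C.p.el [a] := C.p_i _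

variable {C} in
theorem letter_homotopy {L : V.El → M} (hL : LetterLinear L) (a : V.El) :
    L (m.el [C.hom a]) + L (C.hom (m.el [a])) = L a - L (C.proj a) := by
  obtain ⟨d, a⟩ := a
  have := congrArg (hL.toLinear d) (C.homotopy d a)
  rw [map_add, map_sub] at this
  rw [hL.el m _ d (by simp [hom, MultiMap.el])]
  simp only [hom, proj]
  rw [hL.el C.s _ d (by simp [MultiMap.el]), hL.el C.i _ d (by simp [MultiMap.el])]
  exact this

theorem sop_linear {F : V.Word → M} (hF : WordLinear F) : WordLinear (sop C.proj C.hom F) := by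
  intro xs
  induction xs generalizing F with
  | nil =>
    intro ys d r a b
    simp only [List.nil_append, sop_cons]
    have e := C.hom_linear (hF.letter_head ys) d r a b
    beta_reduce at e
    rw [e]
    have e' := fun t => C.proj_linear (hF.letter_head t) d r a b
    simp only [e', sop_add, sop_smul, smul_add]
    rw [smul_comm]
    abel
  | cons c xs ih =>
    intro ys d r a b
    simp only [List.cons_append, sop_cons]
    have e := hF.cons (C.hom c) xs ys d r a b
    beta_reduce at e
    rw [e, ih (hF.cons (C.proj c)) ys d r a b, smul_add, smul_add, smul_comm]
    abel

/-- The tensor trick: the operator S of `sop` is a homotopy from the identity to π ⊗ ⋯ ⊗ π on words.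
Splitting off the first letter, the terms with m₁ π or π m₁ vanish, those with s on the first letter
and m₁ further right cancel in pairs, and the rest is the homotopy identity for one letter plus
induction. -/
theorem sop_der_add_der_sop {F : V.Word → M} (hF : WordLinear F) (x : V.Word) :
    sop C.proj C.hom (der m.linPart.el F) x + der m.linPart.el (sop C.proj C.hom F) x =
      F x - F (x.map C.proj) := by
  induction x generalizing F with
  | nil => rw [sop_nil, der_linPart_nil (C.sop_linear hF)]; simp
  | cons a x ih =>
    have hF' := hF.cons (C.proj a)
    simp only [sop_cons, der_linPart_cons hF, der_linPart_cons (C.sop_linear hF), der_add,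
      sop_add, der_smul, sop_smul]
    have e₁ := ih hF'
    have e₂ := letter_homotopy (C := C) (hF.letter_head x) a
    have e₃ : ∀ t, F (m.el [C.proj a] :: t) = 0 := fun t => m_proj (hF.letter_head t) a
    have e₄ : ∀ t, F (C.proj (m.el [a]) :: t) = 0 := fun t => proj_m (hF.letter_head t) a
    simp only [e₃, e₄, sop_zero, C.proj_fst, C.hom_fst, smul_zero, smul_add, smul_smul,
      sgn_mul_self, one_smul, add_zero, zero_add, List.map_cons]
    rw [show sgn 𝕜 (a.1 - 1) = -sgn 𝕜 a.1 by
      rw [neg_sgn]; exact sgn_congr (by push_cast; grind)]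
    have e₅ : F (m.el [C.hom a] :: x) = F (a :: x) - F (C.proj a :: x) -
      F (C.hom (m.el [a]) :: x) := by rw [← e₂]; abel
    have e₆ : sop C.proj C.hom (der m.linPart.el fun s => F (C.proj a :: s)) x =
        F (C.proj a :: x) - F (C.proj a :: x.map C.proj) -
        der m.linPart.el (sop C.proj C.hom fun s => F (C.proj a :: s)) x := by rw [← e₁]; abel
    rw [e₅, show sop C.proj C.hom (fun t => der m.linPart.el (fun s => F (C.proj a :: s)) t) x = _
      from e₆]
    rw [neg_smul]
    abel

theorem sop_sop {F : V.Word → M} (hF : WordLinear F) (x : V.Word) :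
    sop C.proj C.hom (sop C.proj C.hom F) x = 0 := by
  induction x generalizing F with
  | nil => rfl
  | cons a x ih =>
    simp only [sop_cons, hom_hom (hF.letter_head _), proj_hom (hF.letter_head _), sop_zero,
      hom_proj (hF.letter_head _), sop_smul, smul_zero, zero_add]
    rw [show sop C.proj C.hom (fun t => sop C.proj C.hom (fun t' =>
      F (C.proj (C.proj a) :: t')) t) x = 0 from ih (hF.cons _)]
    simp

theorem sop_map_proj {F : V.Word → M} (hF : WordLinear F) (x : V.Word) :
    sop C.proj C.hom F (x.map C.proj) = 0 := by
  induction x generalizing F with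
  | nil => rfl
  | cons a x ih =>
    simp only [List.map_cons, sop_cons, hom_proj (hF.letter_head _), zero_add]
    have e := ih (hF.cons (C.proj (C.proj a)))
    rw [e, smul_zero]

/-- One step of the recursion for the projection onto the minimal model. -/
noncomputable def retrStep (w : MultiMap V H 0) : MultiMap V H 0 where
  toFun x e := C.p.toFun x e -
    sop C.proj C.hom (der m.highPart.el fun t => w.toFun t e) x
  linear e := (C.p.linear e).sub (C.sop_linear ((w.linear e).der m.highPart))
  degree x e he := by
    rw [C.p.degree x e he, zero_sub, neg_eq_zero,
      sop_congr (K' := fun _ => 0) C.proj_fst C.hom_fst, sop_zero]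
    intro t _ ht
    exact (w.compDer m.highPart 1 (by norm_num)).degree t e (by omega)

theorem exists_retr : ∃ w : MultiMap V H 0, ∀ x e, w.toFun x e = (C.retrStep w).toFun x e := by
  refine MultiMap.exists_fixedPoint _ fun f g w hfg e => ?_
  simp only [retrStep]
  congr 1
  refine sop_congr C.proj_fst C.hom_fst fun t ht _ => ?_
  exact der_congr_highPart (f.linear e) (g.linear e) fun s hs => hfg s (by omega) e

/-- The projection onto the minimal model. -/
noncomputable def retr : MultiMap V H 0 := C.exists_retr.choose

theorem retr_toFun (x : V.Word) (e : ℤ) : C.retr.toFun x e = C.p.toFun x e -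
    sop C.proj C.hom (der m.highPart.el fun t => C.retr.toFun t e) x :=
  C.exists_retr.choose_spec x e

theorem retr_nil (e : ℤ) : C.retr.toFun [] e = 0 := by
  rw [retr_toFun, C.p_of_ne [] (by simp), sop_nil, sub_zero]

theorem retr_singleton (a : V.El) (e : ℤ) : C.retr.toFun [a] e = C.p.toFun [a] e := by
  rw [retr_toFun, sop_cons, sop_nil, smul_zero, add_zero,
    der_congr_highPart (K' := fun _ => 0) (C.retr.linear e) WordLinear.zero, der]
  · simp only [smul_zero]
    rw [cs3_eq_zero fun _ _ _ _ => rfl, sub_zero]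
  · intro s hs
    have : s = [] := List.length_eq_zero_iff.1 (by simpa using hs)
    rw [this]
    exact C.retr_nil e

theorem sop_letter {L : H.El → M} (hL : LetterLinear L) (x : V.Word) :
    L (C.retr.el x) = L (C.p.el x) -
      sop C.proj C.hom (der m.highPart.el fun t => L (C.retr.el t)) x := by
  rw [hL.el C.retr x _ rfl, retr_toFun, map_sub, ← hL.el C.p x _ rfl, map_sop]
  congr 1
  refine sop_congr C.proj_fst C.hom_fst fun t _ ht => ?_
  exact (hL.der_el C.retr m.highPart t _ (by rw [ht]; ring)).symm

theorem sop_p {L : H.El → M} (hL : LetterLinear L) (x : V.Word) :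
    sop C.proj C.hom (fun t => L (C.p.el t)) x = 0 := by
  have hp : ∀ t : V.Word, t.length ≠ 1 → L (C.p.el t) = 0 := fun t ht =>
    hL.el_eq_zero _ _ (C.p_of_ne t ht)
  by_cases hx : x.length = 1
  · obtain ⟨a, rfl⟩ := List.length_eq_one_iff.1 hx
    rw [sop_cons, sop_nil, smul_zero, add_zero]
    exact hL.el_eq_zero _ _ (C.p_s a)
  · rw [sop_congr (K' := fun _ => 0) C.proj_fst C.hom_fst, sop_zero]
    exact fun t ht _ => hp t (by omega)

/-- The recursion reads w = p - w ∘ m̂_high ∘ S. Composing with S once more gives zero, by p s = 0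
for the first term and S S = 0 for the second. -/
theorem sop_retr {L : H.El → M} (hL : LetterLinear L) (x : V.Word) :
    sop C.proj C.hom (fun t => L (C.retr.el t)) x = 0 := by
  have h : ∀ t, L (C.retr.el t) = L (C.p.el t) -
      sop C.proj C.hom (der m.highPart.el fun t => L (C.retr.el t)) t := C.sop_letter hL
  rw [sop_congr C.proj_fst C.hom_fst fun t _ _ => h t, sop_sub,
    show sop C.proj C.hom (fun t => L (C.p.el t)) x = 0 from C.sop_p hL x,
    show sop C.proj C.hom (fun t => sop C.proj C.hom (der m.highPart.el
      fun t => L (C.retr.el t)) t) x = 0 from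
      C.sop_sop ((hL.el_linear C.retr).der m.highPart) x, sub_zero]

theorem p_map_proj (x : V.Word) {L : H.El → M} (hL : LetterLinear L) :
    L (C.p.el (x.map C.proj)) = L (C.p.el x) := by
  by_cases hx : x.length = 1
  · obtain ⟨a, rfl⟩ := List.length_eq_one_iff.1 hx
    rw [List.map_singleton, p_proj]
  · rw [hL.el_eq_zero _ _ (C.p_of_ne x hx), hL.el_eq_zero _ _ (C.p_of_ne _ (by simpa using hx))]

theorem retr_map_proj {L : H.El → M} (hL : LetterLinear L) (x : V.Word) :
    L (C.retr.el (x.map C.proj)) = L (C.p.el x) := by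
  rw [C.sop_letter hL, C.sop_map_proj ((hL.el_linear C.retr).der m.highPart), sub_zero,
    C.p_map_proj x hL]

/-- Split off the first block: S acts on that block, where `sop_retr` applies, or on the remaining
letters, where induction applies. -/
theorem sop_hat_retr {F : H.Word → M} (hF : WordLinear F) (x : V.Word) :
    sop C.proj C.hom (hat C.retr.el F) x = 0 := by
  induction hn : x.length using Nat.strong_induction_on generalizing x F with
  | _ n ih =>
    subst hn
    by_cases hx : x = []
    · subst hx; rfl
    have hx' := List.length_pos_of_ne_nil hx
    rw [sop_congr C.proj_fst C.hom_fst fun t ht _ =>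
      hat_of_ne_nil C.retr_nil hF (List.ne_nil_of_length_pos (by omega))]
    rw [show sop C.proj C.hom (fun t => cs (fun p q => hat C.retr.el
      (fun s => F (C.retr.el p :: s)) q) t) x = sop C.proj C.hom (cs (fun p q => hat C.retr.el
      (fun s => F (C.retr.el p :: s)) q)) x from rfl, sop_cs]
    refine cs_eq_zero fun a b hab => ?_
    rw [show sop C.proj C.hom (fun t => hat C.retr.el (fun s => F (C.retr.el t :: s)) b) a = 0 from
      C.sop_retr (LetterLinear.hat (fun s => hF.letter_head s) _ _) a, zero_add]
    by_cases ha : a = []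
    · subst ha
      simp only [List.map_nil, (hF.letter_head _).el_eq_zero C.retr [] C.retr_nil, hat_zero,
        sop_zero, smul_zero]
    · have := List.length_pos_of_ne_nil ha
      have e := ih b.length (by subst hab; simp only [List.length_append]; omega)
        (hF.cons (C.retr.el (a.map C.proj))) b rfl
      rw [show sop C.proj C.hom (fun t => hat C.retr.el (fun s =>
        F (C.retr.el (a.map C.proj) :: s)) t) b = 0 from e, smul_zero]

theorem cs_p {F : H.Word → M} (hF : WordLinear F) {x : V.Word} (hx : x ≠ []) :
    cs (fun a b => F (C.p.el a :: b.map fun z => C.p.el [z])) x =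
      F (x.map fun z => C.p.el [z]) := by
  have h : ∀ a : V.Word, a.length ≠ 1 → ∀ y, F (C.p.el a :: y) = 0 := fun a ha y =>
    (hF.letter_head y).el_eq_zero _ _ (C.p_of_ne a ha)
  cases x with
  | nil => exact absurd rfl hx
  | cons c x =>
    rw [cs_cons, h [] (by simp), zero_add, cs_eq_left]
    · rfl
    · exact fun a b ha => h _ (by simpa using ha) _

/-- The recursion ŵ m̂_high S = p̂ - ŵ lifts from single outputs to whole words, where p̂ is p
applied to every letter. This is the analogue for w of the tensor trick and is needed because the
target operations see several blocks. -/
theorem sop_der_hat_retr {F : H.Word → M} (hF : WordLinear F) (x : V.Word) :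
    sop C.proj C.hom (der m.highPart.el (hat C.retr.el F)) x =
      F (x.map fun z => C.p.el [z]) - hat C.retr.el F x := by
  induction hn : x.length using Nat.strong_induction_on generalizing x F with
  | _ n ih =>
    subst hn
    by_cases hx : x = []
    · subst hx; simp [sop_nil]
    have hx' := List.length_pos_of_ne_nil hx
    let K : V.Word → V.Word → M := fun p q => hat C.retr.el (fun s => F (C.retr.el p :: s)) q
    have e₁ : ∀ t : V.Word, der m.highPart.el (hat C.retr.el F) t =
        cs (fun a b => der m.highPart.el (fun s => K s b) a) t +
        cs (fun a b => sgn 𝕜 (wdeg a) • der m.highPart.el (fun t => K a t) b) t := by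
      intro t
      rw [der_congr_ne_nil fun s hs => hat_of_ne_nil C.retr_nil hF hs, ← cs_add]
      exact der_cs _ _ _
    have hL : ∀ b, LetterLinear fun z => hat C.retr.el (fun s => F (z :: s)) b := fun b =>
      LetterLinear.hat (fun s => hF.letter_head s) _ _
    -- With the first block split off, S and the insertion m̂ can act on the first block or on the
    -- rest. If both act on the first block, this is the recursion for w.
    have e₂ : ∀ a b, sop C.proj C.hom (fun t => der m.highPart.el (fun s => K s b) t) a =
        hat C.retr.el (fun s => F (C.p.el a :: s)) b -
        hat C.retr.el (fun s => F (C.retr.el a :: s)) b := by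
      intro a b
      have := C.sop_letter (hL b) a
      rw [eq_sub_iff_add_eq] at this ⊢
      rw [add_comm]
      exact this
    -- Insertion in the first block and S on the rest, or conversely in `e₄`: zero because ŵ ∘ S =
    -- 0.
    have e₃ : ∀ a b, sop C.proj C.hom (fun t => der m.highPart.el (fun s => K s t) a) b = 0 := by
      intro a b
      rw [sop_der_comm, show (fun u => sop C.proj C.hom (fun t => K u t) b) = fun _ => (0 : M) from
        funext fun u => C.sop_hat_retr (hF.cons _) b]
      simp only [der, smul_zero]
      exact cs3_eq_zero fun _ _ _ _ => rfl
    have e₄ : ∀ a b, sop C.proj C.hom (fun t => sgn 𝕜 (wdeg t) •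
        der m.highPart.el (fun s => K t s) b) a = 0 := by
      intro a b
      rw [sop_congr (K' := fun t => sgn 𝕜 (wdeg a - 1) • der m.highPart.el (fun s => K t s) b)
        C.proj_fst C.hom_fst fun t _ ht => by rw [ht], sop_smul,
        show sop C.proj C.hom (fun t => der m.highPart.el (fun s => K t s) b) a = 0 from
          C.sop_retr (LetterLinear.der (fun s => hL s) _ _) a, smul_zero]
    have hw : ∀ a : V.Word, wdeg (a.map C.proj) = wdeg a := by
      intro a
      induction a with
      | nil => rfl
      | cons c a ih => simp [ih, C.proj_fst]
    -- If both act on the rest, the first block is projected letter by letter, where w reduces to p,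
    -- and induction handles the rest.
    have e₅ : ∀ a b, a ++ b = x → sgn 𝕜 (wdeg a) • sop C.proj C.hom (fun t =>
        sgn 𝕜 (wdeg (a.map C.proj)) • der m.highPart.el (fun s => K (a.map C.proj) s) t) b =
        F (C.p.el a :: b.map fun z => C.p.el [z]) -
        hat C.retr.el (fun s => F (C.p.el a :: s)) b := by
      intro a b hab
      rw [sop_smul, smul_smul, hw, sgn_mul_self, one_smul]
      by_cases ha : a = []
      · subst ha
        have h₁ := fun t => (hF.letter_head t).el_eq_zero C.retr [] C.retr_nil
        have h₂ := fun t => (hF.letter_head t).el_eq_zero C.p [] (C.p_of_ne [] (by simp))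
        simp only [K, List.map_nil, h₁, h₂, hat_zero, sub_zero]
        rw [show (der m.highPart.el fun _ : V.Word => (0 : M)) = fun _ => 0 from
          funext fun _ => der_zero _ _, sop_zero]
      · have := List.length_pos_of_ne_nil ha
        have e := ih b.length (by subst hab; simp only [List.length_append]; omega)
          (hF.cons (C.retr.el (a.map C.proj))) b rfl
        rw [← C.retr_map_proj (hF.letter_head _) a, ← C.retr_map_proj (hL b) a]
        exact e
    rw [sop_congr C.proj_fst C.hom_fst fun t _ _ => e₁ t, sop_add]
    rw [show sop C.proj C.hom (fun t => cs (fun a b => der m.highPart.el (fun s => K s b) a) t) x =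
      sop C.proj C.hom (cs fun a b => der m.highPart.el (fun s => K s b) a) x from rfl,
      show sop C.proj C.hom (fun t => cs (fun a b => sgn 𝕜 (wdeg a) •
        der m.highPart.el (fun t => K a t) b) t) x = sop C.proj C.hom (cs fun a b =>
        sgn 𝕜 (wdeg a) • der m.highPart.el (fun t => K a t) b) x from rfl,
      sop_cs, sop_cs, ← cs_add, hat_of_ne_nil C.retr_nil hF hx, ← C.cs_p hF hx, ← cs_sub]
    refine cs_congr fun a b hab => ?_
    rw [e₂, e₃, e₄, e₅ a b hab]
    simp only [smul_zero]
    abel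

end Contraction

/-! ### The projection is a homomorphism and a left inverse of the inclusion -/

namespace Contraction

variable {𝕜 : Type v} [Field 𝕜] {V : GradedSpace.{v, u} 𝕜} {m : MultiMap V V 1}
  {H : GradedSpace.{v, u} 𝕜} (C : Contraction m H) {M : Type u₂} [AddCommGroup M] [Module 𝕜 M]

theorem hom_incl {L : V.El → M} (hL : LetterLinear L) (x : H.Word) :
    L (C.hom (C.incl.el x)) = 0 := by
  have h := C.letter_incl (C.hom_linear hL) x
  beta_reduce at h
  rw [h, C.letter_i (C.hom_linear hL) fun a => hL.el_eq_zero _ _ (C.s_i a), zero_sub, neg_eq_zero]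
  exact hom_hom hL _

theorem p_incl {L : H.El → M} (hL : LetterLinear L) (x : H.Word) :
    L (C.p.el [C.incl.el x]) = L (C.p.el [C.i.el x]) := by
  have h := C.letter_incl (hL.comp_el C.p) x
  beta_reduce at h
  rw [h, hL.el_eq_zero C.p _ (C.p_s _), sub_zero]

theorem p_i_toFun (d : ℤ) (x : H.carrier d) : C.p.toFun [C.i.el [⟨d, x⟩]] d = x := by
  have h := C.p_i ⟨d, x⟩
  rw [C.p.el_eq _ d (by simp [MultiMap.el])] at h
  exact eq_of_heq (Sigma.mk.inj h).2

theorem p_i_of_ne {L : H.El → M} (hL : LetterLinear L) {x : H.Word} (hx : x.length ≠ 1) :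
    L (C.p.el [C.i.el x]) = 0 :=
  (hL.comp_el C.p).el_eq_zero _ _ (C.i_of_ne x hx)

/-- The side conditions s i = 0 and s s = 0 give s ∘ h = 0, so every term in which the homotopy
meets a block of the inclusion vanishes. -/
theorem hat_incl_sop {F : V.Word → M} (hF : WordLinear F) (x : H.Word) :
    hat C.incl.el (sop C.proj C.hom F) x = 0 := by
  induction hn : x.length using Nat.strong_induction_on generalizing x F with
  | _ n ih =>
    subst hn
    cases x with
    | nil => rw [hat_nil]; rfl
    | cons a x =>
      rw [hat_cons]
      refine cs_eq_zero fun p q hpq => ?_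
      simp only [sop_cons, C.hom_incl (hF.letter_head _), zero_add, hat_smul]
      have e := ih q.length (by subst hpq; simp)
        (hF.cons (C.proj (C.incl.el (a :: p)))) q rfl
      rw [show hat C.incl.el (fun s => sop C.proj C.hom (fun t =>
        F (C.proj (C.incl.el (a :: p)) :: t)) s) q = 0 from e, smul_zero]

theorem hat_incl_map_p {F : H.Word → M} (hF : WordLinear F) (x : H.Word) :
    hat C.incl.el (fun s => F (s.map fun z => C.p.el [z])) x = F x := by
  induction x generalizing F with
  | nil => simp
  | cons a x ih =>
    rw [hat_cons, cs_eq_left]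
    · simp only [List.map_cons, C.p_incl (hF.letter_head _), C.p_i]
      exact ih (hF.cons a)
    · intro p q hp
      simp only [List.map_cons, C.p_incl (hF.letter_head _)]
      have : (a :: p).length ≠ 1 := by simpa using hp
      simp only [C.p_i_of_ne (hF.letter_head _) this, hat_zero]

theorem map_el_i_linear {F : V.Word → M} (hF : WordLinear F) :
    WordLinear fun s : H.Word => F (s.map fun z => C.i.el [z]) := by
  intro xs ys d r a b
  simp only [List.map_append, List.map_cons]
  exact (hF.letter _ _).comp_el C.i d r a b

theorem hat_incl_map_proj {F : V.Word → M} (hF : WordLinear F) (x : H.Word) :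
    hat C.incl.el (fun s => F (s.map C.proj)) x = F (x.map fun z => C.i.el [z]) := by
  rw [← C.hat_incl_map_p (C.map_el_i_linear hF) x]
  simp only [List.map_map, Function.comp_def]
  rfl

/-- The correction term in w contains S first, and S ∘ ĥ = 0; only p ∘ h = p ∘ i remains. -/
theorem letter_retr_incl {L : H.El → M} (hL : LetterLinear L) {x : H.Word} (hx : x ≠ []) :
    hat C.incl.el (fun t => L (C.retr.el t)) x = L (C.p.el [C.i.el x]) := by
  rw [hat_congr (K' := fun t => L (C.p.el t) - sop C.proj C.hom (der m.highPart.el fun t =>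
    L (C.retr.el t)) t) fun t _ => C.sop_letter hL _, hat_sub,
    show hat C.incl.el (fun s => sop C.proj C.hom (der m.highPart.el fun t =>
    L (C.retr.el t)) s) x = 0 from
    C.hat_incl_sop ((hL.el_linear C.retr).der m.highPart) x, sub_zero,
    hat_of_single _ (fun s hs => hL.el_eq_zero _ _ (C.p_of_ne s hs)) hx, C.p_incl hL]

theorem hat_incl_hat_retr {F : H.Word → M} (hF : WordLinear F) (x : H.Word) :
    hat C.incl.el (hat C.retr.el F) x = F x := by
  rw [hat_hat _ _ hF]
  induction x generalizing F with
  | nil => simp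
  | cons a x ih =>
    have h : ∀ p s, F ((C.retr.compHat C.incl).el (a :: p) :: s) =
        F (C.p.el [C.i.el (a :: p)] :: s) := by
      intro p s
      have e := (hF.letter_head s).compHat_el C.retr C.incl (a :: p)
      beta_reduce at e
      rw [e]
      exact C.letter_retr_incl (hF.letter_head s) (by simp)
    rw [hat_cons]
    simp only [h]
    rw [cs_eq_left]
    · rw [C.p_i]
      exact ih (hF.cons a)
    · intro p q hp
      have : (a :: p).length ≠ 1 := by simpa using hp
      simp only [C.p_i_of_ne (hF.letter_head _) this, hat_zero]

theorem hat_incl_retr (x : H.Word) (e : ℤ) :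
    hat C.incl.el (fun t => C.retr.toFun t e) x = C.p.toFun [C.i.el x] e := by
  by_cases hx : x = []
  · subst hx
    rw [hat_nil, C.retr_nil, (C.p.letterLinear e).el_eq_zero C.i _ (C.i_of_ne [] (by simp))]
  · rw [hat_congr (K' := fun t => C.p.toFun t e - sop C.proj C.hom (der m.highPart.el fun t =>
      C.retr.toFun t e) t) fun t _ => C.retr_toFun _ e, hat_sub,
      show hat C.incl.el (fun s => sop C.proj C.hom (der m.highPart.el fun t =>
      C.retr.toFun t e) s) x = 0 from C.hat_incl_sop ((C.retr.linear e).der m.highPart) x, sub_zero,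
      hat_of_single _ (fun s hs => C.p_of_ne s hs e) hx]
    have h := C.letter_incl (C.p.letterLinear e) x
    rw [h, C.p_s, sub_zero]

theorem der_hat_incl_retr (x : H.Word) (e : ℤ) :
    der C.mMin.el (hat C.incl.el fun t => C.retr.toFun t e) x = C.mMin.toFun x e := by
  rw [show (hat C.incl.el fun t => C.retr.toFun t e) = fun x => C.p.toFun [C.i.el x] e from
    funext fun x => C.hat_incl_retr x e, der_of_single]
  · by_cases he : e = wdeg x + 1
    · subst he
      exact C.p_i_toFun _ _
    · rw [C.mMin.degree x e he, C.p.degree _ e]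
      simp only [wdeg_cons, wdeg_nil, MultiMap.el]
      omega
  · exact fun s hs => (C.p.letterLinear e).el_eq_zero _ _ (C.i_of_ne s hs)

/-- The defect Z = w m̂ - μ ŵ is shown to satisfy Z = -Z m̂_high S. Since m̂_high shortens words and
S preserves their length, Z vanishes by induction. An error term in this equation depends on
projected words only; evaluation on the image of ĥ, where S vanishes and the relation for the
inclusion is known, shows that it is zero. -/
theorem retr_relation (hm : IsAInf m) : Intertwines C.retr m C.mMin := by
  intro x e
  let w : V.Word → H.carrier e := fun t => C.retr.toFun t e
  have hw : WordLinear w := C.retr.linear e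
  let G : V.Word → H.carrier e := der m.highPart.el w
  have hG : WordLinear G := hw.der m.highPart
  let μH : H.Word → H.carrier e := fun t => C.mMin.toFun t e
  have hμ : WordLinear μH := C.mMin.linear e
  let Z : V.Word → H.carrier e := fun t => der m.el w t - hat C.retr.el μH t
  have hZ : WordLinear Z := (hw.der m).sub (hμ.hat C.retr)
  have lin : ∀ t, der m.linPart.el w t = -der m.linPart.el (sop C.proj C.hom G) t := by
    intro t
    have h₁ : w = fun t => C.p.toFun t e - sop C.proj C.hom G t :=
      funext fun t => C.retr_toFun t e
    have h₂ : der m.linPart.el (fun t => C.p.toFun t e) t = 0 := by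
      rw [der_of_single _ fun s hs => C.p_of_ne s hs e]
      by_cases ht : t.length = 1
      · obtain ⟨a, rfl⟩ := List.length_eq_one_iff.1 ht
        rw [show m.linPart.el [a] = m.el [a] from
          MultiMap.el_congr fun e => m.restr_pos rfl e, C.p_m]
      · exact (C.p.letterLinear e).el_eq_zero _ _ (m.linPart_of_ne ht)
    conv_lhs => rw [h₁, der_sub, h₂, zero_sub]
  have split : ∀ {F : V.Word → H.carrier e}, WordLinear F → ∀ t, der m.el F t =
      der m.linPart.el F t + der m.highPart.el F t := fun hF t =>
    der_eq_linPart_add_highPart hm.nil hF t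
  have e₁ : ∀ t, der m.linPart.el G t = -der m.highPart.el (der m.el w) t := by
    intro t
    have h₁ := der_der_of hm.relation hw t
    rw [split (hw.der m)] at h₁
    have h₂ : der m.linPart.el (der m.el w) t = der m.linPart.el G t := by
      rw [show der m.el w = fun t => der m.linPart.el w t + G t from funext (split hw), der_add,
        show der m.linPart.el (fun t => der m.linPart.el w t) t = 0 from
          hm.der_linPart_linPart hw t, zero_add]
    rw [h₂] at h₁
    exact eq_neg_of_add_eq_zero_left h₁
  -- From w d̂ = -G S d̂ and G d̂ = -(w m̂) m̂_high, with d̂ the insertion of m₁, the homotopy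
  -- identity on words applied to G gives this equation.
  have e₂ : ∀ t, der m.el w t = G (t.map C.proj) -
      sop C.proj C.hom (der m.highPart.el (der m.el w)) t := by
    intro t
    have h := C.sop_der_add_der_sop hG t
    rw [show der m.linPart.el G = fun t => -der m.highPart.el (der m.el w) t from funext e₁,
      sop_neg] at h
    rw [split hw, lin]
    have h' : der m.linPart.el (sop C.proj C.hom G) t = G t - G (t.map C.proj) +
        sop C.proj C.hom (der m.highPart.el (der m.el w)) t := by
      rw [← h]; abel
    rw [h']
    change -(G t - G (t.map C.proj) + sop C.proj C.hom (der m.highPart.el (der m.el w)) t) + G t = _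
    abel
  have e₃ : ∀ t, Z t + sop C.proj C.hom (der m.highPart.el Z) t =
      G (t.map C.proj) - μH (t.map fun z => C.p.el [z]) := by
    intro t
    have h := C.sop_der_hat_retr hμ t
    have h' : (der m.highPart.el Z) = fun t => der m.highPart.el (der m.el w) t -
        der m.highPart.el (hat C.retr.el μH) t := funext fun t => der_sub _ _ _ _
    rw [h', sop_sub]
    change der m.el w t - hat C.retr.el μH t + _ = _
    rw [show sop C.proj C.hom (fun t => der m.highPart.el (hat C.retr.el μH) t) t = _ from h,
      show sop C.proj C.hom (fun t => der m.highPart.el (der m.el w) t) t =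
        G (t.map C.proj) - der m.el w t by rw [e₂ t]; abel]
    abel
  -- Compose `e₃` with ĥ: the S-term dies, and Z ĥ = 0 because w ĥ = p i and m̂ ĥ = ĥ m̂_H.
  have e₄ : ∀ t : H.Word, G (t.map fun z => C.i.el [z]) = μH t := by
    intro t
    have h₁ : hat C.incl.el (fun t => Z t + sop C.proj C.hom (der m.highPart.el Z) t) t = 0 := by
      rw [hat_add, show hat C.incl.el (fun s => sop C.proj C.hom (der m.highPart.el Z) s) t = 0 from
        C.hat_incl_sop (hZ.der m.highPart) t, add_zero]
      change hat C.incl.el (fun t => der m.el w t - hat C.retr.el μH t) t = 0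
      rw [hat_sub, show hat C.incl.el (fun t => hat C.retr.el μH t) t = _ from
        C.hat_incl_hat_retr hμ t, show hat C.incl.el (fun t => der m.el w t) t = _ from
        (C.incl_relation hm).hat_der hw t]
      exact sub_eq_zero.2 (C.der_hat_incl_retr t e)
    simp only [e₃, hat_sub] at h₁
    rw [C.hat_incl_map_proj hG, C.hat_incl_map_p hμ] at h₁
    exact sub_eq_zero.1 h₁
  have e₅ : ∀ t, Z t = -sop C.proj C.hom (der m.highPart.el Z) t := by
    intro t
    have h := e₃ t
    rw [← e₄] at h
    simp only [List.map_map, Function.comp_def] at h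
    rw [show (fun z => C.i.el [C.p.el [z]]) = C.proj from rfl, sub_self] at h
    exact eq_neg_of_add_eq_zero_left h
  have e₆ : ∀ t, Z t = 0 := by
    intro t
    induction hn : t.length using Nat.strong_induction_on generalizing t with
    | _ n ih =>
      rw [e₅, sop_congr (K' := fun _ => 0) C.proj_fst C.hom_fst, sop_zero, neg_zero]
      intro s hs _
      rw [der_congr_highPart (K' := fun _ => 0) hZ WordLinear.zero, der_zero]
      exact fun r hr => ih r.length (by omega) r rfl
  exact (sub_eq_zero.1 (e₆ x)).symm

end Contraction

/-! ### Existence of contractions -/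

section Exists

variable {𝕜 : Type v} [Field 𝕜]

theorem exists_generalizedInverse {E F : Type*} [AddCommGroup E] [Module 𝕜 E]
    [AddCommGroup F] [Module 𝕜 F] (f : E →ₗ[𝕜] F) :
    ∃ g : F →ₗ[𝕜] E, (∀ x, f (g (f x)) = f x) ∧ ∀ y, g (f (g y)) = g y := by
  obtain ⟨σ, hσ⟩ := f.rangeRestrict.exists_rightInverse_of_surjective
    (LinearMap.range_eq_top.2 f.surjective_rangeRestrict)
  obtain ⟨r, hr⟩ := (LinearMap.range f).subtype.exists_leftInverse_of_injective
    (Submodule.ker_subtype _)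
  have key : ∀ x, f (σ (r (f x))) = f x := fun x => by
    have h₁ : r (f x) = f.rangeRestrict x := LinearMap.congr_fun hr (f.rangeRestrict x)
    rw [h₁]
    exact congrArg Subtype.val (LinearMap.congr_fun hσ (f.rangeRestrict x))
  -- The map g₀ = σ r satisfies f g₀ f = f; passing to g₀ f g₀ enforces the second identity as well.
  exact ⟨σ ∘ₗ r ∘ₗ f ∘ₗ σ ∘ₗ r, fun x => by simp [key], fun y => by simp [key]⟩

namespace MultiMap

variable {V : GradedSpace.{v, u} 𝕜} {W : GradedSpace.{v, u₁} 𝕜}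

/-- A family of linear maps that preserve the degree, as a family of multilinear maps. -/
def ofDiag (L : ∀ d, V.carrier d →ₗ[𝕜] W.carrier d) : MultiMap V W 0 :=
  ofLinear (fun d e => if h : d = e then h ▸ L d else 0) 0 fun d e he =>
    dif_neg fun h => he (by rw [h, add_zero])

theorem ofDiag_toFun (L : ∀ d, V.carrier d →ₗ[𝕜] W.carrier d) (d : ℤ) (x : V.carrier d) :
    (ofDiag L).toFun [⟨d, x⟩] d = L d x := by
  simp [ofDiag, ofLinear]

theorem ofDiag_el (L : ∀ d, V.carrier d →ₗ[𝕜] W.carrier d) (d : ℤ) (x : V.carrier d) :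
    (ofDiag L).el [⟨d, x⟩] = ⟨d, L d x⟩ := by
  rw [(ofDiag L).el_eq _ d (by simp), ofDiag_toFun]

theorem toFun_eq_zero_iff {p : ℤ} (f : MultiMap V W p) (x : V.Word) {d : ℤ} (hd : wdeg x + p = d) :
    (∀ e, f.toFun x e = 0) ↔ f.toFun x d = 0 := by
  refine ⟨fun h => h d, fun h e => ?_⟩
  by_cases he : e = wdeg x + p
  · rw [he, hd, h]
  · exact f.degree x e he

end MultiMap

theorem IsAInf.exists_contraction {V : GradedSpace.{v, u} 𝕜} {m : MultiMap V V 1}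
    (hm : IsAInf m) : ∃ H : GradedSpace.{v, u} 𝕜, Nonempty (Contraction m H) := by
  let D : ∀ d e, V.carrier d →ₗ[𝕜] V.carrier e := m.linearPart
  have D_zero : ∀ d e, e ≠ d + 1 → D d e = 0 := fun d e he =>
    LinearMap.ext fun x => m.degree _ e (by simpa using he)
  have m_el : ∀ d (x : V.carrier d), m.el [⟨d, x⟩] = ⟨d + 1, D d (d + 1) x⟩ := fun d x =>
    m.el_eq _ _ (by simp)
  have D_D : ∀ d e f x, D e f (D d e x) = 0 := by
    intro d e f x
    by_cases he : e = d + 1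
    · subst he
      have := hm.m_m ⟨d, x⟩ f
      rwa [m_el] at this
    · rw [D_zero d e he, LinearMap.zero_apply, map_zero]
  choose s₀ D_s₀_D s₀_D_s₀ using fun d e => exists_generalizedInverse (D d e)
  have s₀_zero : ∀ d e, e ≠ d + 1 → s₀ d e = 0 := by
    intro d e he
    ext y
    rw [← s₀_D_s₀, D_zero d e he, LinearMap.zero_apply, map_zero, LinearMap.zero_apply]
  -- The factor 1 - s₀ D enforces S S = 0: by s₀ D s₀ = s₀ it kills the image of s₀. The identities
  -- S D S = S and D S D = D persist, so 1 - D S - S D is a projection.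
  let S : ∀ e d, V.carrier e →ₗ[𝕜] V.carrier d := fun e d =>
    s₀ d e ∘ₗ (LinearMap.id - s₀ e (e + 1) ∘ₗ D e (e + 1))
  have S_apply : ∀ e d x, S e d x = s₀ d e x - s₀ d e (s₀ e (e + 1) (D e (e + 1) x)) := by
    intro e d x; simp [S]
  have S_zero : ∀ e d, d ≠ e + -1 → S e d = 0 := by
    intro e d h
    ext x
    rw [S_apply, s₀_zero d e (by omega)]
    simp
  have S_S : ∀ e d f x, S d f (S e d x) = 0 := by
    intro e d f x
    by_cases h : e = d + 1
    · subst h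
      rw [S_apply d f, S_apply (d + 1) d]
      simp only [map_sub, s₀_D_s₀, sub_self]
    · rw [S_zero e d (by omega), LinearMap.zero_apply, map_zero]
  have S_D_S : ∀ d x, S (d + 1) d (D d (d + 1) (S (d + 1) d x)) = S (d + 1) d x := by
    intro d x
    rw [S_apply _ _ (D _ _ _), D_D, map_zero, map_zero, sub_zero, S_apply]
    simp only [map_sub, s₀_D_s₀]
  have D_S_D : ∀ d x, D d (d + 1) (S (d + 1) d (D d (d + 1) x)) = D d (d + 1) x := by
    intro d x
    rw [S_apply, D_D, map_zero, map_zero, sub_zero, D_s₀_D]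
  let π : ∀ d, V.carrier d →ₗ[𝕜] V.carrier d := fun d =>
    LinearMap.id - D (d - 1) d ∘ₗ S d (d - 1) - S (d + 1) d ∘ₗ D d (d + 1)
  have π_apply : ∀ d x, π d x = x - D (d - 1) d (S d (d - 1) x) - S (d + 1) d (D d (d + 1) x) := by
    intro d x; simp [π]
  have D_π : ∀ d e x, D d e (π d x) = 0 := by
    intro d e x
    by_cases he : e = d + 1
    · subst he
      rw [π_apply, map_sub, map_sub, D_D, D_S_D, sub_zero, sub_self]
    · rw [D_zero d e he, LinearMap.zero_apply]
  have π_D : ∀ d x, π (d + 1) (D d (d + 1) x) = 0 := by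
    intro d x
    rw [π_apply, D_D, map_zero, sub_zero, sub_eq_zero]
    -- The degree `d + 1 - 1` is equal to `d` but not definitionally so; it is generalised in order
    -- to substitute it.
    obtain ⟨d', hd⟩ : ∃ d', d' = d + 1 - 1 := ⟨_, rfl⟩
    rw [← hd]
    obtain rfl : d' = d := by omega
    exact (D_S_D _ x).symm
  have S_π : ∀ d e x, S d e (π d x) = 0 := by
    intro d e x
    by_cases h : d = e + 1
    · subst h
      obtain ⟨e', he⟩ : ∃ e', e' = e + 1 - 1 := ⟨_, rfl⟩
      rw [π_apply, ← he]
      obtain rfl : e' = e := by omega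
      rw [map_sub, map_sub, S_D_S, S_S, sub_zero, sub_self]
    · rw [S_zero d e (by omega), LinearMap.zero_apply]
  have π_S : ∀ d x, π d (S (d + 1) d x) = 0 := by
    intro d x
    rw [π_apply, S_S, map_zero, sub_zero, S_D_S, sub_self]
  have π_π : ∀ d x, π d (π d x) = π d x := by
    intro d x
    conv_lhs => rw [π_apply d (π d x), S_π, D_π, map_zero, map_zero, sub_zero, sub_zero]
  let H : GradedSpace.{v, u} 𝕜 := { carrier := fun d => LinearMap.range (π d) }
  let i : ∀ d, H.carrier d →ₗ[𝕜] V.carrier d := fun d => (LinearMap.range (π d)).subtype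
  let p : ∀ d, V.carrier d →ₗ[𝕜] H.carrier d := fun d => (π d).rangeRestrict
  have i_p : ∀ d x, i d (p d x) = π d x := fun d x => rfl
  have i_inj : ∀ d (x y : H.carrier d), i d x = i d y → x = y := fun d x y h => Subtype.ext h
  have i_eq : ∀ d (x : H.carrier d), ∃ y, i d x = π d y := fun d x => by
    obtain ⟨y, hy⟩ := x.2
    exact ⟨y, hy.symm⟩
  let s : MultiMap V V (-1) := MultiMap.ofLinear S (-1) S_zero
  have s_el : ∀ d (x : V.carrier d), s.el [⟨d, x⟩] = ⟨d - 1, S d (d - 1) x⟩ := fun d x =>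
    s.el_eq _ _ (by simp; ring)
  have s_toFun : ∀ d e (x : V.carrier d), s.toFun [⟨d, x⟩] e = S d e x := fun d e x => rfl
  refine ⟨H, ⟨⟨MultiMap.ofDiag i, MultiMap.ofDiag p, s,
    fun x hx e => MultiMap.ofLinear_of_length_ne _ _ _ hx e,
    fun x hx e => MultiMap.ofLinear_of_length_ne _ _ _ hx e, ?_, ?_, ?_, ?_, ?_, ?_, ?_⟩⟩⟩
  · rintro ⟨d, x⟩ e
    obtain ⟨y, hy⟩ := i_eq d x
    rw [MultiMap.ofDiag_el, hy]
    exact D_π d e y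
  · rintro ⟨d, x⟩
    rw [m_el, MultiMap.toFun_eq_zero_iff _ _ (d := d + 1) (by simp), MultiMap.ofDiag_toFun]
    exact i_inj _ _ _ (by rw [i_p, π_D, map_zero])
  · rintro ⟨d, x⟩
    rw [MultiMap.ofDiag_el, MultiMap.ofDiag_el]
    congr 1
    obtain ⟨y, hy⟩ := i_eq d x
    exact i_inj _ _ _ (by rw [i_p, hy, π_π])
  · rintro ⟨d, x⟩ e
    rw [s_el, s_toFun, S_S]
  · rintro ⟨d, x⟩ e
    obtain ⟨y, hy⟩ := i_eq d x
    rw [MultiMap.ofDiag_el, s_toFun, hy, S_π]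
  · rintro ⟨d, x⟩
    rw [s_el, MultiMap.toFun_eq_zero_iff _ _ (d := d - 1) (by simp), MultiMap.ofDiag_toFun]
    refine i_inj _ _ _ ?_
    rw [i_p, map_zero]
    obtain ⟨e, rfl⟩ : ∃ e, d = e + 1 := ⟨d - 1, by ring⟩
    obtain ⟨e', he⟩ : ∃ e', e' = e + 1 - 1 := ⟨_, rfl⟩
    rw [← he]
    obtain rfl : e' = e := by omega
    exact π_S _ x
  · intro d x
    rw [s_el, m_el, s_toFun, MultiMap.ofDiag_el, MultiMap.ofDiag_toFun, i_p, π_apply]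
    change D (d - 1) d _ + _ = _
    abel

end Exists

/-! ### The minimal model -/

theorem AInfAlgebra.IsMinimal.mem_boundaries {𝕜 : Type v} [Field 𝕜] {A : AInfAlgebra.{v, u} 𝕜}
    (hA : A.IsMinimal) {d : ℤ} {x : A.space.carrier d} : x ∈ A.boundaries d ↔ x = 0 := by
  rw [AInfAlgebra.boundaries, hA, LinearMap.range_zero, Submodule.mem_bot]

theorem AInfAlgebra.IsMinimal.mem_cycles {𝕜 : Type v} [Field 𝕜] {A : AInfAlgebra.{v, u} 𝕜}
    (hA : A.IsMinimal) {d : ℤ} (x : A.space.carrier d) : x ∈ A.cycles d := by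
  rw [AInfAlgebra.cycles, hA, LinearMap.ker_zero]
  trivial

/-- Every `A∞`-algebra has a minimal model, onto which it retracts. -/
theorem AInfAlgebra.exists_minimalModel {𝕜 : Type v} [Field 𝕜] (A : AInfAlgebra.{v, u} 𝕜) :
    ∃ (H : AInfAlgebra.{v, u} 𝕜) (h : AInfHom H A) (w : AInfHom A H),
      H.IsMinimal ∧ h.IsQuasiIso ∧ w.IsQuasiIso ∧ w.IsLeftInverse h := by
  obtain ⟨H, ⟨C⟩⟩ := A.isAInf.exists_contraction
  let HA : AInfAlgebra.{v, u} 𝕜 := (C.isAInf_mMin A.isAInf).toAlgebra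
  let h : AInfHom HA A :=
    Intertwines.toHom (A := HA) (B := A) (C.incl_relation A.isAInf) C.incl_nil
  let w : AInfHom A HA :=
    Intertwines.toHom (A := A) (B := HA) (C.retr_relation A.isAInf) C.retr_nil
  have min : HA.IsMinimal := fun d e => LinearMap.ext fun x => C.mMin_singleton ⟨d, x⟩ e
  have h_lin : ∀ d e (x : H.carrier d), h.f.linearPart d e x = C.i.toFun [⟨d, x⟩] e :=
    fun d e x => C.incl_singleton ⟨d, x⟩ e
  have w_lin : ∀ d e (x : A.space.carrier d), w.f.linearPart d e x = C.p.toFun [⟨d, x⟩] e :=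
    fun d e x => C.retr_singleton ⟨d, x⟩ e
  have i_el : ∀ d (x : H.carrier d), C.i.el [⟨d, x⟩] = ⟨d, C.i.toFun [⟨d, x⟩] d⟩ := fun d x =>
    C.i.el_eq _ d (by simp)
  have m_el : ∀ d (x : A.space.carrier d), A.m.el [⟨d, x⟩] = ⟨d + 1, A.m.toFun [⟨d, x⟩] (d + 1)⟩ :=
    fun d x => A.m.el_eq _ (d + 1) (by simp)
  have p_i : ∀ d (x : H.carrier d), C.p.toFun [⟨d, C.i.toFun [⟨d, x⟩] d⟩] d = x := by
    intro d x
    have := C.p_i_toFun d x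
    rwa [i_el] at this
  -- On a cycle the homotopy identity reduces to x - i p x = m₁ s x.
  have hom : ∀ d (x : A.space.carrier d), x ∈ A.cycles d →
      x - C.i.toFun [C.p.el [⟨d, x⟩]] d ∈ A.boundaries d := by
    intro d x hx
    rw [← C.homotopy, m_el]
    have hx' : A.m.toFun [⟨d, x⟩] (d + 1) = 0 := hx
    rw [hx', (C.s.letterLinear d).map_zero, add_zero, C.s.el_eq _ (d - 1) (by simp; ring)]
    exact ⟨_, rfl⟩
  have p_el : ∀ d (x : A.space.carrier d), C.p.el [⟨d, x⟩] = ⟨d, C.p.toFun [⟨d, x⟩] d⟩ :=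
    fun d x => C.p.el_eq _ d (by simp)
  refine ⟨HA, h, w, min, ⟨?_, ?_⟩, ⟨?_, ?_⟩, ?_, ?_⟩
  · intro d (x : H.carrier d) _ hx
    refine min.mem_boundaries.2 ?_
    obtain ⟨z, hz⟩ := hx
    replace hz := hz.trans (h_lin d d x)
    refine (p_i d x).symm.trans ?_
    rw [← hz]
    have := C.p_m ⟨d - 1, z⟩ d
    rwa [A.m.el_eq _ d (by simp)] at this
  · intro d y hy
    refine ⟨C.p.toFun [⟨d, y⟩] d, ?_, ?_⟩
    · exact min.mem_cycles _
    · rw [h_lin]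
      have := hom d y hy
      rwa [p_el] at this
  · intro d x hx hx'
    have hx' : C.p.toFun [⟨d, x⟩] d = (0 : H.carrier d) :=
      (w_lin d d x).symm.trans (min.mem_boundaries.1 hx')
    have := hom d x hx
    rwa [p_el, hx', (C.i.letterLinear d).map_zero, sub_zero] at this
  · intro d (y : H.carrier d) _
    refine ⟨C.i.toFun [⟨d, y⟩] d, ?_, ?_⟩
    · have := C.m_i ⟨d, y⟩ (d + 1)
      rwa [i_el] at this
    · refine min.mem_boundaries.2 (sub_eq_zero.2 ?_)
      rw [w_lin, p_i]
  · intro d x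
    exact (C.hat_incl_retr [⟨d, x⟩] d).trans (C.p_i_toFun d x)
  · intro xs hxs e
    exact (C.hat_incl_retr xs e).trans
      ((C.p.letterLinear e).el_eq_zero _ _ (C.i_of_ne xs (show xs.length ≠ 1 by omega)))

open GradedSpace

/-! ### Two-forms and their pullback -/

theorem cs3_cs3_regroup {α β : Type*} {M : Type*} [AddCommGroup M]
    (K : List α → List α → List α → List β → List β → List β → M) (x : List α) (y : List β) :
    cs3 (fun x₁ x₂ x₃ => cs3 (fun y₁ y₂ y₃ => K x₁ x₂ x₃ y₁ y₂ y₃) y) x =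
      cs (fun x₁ x' => cs (fun y' y₃ => cs (fun x₂ x₃ => cs (fun y₁ y₂ =>
        K x₁ x₂ x₃ y₁ y₂ y₃) y') x') y) x := by
  refine cs_congr fun x₁ x' _ => ?_
  rw [cs_comm]
  exact cs_congr fun x₂ x₃ _ => (cs_assoc _ _).symm

section Forms

variable {𝕜 : Type v} [Field 𝕜] {V : GradedSpace.{v, u} 𝕜} {W : GradedSpace.{v, u₁} 𝕜} {c : ℤ}

/-- The scalar function of a family of maps to the dual space. -/
def bform (φ : BiMap V V (V.dual c) 0) (x : V.Word) (v : V.El) (y : V.Word) (w : V.El) : 𝕜 :=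
  dualEval (φ.el x v y).2 w

/-- The evaluation of functionals at an element. -/
def evalAt (w : V.El) (e : ℤ) : (V.dual c).carrier e →ₗ[𝕜] 𝕜 where
  toFun φ := dualEval φ w
  map_add' _ _ := rfl
  map_smul' _ _ := rfl

theorem evalAt_apply (w : V.El) (e : ℤ) (φ : (V.dual c).carrier e) :
    evalAt w e φ = dualEval φ w := rfl

theorem evalAt_toFun (φ : BiMap V V (V.dual c) 0) (x : V.Word) (v : V.El) (y : V.Word)
    (w : V.El) (e : ℤ) (he : e = wdeg x + v.1 + wdeg y) :
    evalAt w e (φ.toFun x v y e) = bform φ x v y w := by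
  obtain rfl : e = wdeg x + v.1 + wdeg y + 0 := by rw [he, add_zero]
  rfl

theorem bform_ext {φ φ' : BiMap V V (V.dual c) 0}
    (h : ∀ x v y w, bform φ x v y w = bform φ' x v y w) : φ = φ' := by
  refine BiMap.ext (funext fun x => funext fun v => funext fun y => funext fun e => ?_)
  by_cases he : e = wdeg x + v.1 + wdeg y + 0
  · subst he
    exact dual_ext fun w => h x v y w
  · rw [φ.degree x v y e he, φ'.degree x v y e he]

theorem bform_eq_zero (φ : BiMap V V (V.dual c) 0) (x : V.Word) (v : V.El) (y : V.Word) (w : V.El)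
    (h : wdeg x + v.1 + wdeg y + w.1 + c ≠ 0) : bform φ x v y w = 0 :=
  dualEval_eq_zero _ _ (by simp only [BiMap.el]; omega)

theorem bform_left_linear (φ : BiMap V V (V.dual c) 0) (v : V.El) (y : V.Word) (w : V.El) :
    WordLinear fun x => bform φ x v y w := by
  intro xs ys d r a b
  have h := φ.left_linear v y (wdeg xs + d + wdeg ys + v.1 + wdeg y) xs ys d r a b
  beta_reduce at h ⊢
  iterate 3 rw [← evalAt_toFun φ _ v y w (wdeg xs + d + wdeg ys + v.1 + wdeg y)
    (by simp only [wdeg_append, wdeg_cons]; ring)]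
  rw [h, map_add, map_smul]

theorem bform_right_linear (φ : BiMap V V (V.dual c) 0) (x : V.Word) (v : V.El) (w : V.El) :
    WordLinear fun y => bform φ x v y w := by
  intro xs ys d r a b
  have h := φ.right_linear x v (wdeg x + v.1 + (wdeg xs + d + wdeg ys)) xs ys d r a b
  beta_reduce at h ⊢
  iterate 3 rw [← evalAt_toFun φ x v _ w (wdeg x + v.1 + (wdeg xs + d + wdeg ys))
    (by simp only [wdeg_append, wdeg_cons]; ring)]
  rw [h, map_add, map_smul]

theorem bform_mid_linear (φ : BiMap V V (V.dual c) 0) (x y : V.Word) (w : V.El) :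
    LetterLinear fun v => bform φ x v y w := by
  intro d r a b
  have h := φ.mid_linear x y d r a b (wdeg x + d + wdeg y)
  beta_reduce
  iterate 3 rw [← evalAt_toFun φ x _ y w (wdeg x + d + wdeg y) (by ring)]
  rw [h, map_add, map_smul]

theorem bform_arg_linear (φ : BiMap V V (V.dual c) 0) (x y : V.Word) (v : V.El) :
    LetterLinear fun w => bform φ x v y w := by
  intro d r a b
  exact dualEval_add_smul _ d r a b

/-- The pullback of a family of maps to the dual space along a family of degree zero. -/
def pb (f : MultiMap V W 0) (χ : BiMap W W (W.dual c) 0) : BiMap V V (V.dual c) 0 :=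
  BiMap.comp (f.diag.transpose c) (BiMap.comp (BiMap.pull f χ) f.diag)

/-- Substitution in two words. -/
def hat2 {M : Type u₂} [AddCommGroup M] (f : MultiMap V W 0) (K : W.Word → W.Word → M)
    (x y : V.Word) : M :=
  hat f.el (fun s => hat f.el (fun t => K s t) y) x

section Hat2

variable {M : Type u₂} [AddCommGroup M] (f : MultiMap V W 0)

theorem hat2_congr_wdeg {K K' : W.Word → W.Word → M} {x y : V.Word}
    (h : ∀ s t, wdeg s = wdeg x → wdeg t = wdeg y → K s t = K' s t) :
    hat2 f K x y = hat2 f K' x y :=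
  hat_congr_wdeg fun s hs => hat_congr_wdeg fun t ht => h s t hs ht

theorem hat2_comm (K : W.Word → W.Word → M) (x y : V.Word) :
    hat2 f K x y = hat2 f (fun t s => K s t) y x := hat_comm _ _ _ _ _

theorem hat2_smul [Module 𝕜 M] (r : 𝕜) (K : W.Word → W.Word → M) (x y : V.Word) :
    hat2 f (fun s t => r • K s t) x y = r • hat2 f K x y := by
  simp only [hat2, hat_smul]

theorem hat2_add (K K' : W.Word → W.Word → M) (x y : V.Word) :
    hat2 f (fun s t => K s t + K' s t) x y = hat2 f K x y + hat2 f K' x y := by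
  simp only [hat2, hat_add]

end Hat2

/-- The effect of a family of degree zero on words with a marked letter. -/
def mid {M : Type u₂} [AddCommGroup M] (f : V.Word → W.El) (G : W.Word → W.El → W.Word → M)
    (x : V.Word) (v : V.El) (y : V.Word) : M :=
  cs (fun x₁ x₂ => cs (fun y₁ y₂ =>
    hat f (fun s => hat f (fun t => G s (f (x₂ ++ v :: y₁)) t) y₂) x₁) y) x

/-- The formula for the scalar function of a pullback. -/
def pbf (f : MultiMap V W 0) (Φ : W.Word → W.El → W.Word → W.El → 𝕜) (x : V.Word) (v : V.El)
    (y : V.Word) (w : V.El) : 𝕜 :=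
  cs3 (fun x₁ x₂ x₃ => cs3 (fun y₁ y₂ y₃ =>
    sgn 𝕜 (wdeg x₁ * (wdeg x₂ + wdeg x₃ + v.1 + wdeg y₁ + wdeg y₂ + wdeg y₃ + w.1)) •
      hat2 f (fun s t => Φ s (f.el (x₃ ++ v :: y₁)) t (f.el (y₃ ++ w :: x₁))) x₂ y₂) y) x

theorem pbf_eq_mid (f : MultiMap V W 0) (Φ : W.Word → W.El → W.Word → W.El → 𝕜) (x : V.Word)
    (v : V.El) (y : V.Word) (w : V.El) : pbf f Φ x v y w = cs (fun x₁ x' => cs (fun y' y₃ =>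
      sgn 𝕜 (wdeg x₁ * (wdeg x' + v.1 + wdeg y' + wdeg y₃ + w.1)) •
        mid f.el (fun s u t => Φ s u t (f.el (y₃ ++ w :: x₁))) x' v y') y) x := by
  rw [pbf, cs3_cs3_regroup]
  refine cs_congr fun x₁ x' _ => cs_congr fun y' y₃ _ => ?_
  rw [mid, ← cs_smul]
  refine cs_congr fun x₂ x₃ hx => ?_
  rw [← cs_smul]
  refine cs_congr fun y₁ y₂ hy => ?_
  subst hx hy
  simp only [wdeg_append, ← add_assoc]
  rfl

theorem diag_el {p : ℤ} (f : MultiMap V W p) (x : V.Word) (v : V.El) (y : V.Word) :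
    f.diag.el x v y = f.el (x ++ v :: y) := by
  rw [f.el_eq _ (wdeg x + v.1 + wdeg y + p) (by simp only [wdeg_append, wdeg_cons]; ring)]
  rfl

theorem evalAt_transpose {N : GradedSpace.{v, u₂} 𝕜} {p : ℤ} (g : BiMap V W N p) (x : V.Word)
    (φ : (N.dual c).El) (y : V.Word) (w : W.El) (e : ℤ) (he : e = wdeg x + φ.1 + wdeg y + p) :
    evalAt w e ((g.transpose c).toFun x φ y e) = g.transposeVal x φ y w := by
  simp only [BiMap.transpose, dif_pos he]
  rfl

theorem evalAt_comp {M : GradedSpace.{v, u₂} 𝕜} {N : GradedSpace.{v, u₃} 𝕜} (h : BiMap V N (W.dual c) 0)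
    (g : BiMap V M N 0)
    (x : V.Word) (v : M.El) (y : V.Word) (w : W.El) (e : ℤ) :
    evalAt w e ((h.comp g).toFun x v y e) = cs (fun x₁ x₂ => cs (fun y₁ y₂ =>
      evalAt w e (h.toFun x₁ (g.el x₂ v y₁) y₂ e)) y) x := by
  rw [show (h.comp g).toFun x v y e = cs (fun x₁ x₂ => cs (fun y₁ y₂ =>
    h.toFun x₁ (g.el x₂ v y₁) y₂ e) y) x from rfl]
  simp only [map_cs]

/-- The three composed bimodule maps supply the pieces of `pbf`: f̃ forms the block `x₃ v y₁` of the
module letter, the induced map substitutes in `x₂` and `y₂`, and the transpose of f̃ forms the block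
`y₃ w x₁`, which wraps around cyclically and whose sign is that of moving `x₁` to the end. -/
theorem bform_pb (f : MultiMap V W 0) (χ : BiMap W W (W.dual c) 0) (x : V.Word) (v : V.El)
    (y : V.Word) (w : V.El) : bform (pb f χ) x v y w = pbf f (bform χ) x v y w := by
  have inner : ∀ (x' y' : V.Word) (b : W.El),
      dualEval ((BiMap.comp (BiMap.pull f χ) f.diag).el x' v y').2 b =
      mid f.el (fun s u t => bform χ s u t b) x' v y' := by
    intro x' y' b
    rw [← evalAt_apply]
    refine (evalAt_comp (BiMap.pull f χ) f.diag x' v y' b _).trans ?_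
    refine cs_congr fun x₂ x₃ hx => cs_congr fun y₁ y₂ hy => ?_
    change evalAt b (wdeg x' + v.1 + wdeg y' + 0) ((BiMap.pull f χ).toFun x₂ (f.diag.el x₃ v y₁)
      y₂ (wdeg x' + v.1 + wdeg y' + 0)) = _
    rw [show (BiMap.pull f χ).toFun x₂ (f.diag.el x₃ v y₁) y₂ (wdeg x' + v.1 + wdeg y' + 0) =
      hat2 f (fun s t => χ.toFun s (f.diag.el x₃ v y₁) t (wdeg x' + v.1 + wdeg y' + 0)) x₂ y₂
      from rfl, hat2, map_hat]
    simp only [map_hat]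
    refine hat2_congr_wdeg f fun s t hs ht => ?_
    rw [diag_el, evalAt_toFun]
    subst hx hy
    simp only [wdeg_append, wdeg_cons, hs, ht, MultiMap.el]
    ring
  rw [bform, ← evalAt_apply]
  have outer : (evalAt w (wdeg x + v.1 + wdeg y + 0)) ((pb f χ).toFun x v y
      (wdeg x + v.1 + wdeg y + 0)) = cs (fun x₁ x' => cs (fun y' y₃ =>
      sgn 𝕜 (wdeg x₁ * (wdeg x' + v.1 + wdeg y' + wdeg y₃ + w.1)) •
        mid f.el (fun s u t => bform χ s u t (f.el (y₃ ++ w :: x₁))) x' v y') y) x := by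
    refine (evalAt_comp (f.diag.transpose c) (BiMap.comp (BiMap.pull f χ) f.diag)
      x v y w _).trans ?_
    refine cs_congr fun x₁ x' hx => cs_congr fun y' y₃ hy => ?_
    refine (evalAt_transpose f.diag x₁ _ y₃ w _ ?_).trans ?_
    · subst hx hy
      simp only [wdeg_append, BiMap.el]
      ring
    · rw [BiMap.transposeVal, inner, diag_el, smul_eq_mul]
      congr 1
      apply sgn_congr
      simp only [BiMap.el]
      push_cast
      ring
  rw [pbf_eq_mid]
  exact outer

/-- Skew symmetry of a scalar function. -/
def SkewForm (Φ : V.Word → V.El → V.Word → V.El → 𝕜) : Prop :=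
  ∀ (x y : V.Word) (v w : V.El),
    Φ x v y w = -(sgn 𝕜 ((wdeg x + v.1) * (wdeg y + w.1)) * Φ y w x v)

/-- Closedness of a scalar function, for families that end in a chosen entry. -/
def ClosedForm (Φ : V.Word → V.El → V.Word → V.El → 𝕜) : Prop :=
  ∀ (x Q R : V.Word) (a b d : V.El),
    sgn 𝕜 ((wdeg x + a.1 + wdeg Q + b.1) * (wdeg R + d.1)) * Φ (R ++ d :: x) a Q b +
    Φ (x ++ a :: Q) b R d +
    sgn 𝕜 ((wdeg x + a.1) * (wdeg Q + b.1 + wdeg R + d.1)) * Φ (Q ++ b :: R) d x a = 0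

/-- Exchanging the two arguments exchanges the roles of the two marked blocks, so the identity holds
summand by summand once the signs are compared. -/
theorem SkewForm.pbf {Φ : W.Word → W.El → W.Word → W.El → 𝕜} (h : SkewForm Φ)
    (f : MultiMap V W 0) : SkewForm (AInf.pbf f Φ) := by
  intro x y v w
  unfold AInf.pbf
  rw [cs3_comm, ← smul_eq_mul, ← cs3_smul, ← cs3_neg]
  refine cs3_congr fun y₁ y₂ y₃ hy => ?_
  rw [← cs3_smul, ← cs3_neg]
  refine cs3_congr fun x₁ x₂ x₃ hx => ?_
  rw [hat2_comm, hat2_congr_wdeg f (fun t s ht hs => (h s t _ _).trans (by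
    rw [hs, ht, ← neg_mul, ← smul_eq_mul])), hat2_smul]
  simp only [smul_smul, ← neg_smul, neg_sgn, ← sgn_add]
  congr 1
  apply sgn_congr
  subst hx hy
  simp only [wdeg_append, wdeg_cons, MultiMap.el]
  push_cast
  grind

/-! ### Closedness is preserved by pullback -/

section Closed

variable (f : MultiMap V W 0) (Φ : W.Word → W.El → W.Word → W.El → 𝕜)

/-- The part of a pullback where the first mark lies in the block of the second. -/
def pbfA (x : V.Word) (a : V.El) (Q : V.Word) (b : V.El) (R : V.Word) (d : V.El) : 𝕜 :=
  cs3 (fun x₁ x₂ x₃ => cs3 (fun r₁ r₂ r₃ => sgn 𝕜 (wdeg x₁ * (wdeg x₂ + wdeg x₃ + a.1 + wdeg Q +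
    b.1 + wdeg r₁ + wdeg r₂ + wdeg r₃ + d.1)) • hat2 f (fun s t =>
      Φ s (f.el (x₃ ++ a :: (Q ++ b :: r₁))) t (f.el (r₃ ++ d :: x₁))) x₂ r₂) R) x

/-- The part of a pullback where the three marks lie in different blocks. -/
def pbfB (x : V.Word) (a : V.El) (Q : V.Word) (b : V.El) (R : V.Word) (d : V.El) : 𝕜 :=
  cs3 (fun x₁ x₂ x₃ => cs3 (fun q₁ q₂ q₃ => cs3 (fun r₁ r₂ r₃ => sgn 𝕜 (wdeg x₁ * (wdeg x₂ +
    wdeg x₃ + a.1 + wdeg q₁ + wdeg q₂ + wdeg q₃ + b.1 + wdeg r₁ + wdeg r₂ + wdeg r₃ + d.1)) •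
    hat f.el (fun s => hat f.el (fun t => hat f.el (fun r =>
      Φ (s ++ f.el (x₃ ++ a :: q₁) :: t) (f.el (q₃ ++ b :: r₁)) r (f.el (r₃ ++ d :: x₁)))
      r₂) q₂) x₂) R) Q) x

/-- The part of a pullback where the first mark lies in the block of the third. -/
def pbfC (x : V.Word) (a : V.El) (Q : V.Word) (b : V.El) (R : V.Word) (d : V.El) : 𝕜 :=
  cs3 (fun q₁ q₂ q₃ => cs3 (fun r₁ r₂ r₃ => sgn 𝕜 ((wdeg x + a.1 + wdeg q₁) * (wdeg q₂ +
    wdeg q₃ + b.1 + wdeg r₁ + wdeg r₂ + wdeg r₃ + d.1)) • hat2 f (fun s t =>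
      Φ s (f.el (q₃ ++ b :: r₁)) t (f.el (r₃ ++ d :: (x ++ a :: q₁)))) q₂ r₂) R) Q

/-- The third mark `a` lies in the block of `b`, in a block of its own, or in the block of `d`,
which may wrap around cyclically. -/
theorem pbf_append_cons (x : V.Word) (a : V.El) (Q : V.Word) (b : V.El) (R : V.Word) (d : V.El) :
    pbf f Φ (x ++ a :: Q) b R d = pbfA f Φ x a Q b R d + pbfB f Φ x a Q b R d +
      pbfC f Φ x a Q b R d := by
  rw [pbf, cs3_append_cons]
  congr 1
  · congr 1
    · refine cs3_congr fun x₁ x₂ x₃ _ => cs3_congr fun r₁ r₂ r₃ _ => ?_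
      simp only [wdeg_append, wdeg_cons, List.append_assoc, List.cons_append, ← add_assoc]
    · have e : ∀ x₁ p q' q₃ : V.Word, cs3 (fun r₁ r₂ r₃ => sgn 𝕜 (wdeg x₁ * (wdeg (p ++ a :: q') +
          wdeg q₃ + b.1 + wdeg r₁ + wdeg r₂ + wdeg r₃ + d.1)) • hat2 f (fun s t =>
          Φ s (f.el (q₃ ++ b :: r₁)) t (f.el (r₃ ++ d :: x₁))) (p ++ a :: q') r₂) R =
          cs (fun x₂ x₃ => cs (fun q₁ q₂ => cs3 (fun r₁ r₂ r₃ => sgn 𝕜 (wdeg x₁ * (wdeg x₂ +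
            wdeg x₃ + a.1 + wdeg q₁ + wdeg q₂ + wdeg q₃ + b.1 + wdeg r₁ + wdeg r₂ + wdeg r₃ +
            d.1)) • hat f.el (fun s => hat f.el (fun t => hat f.el (fun r =>
            Φ (s ++ f.el (x₃ ++ a :: q₁) :: t) (f.el (q₃ ++ b :: r₁)) r (f.el (r₃ ++ d :: x₁)))
            r₂) q₂) x₂) R) q') p := by
        intro x₁ p q' q₃
        simp only [hat2, hat_append_cons, ← cs_smul, cs3_cs_comm]
        refine cs_congr fun x₂ x₃ hp => cs_congr fun q₁ q₂ hq => cs3_congr fun r₁ r₂ r₃ _ => ?_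
        subst hp hq
        simp only [wdeg_append, wdeg_cons, ← add_assoc]
      simp only [e]
      unfold pbfB
      simp only [cs3.eq_1 (x := x)]
      refine cs_congr fun x₁ p _ => ?_
      have e' : ∀ q' q₃ : V.Word, cs (fun x₂ x₃ => cs (fun q₁ q₂ => cs3 (fun r₁ r₂ r₃ =>
            sgn 𝕜 (wdeg x₁ * (wdeg x₂ +
            wdeg x₃ + a.1 + wdeg q₁ + wdeg q₂ + wdeg q₃ + b.1 + wdeg r₁ + wdeg r₂ + wdeg r₃ +
            d.1)) • hat f.el (fun s => hat f.el (fun t => hat f.el (fun r =>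
            Φ (s ++ f.el (x₃ ++ a :: q₁) :: t) (f.el (q₃ ++ b :: r₁)) r (f.el (r₃ ++ d :: x₁)))
            r₂) q₂) x₂) R) q') p = cs (fun q₁ q₂ => cs (fun x₂ x₃ => cs3 (fun r₁ r₂ r₃ =>
            sgn 𝕜 (wdeg x₁ * (wdeg x₂ +
            wdeg x₃ + a.1 + wdeg q₁ + wdeg q₂ + wdeg q₃ + b.1 + wdeg r₁ + wdeg r₂ + wdeg r₃ +
            d.1)) • hat f.el (fun s => hat f.el (fun t => hat f.el (fun r =>
            Φ (s ++ f.el (x₃ ++ a :: q₁) :: t) (f.el (q₃ ++ b :: r₁)) r (f.el (r₃ ++ d :: x₁)))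
            r₂) q₂) x₂) R) p) q' := fun q' q₃ => cs_comm _ _ _
      simp only [e']
      rw [cs_assoc]
      exact cs3_cs_comm _ _ _
  · refine cs3_congr fun q₁ q₂ q₃ _ => cs3_congr fun r₁ r₂ r₃ _ => ?_
    simp only [wdeg_append, wdeg_cons, ← add_assoc]

variable {Φ}

/-- Two marks in one block leave only two marked blocks, so the `C`-part is a rotated `A`-part with
its arguments exchanged. In the cyclic sum of closedness all `A`- and `C`-parts therefore cancel. -/
theorem SkewForm.pbfC (h : SkewForm Φ) (x : V.Word) (a : V.El) (Q : V.Word) (b : V.El)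
    (R : V.Word) (d : V.El) : AInf.pbfC f Φ x a Q b R d =
      -(sgn 𝕜 ((wdeg x + a.1 + wdeg Q + b.1) * (wdeg R + d.1)) * pbfA f Φ R d x a Q b) := by
  unfold AInf.pbfC pbfA
  rw [cs3_comm, ← smul_eq_mul, ← cs3_smul, ← cs3_neg]
  refine cs3_congr fun y₁ y₂ y₃ hy => ?_
  rw [← cs3_smul, ← cs3_neg]
  refine cs3_congr fun x₁ x₂ x₃ hx => ?_
  rw [hat2_comm, hat2_congr_wdeg f (fun t s ht hs => (h s t _ _).trans (by
    rw [hs, ht, ← neg_mul, ← smul_eq_mul])), hat2_smul]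
  simp only [smul_smul, ← neg_smul, neg_sgn, ← sgn_add]
  congr 1
  apply sgn_congr
  subst hx hy
  simp only [wdeg_append, wdeg_cons, MultiMap.el]
  push_cast
  grind

/-- When the three marks lie in different blocks, the summands of the three rotations match one by
one, and each triple is closedness of Φ for the list of blocks. -/
theorem ClosedForm.pbfB (h : ClosedForm Φ) (x Q R : V.Word) (a b d : V.El) :
    sgn 𝕜 ((wdeg x + a.1 + wdeg Q + b.1) * (wdeg R + d.1)) * AInf.pbfB f Φ R d x a Q b +
    AInf.pbfB f Φ x a Q b R d +
    sgn 𝕜 ((wdeg x + a.1) * (wdeg Q + b.1 + wdeg R + d.1)) * AInf.pbfB f Φ Q b R d x a = 0 := by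
  have e₁ : AInf.pbfB f Φ R d x a Q b = cs3 (fun x₁ x₂ x₃ => cs3 (fun q₁ q₂ q₃ =>
      cs3 (fun r₁ r₂ r₃ => sgn 𝕜 (wdeg r₁ * (wdeg r₂ + wdeg r₃ + d.1 + wdeg x₁ + wdeg x₂ +
        wdeg x₃ + a.1 + wdeg q₁ + wdeg q₂ + wdeg q₃ + b.1)) • hat f.el (fun s => hat f.el
        (fun t => hat f.el (fun r => Φ (r ++ f.el (r₃ ++ d :: x₁) :: s) (f.el (x₃ ++ a :: q₁)) t
          (f.el (q₃ ++ b :: r₁))) r₂) q₂) x₂) R) Q) x := by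
    unfold AInf.pbfB
    rw [cs3_comm]
    refine cs3_congr fun x₁ x₂ x₃ _ => ?_
    rw [cs3_comm]
    refine cs3_congr fun q₁ q₂ q₃ _ => cs3_congr fun r₁ r₂ r₃ _ => ?_
    congr 1
    rw [hat_comm]
    congr 1; funext s
    exact hat_comm _ _ _ _ _
  have e₂ : AInf.pbfB f Φ Q b R d x a = cs3 (fun x₁ x₂ x₃ => cs3 (fun q₁ q₂ q₃ =>
      cs3 (fun r₁ r₂ r₃ => sgn 𝕜 (wdeg q₁ * (wdeg q₂ + wdeg q₃ + b.1 + wdeg r₁ + wdeg r₂ +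
        wdeg r₃ + d.1 + wdeg x₁ + wdeg x₂ + wdeg x₃ + a.1)) • hat f.el (fun s => hat f.el
        (fun t => hat f.el (fun r => Φ (t ++ f.el (q₃ ++ b :: r₁) :: r) (f.el (r₃ ++ d :: x₁)) s
          (f.el (x₃ ++ a :: q₁))) r₂) q₂) x₂) R) Q) x := by
    unfold AInf.pbfB
    refine (cs3_congr fun q₁ q₂ q₃ _ => cs3_comm _ R x).trans ?_
    rw [cs3_comm]
    refine cs3_congr fun x₁ x₂ x₃ _ => cs3_congr fun q₁ q₂ q₃ _ => cs3_congr fun r₁ r₂ r₃ _ => ?_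
    congr 1
    refine Eq.trans ?_ (hat_comm _ _ _ _ _)
    congr 1; funext s
    exact hat_comm _ _ _ _ _
  rw [e₁, e₂]
  unfold AInf.pbfB
  rw [← smul_eq_mul (a := sgn 𝕜 _), ← smul_eq_mul (a := sgn 𝕜 _) (b := cs3 _ _), ← cs3_smul,
    ← cs3_smul, ← cs3_add, ← cs3_add]
  refine cs3_eq_zero fun x₁ x₂ x₃ hx => ?_
  rw [← cs3_smul, ← cs3_smul, ← cs3_add, ← cs3_add]
  refine cs3_eq_zero fun q₁ q₂ q₃ hq => ?_
  rw [← cs3_smul, ← cs3_smul, ← cs3_add, ← cs3_add]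
  refine cs3_eq_zero fun r₁ r₂ r₃ hr => ?_
  simp only [← hat_smul, ← hat_add]
  refine (hat_congr_wdeg fun s hs => ?_).trans (hat_zero f.el x₂)
  refine (hat_congr_wdeg fun t ht => ?_).trans (hat_zero f.el q₂)
  refine (hat_congr_wdeg fun r hr' => ?_).trans (hat_zero f.el r₂)
  have key := congrArg (fun z => sgn 𝕜 (wdeg x₁ * (wdeg x₂ +
    wdeg x₃ + a.1 + wdeg q₁ + wdeg q₂ + wdeg q₃ + b.1 + wdeg r₁ + wdeg r₂ + wdeg r₃ + d.1)) * z)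
    (h s t r (f.el (x₃ ++ a :: q₁)) (f.el (q₃ ++ b :: r₁)) (f.el (r₃ ++ d :: x₁)))
  simp only [mul_zero, mul_add, ← mul_assoc, ← sgn_add] at key
  simp only [smul_eq_mul, ← mul_assoc, ← sgn_add]
  rw [← key]
  subst hx hq hr
  congr 2
  · congr 1
    apply sgn_congr
    simp only [wdeg_append, wdeg_cons, MultiMap.el, hs, ht, hr']
    push_cast
    grind
  · congr 1
    apply sgn_congr
    push_cast
    grind
  · apply sgn_congr
    simp only [wdeg_append, wdeg_cons, MultiMap.el, hs, ht, hr']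
    push_cast
    grind

theorem ClosedForm.pbf (h : ClosedForm Φ) (h' : SkewForm Φ) : ClosedForm (AInf.pbf f Φ) := by
  intro x Q R a b d
  have hB := h.pbfB f x Q R a b d
  have e₁ := h'.pbfC f x a Q b R d
  have e₂ := h'.pbfC f R d x a Q b
  have e₃ := h'.pbfC f Q b R d x a
  simp only [pbf_append_cons]
  have s₁ : sgn 𝕜 ((wdeg x + a.1 + wdeg Q + b.1) * (wdeg R + d.1)) *
      sgn 𝕜 ((wdeg R + d.1 + wdeg x + a.1) * (wdeg Q + b.1)) =
      sgn 𝕜 ((wdeg x + a.1) * (wdeg Q + b.1 + wdeg R + d.1)) := by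
    rw [← sgn_add]; apply sgn_congr; push_cast; grind
  have s₂ : sgn 𝕜 ((wdeg x + a.1) * (wdeg Q + b.1 + wdeg R + d.1)) *
      sgn 𝕜 ((wdeg Q + b.1 + wdeg R + d.1) * (wdeg x + a.1)) = 1 := by
    rw [mul_comm (wdeg Q + b.1 + wdeg R + d.1), sgn_mul_self]
  rw [e₁, e₂, e₃]
  linear_combination hB - s₁ * pbfA f Φ Q b R d x a - s₂ * pbfA f Φ x a Q b R d

end Closed

end Forms

namespace DualFamily

variable {𝕜 : Type v} [Field 𝕜] {A : AInfAlgebra.{v, u} 𝕜} {c : ℤ}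

theorem isSkew_iff {φ : DualFamily A c} : φ.IsSkew ↔ SkewForm (bform φ) := Iff.rfl

/-- A family `P a Q b R d S` is a cyclic rotation of `S P a Q b R d`, which ends in a marked entry.
The two identities differ by the Koszul sign of that rotation. -/
theorem isClosed_iff {φ : DualFamily A c} : φ.IsClosed ↔ ClosedForm (bform φ) := by
  constructor
  · intro h x Q R a b d
    have := h x Q R [] a b d
    simp only [List.append_assoc, List.cons_append, List.nil_append, wdeg_append, wdeg_cons,
      wdeg_nil, add_zero, mul_zero, sgn_zero, one_mul, ← add_assoc] at this
    exact this
  · intro h P Q R S a b d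
    have key := congrArg (fun z => sgn 𝕜 ((wdeg P + a.1 + wdeg Q + b.1 + wdeg R + d.1) *
      wdeg S) * z) (h (S ++ P) Q R a b d)
    simp only [mul_zero, mul_add, ← mul_assoc, ← sgn_add] at key
    rw [← key]
    simp only [List.append_assoc, List.cons_append]
    congr 2
    · congr 1
      apply sgn_congr
      simp only [wdeg_append, wdeg_cons, wdeg_nil]
      push_cast
      grind
    · congr 1
      apply sgn_congr
      simp only [wdeg_append, wdeg_cons, wdeg_nil]
      push_cast
      grind
    · apply sgn_congr
      simp only [wdeg_append, wdeg_cons, wdeg_nil]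
      push_cast
      grind

end DualFamily

open GradedSpace

/-! ### Marked words -/

section Marked

variable {𝕜 : Type v} [Field 𝕜] {V : GradedSpace.{v, u} 𝕜} {W : GradedSpace.{v, u₁} 𝕜}
  {M : Type u₂} [AddCommGroup M] [Module 𝕜 M]

theorem cs_cs_regroup {α β : Type*} {M : Type*} [AddCommGroup M]
    (K : List α → List α → List α → List β → List β → List β → M) (x : List α) (y : List β) :
    cs (fun x₁ x₂ => cs (fun y₁ y₂ => cs (fun a b => cs (fun c d => K a b x₂ y₁ c d) y₂) x₁) y) x =
      cs (fun a x' => cs (fun y' d => cs (fun b x₂ => cs (fun y₁ c => K a b x₂ y₁ c d) y') x') y)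
        x := by
  rw [← cs3_cs3_regroup, ← cs_assoc]
  exact cs_congr fun x₁ x₂ _ => cs_comm _ _ _

/-- Linearity of a function of words with a marked letter. -/
structure MarkLinear (G : V.Word → V.El → V.Word → M) : Prop where
  left : ∀ v y, WordLinear fun x => G x v y
  mark : ∀ x y, LetterLinear fun v => G x v y
  right : ∀ x v, WordLinear fun y => G x v y

/-- The part of the derivation by a family of degree one on words with a marked letter, without
the terms that are to the right of the marked letter. -/
def half (m : V.Word → V.El) (G : V.Word → V.El → V.Word → M) (x : V.Word) (v : V.El)
    (y : V.Word) : M :=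
  der m (fun s => G s v y) x +
    cs (fun x₁ x₂ => cs (fun y₁ y₂ => sgn 𝕜 (wdeg x₁) • G x₁ (m (x₂ ++ v :: y₁)) y₂) y) x

/-- Intertwining on the block of the marked letter produces insertions on both sides of that letter.
Those on its right are not counted by `half` and form the extra sum. -/
theorem Intertwines.mid_half {f : MultiMap V W 0} {m : MultiMap V V 1} {m' : MultiMap W W 1}
    (h : Intertwines f m m') {G : W.Word → W.El → W.Word → M} (hG : MarkLinear G)
    (x : V.Word) (v : V.El) (y : V.Word) :
    mid f.el (half m'.el G) x v y = half m.el (mid f.el G) x v y +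
      cs (fun x₁ x₂ => cs (fun y₁ y₂ => sgn 𝕜 (wdeg x₁ + (wdeg x₂ + v.1)) •
        hat f.el (fun s => hat f.el (fun t =>
          der m.el (fun r => G s (f.el (x₂ ++ v :: r)) t) y₁) y₂) x₁) y) x := by
  -- An operation on the substituted word acts before the block of `v`, where intertwining moves it
  -- inside, or absorbs that block together with neighbours.
  have e₁ : ∀ x₁ x₂ y₁ y₂ : V.Word, hat f.el (fun s => hat f.el (fun t =>
      half m'.el G s (f.el (x₂ ++ v :: y₁)) t) y₂) x₁ =
      der m.el (hat f.el fun s => hat f.el (fun t => G s (f.el (x₂ ++ v :: y₁)) t) y₂) x₁ +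
      cs (fun a b => cs (fun c d => sgn 𝕜 (wdeg a) • hat f.el (fun s => hat f.el (fun t =>
        hat f.el (fun p => hat f.el (fun q =>
          G s (m'.el (p ++ f.el (x₂ ++ v :: y₁) :: q)) t) c) b) d) a) y₂) x₁ := by
    intro x₁ x₂ y₁ y₂
    simp only [half, hat_add]
    congr 1
    · rw [← h.hat_der (F := fun s => hat f.el (fun t => G s (f.el (x₂ ++ v :: y₁)) t) y₂)]
      · simp only [← der_hat_comm]
      · intro xs ys d r a b
        simp only [fun t => hG.left (f.el (x₂ ++ v :: y₁)) t xs ys d r a b, hat_add, hat_smul]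
    · have : ∀ s, hat f.el (fun t => cs (fun s₁ s₂ => cs (fun t₁ t₂ => sgn 𝕜 (wdeg s₁) •
          G s₁ (m'.el (s₂ ++ f.el (x₂ ++ v :: y₁) :: t₁)) t₂) t) s) y₂ =
          cs (fun s₁ s₂ => cs (fun c d => sgn 𝕜 (wdeg s₁) • hat f.el (fun t₁ => hat f.el (fun t₂ =>
          G s₁ (m'.el (s₂ ++ f.el (x₂ ++ v :: y₁) :: t₁)) t₂) d) c) y₂) s := by
        intro s
        rw [hat_cs_comm]
        refine cs_congr fun s₁ s₂ _ => ?_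
        rw [hat_cs]
        simp only [hat_smul]
      simp only [this]
      rw [hat_cs]
      refine cs_congr fun a b _ => ?_
      simp only [hat_cs_comm]
      refine cs_congr fun c d _ => ?_
      rw [← hat_smul]
      refine hat_congr_wdeg fun s hs => ?_
      rw [hs]
      simp only [hat_smul]
      congr 1
      refine Eq.trans ?_ (hat_comm _ _ _ _ _)
      congr 1
      funext p
      exact hat_comm _ _ _ _ _
  -- Absorbing the block of `v` is traded for an insertion in the enlarged block: to the left of
  -- `v`, absorbing `v`, or to its right.
  have e₂ : ∀ a x' y' d : V.Word, cs (fun b x₂ => cs (fun y₁ k => sgn 𝕜 (wdeg a) •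
      hat f.el (fun s => hat f.el (fun t => hat f.el (fun p => hat f.el (fun q =>
        G s (m'.el (p ++ f.el (x₂ ++ v :: y₁) :: q)) t) k) b) d) a) y') x' =
      sgn 𝕜 (wdeg a) • hat f.el (fun s => hat f.el (fun t =>
        der m.el (fun r => G s (f.el (r ++ v :: y')) t) x') d) a +
      cs (fun x₁ x₂ => cs (fun y₁ y₂ => sgn 𝕜 (wdeg (a ++ x₁)) • hat f.el (fun s =>
        hat f.el (fun t => G s (f.el (x₁ ++ m.el (x₂ ++ v :: y₁) :: y₂)) t) d) a) y') x' +
      sgn 𝕜 (wdeg a + (wdeg x' + v.1)) • hat f.el (fun s => hat f.el (fun t =>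
        der m.el (fun r => G s (f.el (x' ++ v :: r)) t) y') d) a := by
    intro a x' y' d
    have e : ∀ s t, hat f.el (fun r => G s (m'.el r) t) (x' ++ v :: y') =
        der m.el (fun r => G s (f.el r) t) (x' ++ v :: y') := fun s t => h.letter (hG.mark s t) _
    simp only [hat_append_cons, der_append_cons] at e
    have l : cs (fun b x₂ => cs (fun y₁ k => sgn 𝕜 (wdeg a) •
        hat f.el (fun s => hat f.el (fun t => hat f.el (fun p => hat f.el (fun q =>
        G s (m'.el (p ++ f.el (x₂ ++ v :: y₁) :: q)) t) k) b) d) a) y') x' =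
        sgn 𝕜 (wdeg a) • hat f.el (fun s => hat f.el (fun t => cs (fun b x₂ => cs (fun y₁ k =>
          hat f.el (fun p => hat f.el (fun q =>
        G s (m'.el (p ++ f.el (x₂ ++ v :: y₁) :: q)) t) k) b) y') x') d) a := by
      simp only [hat_cs_comm, cs_smul]
    rw [l]
    simp only [e, hat_add, smul_add]
    congr 1
    · congr 1
      simp only [hat_cs_comm, hat_smul, ← cs_smul, smul_smul, sgn_add, wdeg_append]
    · simp only [hat_smul, smul_smul, sgn_add]
  refine Eq.trans (cs_congr fun x₁ x₂ _ => cs_congr fun y₁ y₂ _ => e₁ x₁ x₂ y₁ y₂) ?_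
  simp only [cs_add]
  rw [cs_cs_regroup (fun a b x₂ y₁ c d => sgn 𝕜 (wdeg a) • hat f.el (fun s => hat f.el (fun t =>
    hat f.el (fun p => hat f.el (fun q =>
      G s (m'.el (p ++ f.el (x₂ ++ v :: y₁) :: q)) t) c) b) d) a)]
  simp only [e₂, cs_add]
  have e₄ : half m.el (mid f.el G) x v y = cs (fun x₁ x₂ => cs (fun y₁ y₂ => der m.el (hat f.el
      fun s => hat f.el (fun t => G s (f.el (x₂ ++ v :: y₁)) t) y₂) x₁) y) x +
      (cs (fun a x' => cs (fun y' d => sgn 𝕜 (wdeg a) • hat f.el (fun s => hat f.el (fun t =>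
        der m.el (fun r => G s (f.el (r ++ v :: y')) t) x') d) a) y) x +
      cs (fun a x' => cs (fun y' d => cs (fun x₁ x₂ => cs (fun y₁ y₂ => sgn 𝕜 (wdeg (a ++ x₁)) •
        hat f.el (fun s => hat f.el (fun t =>
          G s (f.el (x₁ ++ m.el (x₂ ++ v :: y₁) :: y₂)) t) d) a) y') x') y) x) := by
    rw [half, ← add_assoc]
    congr 1
    · unfold mid
      refine (der_cs _ _ _).trans ?_
      rw [cs_add]
      simp only [der_cs_comm, der_hat_comm, ← cs_smul]
    · rw [← cs_cs_regroup (fun a x₁ x₂ y₁ y₂ d => sgn 𝕜 (wdeg (a ++ x₁)) • hat f.el (fun s =>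
        hat f.el (fun t => G s (f.el (x₁ ++ m.el (x₂ ++ v :: y₁) :: y₂)) t) d) a)]
      refine cs_congr fun x₁ x₂ hx => cs_congr fun y₁ y₂ hy => ?_
      rw [mid, ← cs_smul]
      refine cs_congr fun a b ha => ?_
      rw [← cs_smul, ha]
  rw [e₄]
  abel

end Marked

/-! ### The Lie derivative of a form -/

section Lie

variable {𝕜 : Type v} [Field 𝕜] {V : GradedSpace.{v, u} 𝕜} {W : GradedSpace.{v, u₁} 𝕜} {c : ℤ}

/-- Linearity of a scalar function in all its arguments. -/
structure FormLinear (Φ : V.Word → V.El → V.Word → V.El → 𝕜) : Prop where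
  left : ∀ v y w, WordLinear fun x => Φ x v y w
  mid : ∀ x y w, LetterLinear fun v => Φ x v y w
  right : ∀ x v w, WordLinear fun y => Φ x v y w
  arg : ∀ x v y, LetterLinear fun w => Φ x v y w

theorem formLinear_bform (φ : BiMap V V (V.dual c) 0) : FormLinear (bform φ) where
  left v y w := bform_left_linear φ v y w
  mid x y w := bform_mid_linear φ x y w
  right x v w := bform_right_linear φ x v w
  arg x v y := bform_arg_linear φ x y v

/-- The rotation of a form. -/
def rotForm (Φ : V.Word → V.El → V.Word → V.El → 𝕜) (x : V.Word) (v : V.El) (y : V.Word)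
    (w : V.El) : 𝕜 := sgn 𝕜 ((wdeg x + v.1) * (wdeg y + w.1)) • Φ y w x v

/-- One half of the Lie derivative. -/
def halfForm (m : V.Word → V.El) (Φ : V.Word → V.El → V.Word → V.El → 𝕜) (x : V.Word) (v : V.El)
    (y : V.Word) (w : V.El) : 𝕜 := half m (fun a b c => Φ a b c w) x v y

/-- The Lie derivative of a form: the sum over all ways to insert `m` such that it does not absorb
both marked letters. -/
def lieForm (m : V.Word → V.El) (Φ : V.Word → V.El → V.Word → V.El → 𝕜) (x : V.Word) (v : V.El)
    (y : V.Word) (w : V.El) : 𝕜 :=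
  halfForm m Φ x v y w + rotForm (halfForm m (rotForm Φ)) x v y w

theorem FormLinear.markLinear {Φ : V.Word → V.El → V.Word → V.El → 𝕜} (h : FormLinear Φ)
    (w : V.El) : MarkLinear fun x v y => Φ x v y w where
  left v y := h.left v y w
  mark x y := h.mid x y w
  right x v := h.right x v w

theorem FormLinear.rotForm {Φ : V.Word → V.El → V.Word → V.El → 𝕜} (h : FormLinear Φ) :
    FormLinear (AInf.rotForm Φ) where
  left v y w := (h.right y w v).smul_wdeg fun n => sgn 𝕜 ((n + v.1) * (wdeg y + w.1))
  mid x y w d r a b := by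
    simp only [AInf.rotForm, h.arg y w x d r a b, smul_add, smul_comm r]
  right x v w := (h.left w x v).smul_wdeg fun n => sgn 𝕜 ((wdeg x + v.1) * (n + w.1))
  arg x v y d r a b := by
    simp only [AInf.rotForm, h.mid y x v d r a b, smul_add, smul_comm r]

theorem rotForm_rotForm (Φ : V.Word → V.El → V.Word → V.El → 𝕜) : rotForm (rotForm Φ) = Φ := by
  funext x v y w
  rw [rotForm, rotForm, smul_smul, mul_comm (wdeg y + w.1), sgn_mul_self, one_smul]

theorem rotForm_add (Φ Ψ : V.Word → V.El → V.Word → V.El → 𝕜) (x : V.Word) (v : V.El)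
    (y : V.Word) (w : V.El) : rotForm (fun x v y w => Φ x v y w + Ψ x v y w) x v y w =
      rotForm Φ x v y w + rotForm Ψ x v y w := smul_add _ _ _

theorem pbf_rotForm (f : MultiMap V W 0) (Φ : W.Word → W.El → W.Word → W.El → 𝕜) :
    pbf f (rotForm Φ) = rotForm (pbf f Φ) := by
  funext x v y w
  unfold rotForm AInf.pbf
  rw [cs3_comm, ← cs3_smul]
  refine cs3_congr fun y₁ y₂ y₃ hy => ?_
  rw [← cs3_smul]
  refine cs3_congr fun x₁ x₂ x₃ hx => ?_
  rw [hat2_comm, hat2_congr_wdeg f (fun t s ht hs => by beta_reduce; rw [hs, ht]), hat2_smul]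
  simp only [smul_smul, ← sgn_add]
  congr 1
  apply sgn_congr
  subst hx hy
  simp only [wdeg_append, wdeg_cons, MultiMap.el]
  push_cast
  grind

/-- The part of the derivation of a pullback in the letters on the right in the first block. -/
def innerForm (f : V.Word → W.El) (m : V.Word → V.El) (Φ : W.Word → W.El → W.Word → W.El → 𝕜)
    (x : V.Word) (v : V.El) (y : V.Word) (w : V.El) : 𝕜 :=
  cs3 (fun x₁ x₂ x₃ => cs3 (fun y₁ y₂ y₃ =>
    sgn 𝕜 (wdeg x₁ * (wdeg x₂ + wdeg x₃ + v.1 + wdeg y₁ + wdeg y₂ + wdeg y₃ + w.1) +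
      (wdeg x₂ + (wdeg x₃ + v.1))) • hat f (fun s => hat f (fun t =>
        der m (fun r => Φ s (f (x₃ ++ v :: r)) t (f (y₃ ++ w :: x₁))) y₁) y₂) x₂) y) x

/-- The common part of the derivation of a pullback and the pullback of the derivation. -/
def commonForm (f : V.Word → W.El) (m : V.Word → V.El) (Φ : W.Word → W.El → W.Word → W.El → 𝕜)
    (x : V.Word) (v : V.El) (y : V.Word) (w : V.El) : 𝕜 :=
  cs (fun x₁ x' => cs (fun y' y₃ =>
    sgn 𝕜 (wdeg x₁ * (wdeg x' + v.1 + wdeg y' + wdeg y₃ + w.1)) •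
      half m (mid f (fun s u t => Φ s u t (f (y₃ ++ w :: x₁)))) x' v y') y) x

variable {f : MultiMap V W 0} {m : MultiMap V V 1} {m' : MultiMap W W 1}
  {Φ : W.Word → W.El → W.Word → W.El → 𝕜}

/-- The halves of the Lie derivative are not natural separately. The defect is `innerForm`, the
insertions to the right of `v` inside its block; `halfForm_pbf` has the rotated defect. -/
theorem Intertwines.pbf_halfForm (h : Intertwines f m m') (hΦ : FormLinear Φ) (x : V.Word)
    (v : V.El) (y : V.Word) (w : V.El) : pbf f (halfForm m'.el Φ) x v y w =
      commonForm f.el m.el Φ x v y w + innerForm f.el m.el Φ x v y w := by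
  rw [pbf_eq_mid, innerForm, cs3_cs3_regroup, commonForm, ← cs_add]
  refine cs_congr fun x₁ x' _ => ?_
  rw [← cs_add]
  refine cs_congr fun y' y₃ _ => ?_
  refine (congrArg _ (h.mid_half (hΦ.markLinear (f.el (y₃ ++ w :: x₁))) x' v y')).trans ?_
  rw [smul_add]
  congr 1
  rw [← cs_smul]
  refine cs_congr fun x₂ x₃ hx => ?_
  rw [← cs_smul]
  refine cs_congr fun y₁ y₂ hy => ?_
  subst hx hy
  rw [smul_smul, ← sgn_add]
  simp only [wdeg_append, ← add_assoc]

theorem halfForm_pbf (x : V.Word) (v : V.El) (y : V.Word) (w : V.El) :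
    halfForm m.el (pbf f Φ) x v y w =
      commonForm f.el m.el Φ x v y w + rotForm (innerForm f.el m.el (rotForm Φ)) x v y w := by
  -- After rotation these are the insertions in `x₁`, that is, in the part of the block of `w` that
  -- lies to the right of `w`.
  have e₁ : rotForm (innerForm f.el m.el (rotForm Φ)) x v y w = cs (fun x₁ x' =>
      der m.el (fun r => cs (fun y' y₃ =>
        sgn 𝕜 (wdeg r * (wdeg x' + v.1 + wdeg y' + wdeg y₃ + w.1)) •
        mid f.el (fun s u t => Φ s u t (f.el (y₃ ++ w :: r))) x' v y') y) x₁) x := by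
    have l₁ : ∀ x₁ x' y' y₃ : V.Word, der m.el (fun r =>
        sgn 𝕜 (wdeg r * (wdeg x' + v.1 + wdeg y' + wdeg y₃ + w.1)) •
        mid f.el (fun s u t => Φ s u t (f.el (y₃ ++ w :: r))) x' v y') x₁ =
        cs (fun x₂ x₃ => cs (fun y₁ y₂ => sgn 𝕜 ((wdeg x₁ + 1) *
          (wdeg (x₂ ++ x₃) + v.1 + wdeg (y₁ ++ y₂) + wdeg y₃ + w.1)) • hat f.el (fun s =>
          hat f.el (fun t => der m.el (fun r => Φ s (f.el (x₃ ++ v :: y₁)) t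
          (f.el (y₃ ++ w :: r))) x₁) y₂) x₂) y') x' := by
      intro x₁ x' y' y₃
      rw [der_congr_wdeg (fun r hr => by rw [hr]), der_smul]
      simp only [mid, der_cs_comm, der_hat_comm, ← cs_smul]
      refine cs_congr fun x₂ x₃ hx => cs_congr fun y₁ y₂ hy => ?_
      rw [hx, hy]
    simp only [der_cs_comm, l₁]
    rw [← cs3_cs3_regroup (fun x₁ x₂ x₃ y₁ y₂ y₃ => sgn 𝕜 ((wdeg x₁ + 1) *
          (wdeg (x₂ ++ x₃) + v.1 + wdeg (y₁ ++ y₂) + wdeg y₃ + w.1)) • hat f.el (fun s =>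
          hat f.el (fun t => der m.el (fun r => Φ s (f.el (x₃ ++ v :: y₁)) t
          (f.el (y₃ ++ w :: r))) x₁) y₂) x₂), rotForm, innerForm, cs3_comm, ← cs3_smul]
    refine cs3_congr fun x₁ x₂ x₃ hx => ?_
    rw [← cs3_smul]
    refine cs3_congr fun y₁ y₂ y₃ hy => ?_
    have l₂ : ∀ s t : W.Word, wdeg s = wdeg x₂ → wdeg t = wdeg y₂ →
        der m.el (fun r => rotForm Φ t (f.el (y₃ ++ w :: r)) s (f.el (x₃ ++ v :: y₁))) x₁ =
        sgn 𝕜 ((wdeg y₂ + (wdeg y₃ + w.1 + wdeg x₁ + 1)) *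
          (wdeg x₂ + (wdeg x₃ + v.1 + wdeg y₁))) •
        der m.el (fun r => Φ s (f.el (x₃ ++ v :: y₁)) t (f.el (y₃ ++ w :: r))) x₁ := by
      intro s t hs ht
      rw [← der_smul]
      refine der_congr_wdeg fun r hr => ?_
      rw [rotForm]
      congr 1
      apply sgn_congr
      simp only [wdeg_append, wdeg_cons, MultiMap.el, hs, ht, hr]
      push_cast
      ring
    rw [hat_comm, hat_congr_wdeg (fun s hs => hat_congr_wdeg (fun t ht => l₂ s t hs ht))]
    simp only [hat_smul, smul_smul, ← sgn_add]
    congr 1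
    apply sgn_congr
    subst hx hy
    simp only [wdeg_append]
    push_cast
    grind
  have e₂ : ∀ x₁ x' : V.Word, sgn 𝕜 (wdeg x₁) • der m.el (fun r => cs (fun y' y₃ =>
      sgn 𝕜 (wdeg x₁ * (wdeg r + v.1 + wdeg y' + wdeg y₃ + w.1)) •
        mid f.el (fun s u t => Φ s u t (f.el (y₃ ++ w :: x₁))) r v y') y) x' =
      cs (fun y' y₃ => sgn 𝕜 (wdeg x₁ * (wdeg x' + v.1 + wdeg y' + wdeg y₃ + w.1)) •
        der m.el (fun r => mid f.el (fun s u t => Φ s u t (f.el (y₃ ++ w :: x₁))) r v y') x')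
        y := by
    intro x₁ x'
    rw [der_cs_comm, ← cs_smul]
    refine cs_congr fun y' y₃ _ => ?_
    rw [der_congr_wdeg (fun r hr => by rw [hr]), der_smul, smul_smul, ← sgn_add]
    congr 1
    apply sgn_congr
    push_cast
    grind
  have e₃ : cs (fun p x₂ => cs (fun y₁ q => sgn 𝕜 (wdeg p) • pbf f Φ p (m.el (x₂ ++ v :: y₁)) q w)
      y) x = cs (fun x₁ x' => cs (fun y' y₃ => cs (fun a x₂ => cs (fun y₁ k =>
        sgn 𝕜 (wdeg x₁ * (wdeg x' + v.1 + wdeg y' + wdeg y₃ + w.1)) • sgn 𝕜 (wdeg a) •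
        mid f.el (fun s u t => Φ s u t (f.el (y₃ ++ w :: x₁))) a (m.el (x₂ ++ v :: y₁)) k)
        y') x') y) x := by
    refine Eq.trans ?_ (cs_cs_regroup (fun x₁ a x₂ y₁ k y₃ => sgn 𝕜 (wdeg x₁ * (wdeg (a ++ x₂) +
      v.1 + wdeg (y₁ ++ k) + wdeg y₃ + w.1)) • sgn 𝕜 (wdeg a) •
      mid f.el (fun s u t => Φ s u t (f.el (y₃ ++ w :: x₁))) a (m.el (x₂ ++ v :: y₁)) k)
      x y) |>.trans ?_
    · refine cs_congr fun p x₂ _ => cs_congr fun y₁ q _ => ?_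
      rw [pbf_eq_mid, ← cs_smul]
      refine cs_congr fun x₁ a hp => ?_
      rw [← cs_smul]
      refine cs_congr fun k y₃ hq => ?_
      rw [smul_smul, smul_smul, ← sgn_add, ← sgn_add]
      congr 1
      apply sgn_congr
      subst hp hq
      simp only [wdeg_append, wdeg_cons, MultiMap.el]
      push_cast
      grind
    · refine cs_congr fun x₁ x' _ => cs_congr fun y' y₃ _ => cs_congr fun a x₂ hx =>
        cs_congr fun y₁ k hy => ?_
      rw [hx, hy]
  have e₄ : halfForm m.el (pbf f Φ) x v y w = cs (fun x₁ x' =>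
      der m.el (fun r => cs (fun y' y₃ =>
        sgn 𝕜 (wdeg r * (wdeg x' + v.1 + wdeg y' + wdeg y₃ + w.1)) •
        mid f.el (fun s u t => Φ s u t (f.el (y₃ ++ w :: r))) x' v y') y) x₁ +
      sgn 𝕜 (wdeg x₁) • der m.el (fun r => cs (fun y' y₃ =>
      sgn 𝕜 (wdeg x₁ * (wdeg r + v.1 + wdeg y' + wdeg y₃ + w.1)) •
        mid f.el (fun s u t => Φ s u t (f.el (y₃ ++ w :: x₁))) r v y') y) x') x +
      cs (fun p x₂ => cs (fun y₁ q => sgn 𝕜 (wdeg p) • pbf f Φ p (m.el (x₂ ++ v :: y₁)) q w)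
      y) x := by
    rw [halfForm, half]
    congr 1
    rw [← der_cs]
    congr 1
    funext s
    exact pbf_eq_mid f Φ s v y w
  rw [e₄, e₃, e₁, cs_add]
  simp only [e₂]
  rw [add_assoc, add_comm, ← cs_add, commonForm]
  congr 1
  refine cs_congr fun x₁ x' _ => ?_
  rw [← cs_add]
  refine cs_congr fun y' y₃ _ => ?_
  simp only [half, smul_add, ← cs_smul]

/-- Adding a half and its rotation, the defect of one half is the rotated defect of the other, so
both sides are the same sum of common and inner parts. -/
theorem Intertwines.pbf_lieForm (h : Intertwines f m m') (hΦ : FormLinear Φ) (x : V.Word)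
    (v : V.El) (y : V.Word) (w : V.El) :
    pbf f (lieForm m'.el Φ) x v y w = lieForm m.el (pbf f Φ) x v y w := by
  have e₁ : pbf f (lieForm m'.el Φ) x v y w = pbf f (halfForm m'.el Φ) x v y w +
      rotForm (pbf f (halfForm m'.el (rotForm Φ))) x v y w := by
    rw [← pbf_rotForm]
    simp only [pbf, lieForm, hat2_add, smul_add, cs3_add]
  have e₂ : pbf f (halfForm m'.el (rotForm Φ)) = fun x v y w => commonForm f.el m.el (rotForm Φ)
      x v y w + innerForm f.el m.el (rotForm Φ) x v y w := by
    funext x v y w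
    exact h.pbf_halfForm hΦ.rotForm x v y w
  have e₃ : halfForm m.el (rotForm (pbf f Φ)) = fun x v y w => commonForm f.el m.el (rotForm Φ)
      x v y w + rotForm (innerForm f.el m.el Φ) x v y w := by
    funext x v y w
    rw [← pbf_rotForm, halfForm_pbf, rotForm_rotForm]
  rw [e₁, e₂, h.pbf_halfForm hΦ, lieForm, halfForm_pbf, e₃, rotForm_add, rotForm_add,
    rotForm_rotForm]
  ring

/-- The four sums are those of the bimodule equation evaluated at `w`; the last one carries the sign
of the dual bimodule. -/
theorem lieForm_eq (Ψ : V.Word → V.El → V.Word → V.El → 𝕜) (x : V.Word) (v : V.El) (y : V.Word)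
    (w : V.El) : lieForm m.el Ψ x v y w = der m.el (fun s => Ψ s v y w) x +
      cs (fun x₁ x₂ => cs (fun y₁ y₂ =>
        sgn 𝕜 (wdeg x₁) • Ψ x₁ (m.el (x₂ ++ v :: y₁)) y₂ w) y) x +
      sgn 𝕜 (wdeg x + v.1) • der m.el (fun t => Ψ x v t w) y -
      cs (fun x₁ x₂ => cs (fun y₁ y₂ =>
        sgn 𝕜 (1 + (wdeg x₂ + v.1 + wdeg y₁) + wdeg x₁ * (wdeg x₂ + v.1 + wdeg y₁ + wdeg y₂ +
          w.1)) • Ψ x₂ v y₁ (m.el (y₂ ++ w :: x₁))) y) x := by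
  rw [lieForm, halfForm, half, add_sub_assoc]
  congr 1
  rw [rotForm, halfForm, half, smul_add, sub_eq_add_neg]
  congr 1
  · simp only [rotForm]
    rw [der_congr_wdeg (fun s hs => by rw [hs]), der_smul, smul_smul, ← sgn_add]
    congr 1
    apply sgn_congr
    push_cast
    grind
  · rw [cs_comm, ← cs_smul, ← cs_neg]
    refine cs_congr fun x₁ x₂ hx => ?_
    rw [← cs_smul, ← cs_neg]
    refine cs_congr fun y₁ y₂ hy => ?_
    simp only [rotForm, smul_smul, ← neg_smul, neg_sgn, ← sgn_add]
    congr 1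
    apply sgn_congr
    subst hx hy
    simp only [wdeg_append, wdeg_cons, MultiMap.el]
    push_cast
    grind

end Lie

/-! ### Bimodule maps as invariant forms -/

section Bimodule

variable {𝕜 : Type v} [Field 𝕜] {A : AInfAlgebra.{v, u} 𝕜} {c : ℤ}

theorem DualFamily.isBimoduleMap_iff {φ : DualFamily A c} :
    φ.IsBimoduleMap ↔ ∀ x v y w, lieForm A.m.el (bform φ) x v y w = 0 := by
  have key : ∀ (x : A.space.Word) (v : A.space.El) (y : A.space.Word) (w : A.space.El) (e : ℤ),
      e = wdeg x + v.1 + wdeg y + 1 → evalAt w e (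
      cs3 (fun a b d => sgn 𝕜 (wdeg a) • φ.toFun (a ++ A.m.el b :: d) v y e) x +
      cs (fun x₁ x₂ => cs (fun y₁ y₂ =>
        sgn 𝕜 (wdeg x₁) • φ.toFun x₁ (A.m.diag.el x₂ v y₁) y₂ e) y) x +
      cs3 (fun a b d => sgn 𝕜 (wdeg x + v.1 + wdeg a) • φ.toFun x v (a ++ A.m.el b :: d) e) y -
      cs (fun x₁ x₂ => cs (fun y₁ y₂ =>
        (A.m.diag.transpose c).toFun x₁ (φ.el x₂ v y₁) y₂ e) y) x) =
      lieForm A.m.el (bform φ) x v y w := by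
    intro x v y w e he
    rw [lieForm_eq, map_sub, map_add, map_add]
    congr 1
    · congr 1
      · congr 1
        · rw [map_cs3]
          refine cs3_congr fun a b d hx => ?_
          rw [map_smul, evalAt_toFun]
          subst hx he
          simp only [wdeg_append, wdeg_cons, MultiMap.el]
          ring
        · rw [map_cs]
          refine cs_congr fun x₁ x₂ hx => ?_
          rw [map_cs]
          refine cs_congr fun y₁ y₂ hy => ?_
          rw [map_smul, diag_el, evalAt_toFun]
          subst hx hy he
          simp only [wdeg_append, wdeg_cons, MultiMap.el]
          ring
      · rw [map_cs3, der, ← cs3_smul]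
        refine cs3_congr fun a b d hy => ?_
        rw [map_smul, evalAt_toFun, smul_smul, ← sgn_add]
        subst hy he
        simp only [wdeg_append, wdeg_cons, MultiMap.el]
        ring
    · rw [map_cs]
      refine cs_congr fun x₁ x₂ hx => ?_
      rw [map_cs]
      refine cs_congr fun y₁ y₂ hy => ?_
      rw [evalAt_transpose, BiMap.transposeVal, diag_el, smul_eq_mul]
      · simp only [BiMap.el, one_mul, add_zero]
        rfl
      · subst hx hy he
        simp only [wdeg_append, BiMap.el]
        ring
  have hD : φ.IsBimoduleMap ↔ ∀ (x : A.space.Word) (v : A.space.El) (y : A.space.Word) (e : ℤ),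
      cs3 (fun a b d => sgn 𝕜 (wdeg a) • φ.toFun (a ++ A.m.el b :: d) v y e) x +
      cs (fun x₁ x₂ => cs (fun y₁ y₂ =>
        sgn 𝕜 (wdeg x₁) • φ.toFun x₁ (A.m.diag.el x₂ v y₁) y₂ e) y) x +
      cs3 (fun a b d => sgn 𝕜 (wdeg x + v.1 + wdeg a) • φ.toFun x v (a ++ A.m.el b :: d) e) y =
      cs (fun x₁ x₂ => cs (fun y₁ y₂ =>
        (A.m.diag.transpose c).toFun x₁ (φ.el x₂ v y₁) y₂ e) y) x := by
    simp only [← cuts₃_sum]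
    exact Iff.rfl
  rw [hD]
  constructor
  · intro h x v y w
    rw [← key x v y w _ rfl, h, sub_self, map_zero]
  · intro h x v y e
    by_cases he : e = wdeg x + v.1 + wdeg y + 1
    · rw [← sub_eq_zero]
      exact dual_ext fun w => (key x v y w e he).trans (h x v y w)
    -- In the other degrees every term vanishes for degree reasons.
    · rw [cs3_eq_zero, cs_eq_zero, cs3_eq_zero, cs_eq_zero]
      · simp
      · intro x₁ x₂ hx
        refine cs_eq_zero fun y₁ y₂ hy => BiMap.degree _ _ _ _ _ fun h' => he ?_
        subst hx hy h'
        simp only [wdeg_append, BiMap.el]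
        ring
      · intro a b d hy
        rw [φ.degree, smul_zero]
        intro h'
        refine he ?_
        subst hy h'
        simp only [wdeg_append, wdeg_cons, MultiMap.el]
        ring
      · intro x₁ x₂ hx
        refine cs_eq_zero fun y₁ y₂ hy => ?_
        rw [φ.degree, smul_zero]
        intro h'
        refine he ?_
        subst hx hy h'
        simp only [wdeg_append, diag_el, wdeg_cons, MultiMap.el]
        ring
      · intro a b d hx
        rw [φ.degree, smul_zero]
        intro h'
        refine he ?_
        subst hx h'
        simp only [wdeg_append, wdeg_cons, MultiMap.el]
        ring

theorem DualFamily.IsBimoduleMap.pullback {B : AInfAlgebra.{v, u₁} 𝕜} {χ : DualFamily B c}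
    (h : χ.IsBimoduleMap) (f : AInfHom A B) : (DualFamily.pullback f χ).IsBimoduleMap := by
  rw [isBimoduleMap_iff] at h ⊢
  intro x v y w
  have e : bform (DualFamily.pullback f χ) = pbf f.f (bform χ) := by
    funext x v y w
    exact bform_pb f.f χ x v y w
  rw [e, ← f.intertwines.pbf_lieForm (formLinear_bform χ)]
  refine cs3_eq_zero fun _ _ _ _ => cs3_eq_zero fun _ _ _ _ => ?_
  simp only [hat2, h, hat_zero, smul_zero]

end Bimodule

open GradedSpace

/-! ### Sums over the letters of a word -/

section MarkedSum

variable {α : Type u} {M : Type u₂} [AddCommGroup M]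

/-- The sum of `K P a Q` over all `P`, `a`, `Q` with `z = P a Q`. -/
def ms : (List α → α → List α → M) → List α → M
  | _, [] => 0
  | K, a :: z => K [] a z + ms (fun P b Q => K (a :: P) b Q) z

theorem ms_nil (K : List α → α → List α → M) : ms K [] = 0 := rfl

theorem ms_cons (K : List α → α → List α → M) (a : α) (z : List α) :
    ms K (a :: z) = K [] a z + ms (fun P b Q => K (a :: P) b Q) z := rfl

theorem ms_append_cons (K : List α → α → List α → M) (x : List α) (v : α) (y : List α) :
    ms K (x ++ v :: y) = ms (fun P a Q => K P a (Q ++ v :: y)) x + K x v y +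
      ms (fun P a Q => K (x ++ v :: P) a Q) y := by
  induction x generalizing K with
  | nil => simp [ms_cons, ms_nil]
  | cons b x ih => simp only [List.cons_append, ms_cons, ih]; abel

theorem ms_congr {K K' : List α → α → List α → M} {z : List α}
    (h : ∀ P a Q, P ++ a :: Q = z → K P a Q = K' P a Q) : ms K z = ms K' z := by
  induction z generalizing K K' with
  | nil => rfl
  | cons b z ih =>
    rw [ms_cons, ms_cons, h _ _ _ rfl, ih fun P a Q hz => h (b :: P) a Q (by simp [hz])]

theorem ms_const (r : M) (z : List α) : ms (fun _ _ _ => r) z = z.length • r := by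
  induction z with
  | nil => simp [ms_nil]
  | cons b z ih => rw [ms_cons, ih, List.length_cons, succ_nsmul']

theorem ms_add (K K' : List α → α → List α → M) (z : List α) :
    ms (fun P a Q => K P a Q + K' P a Q) z = ms K z + ms K' z := by
  induction z generalizing K K' with
  | nil => simp [ms_nil]
  | cons b z ih => simp only [ms_cons, ih]; abel

theorem map_ms {N : Type*} [AddCommGroup N] {F : Type*} [FunLike F M N]
    [AddMonoidHomClass F M N] (φ : F) (K : List α → α → List α → M) (z : List α) :
    φ (ms K z) = ms (fun P a Q => φ (K P a Q)) z := by
  induction z generalizing K with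
  | nil => simp [ms_nil]
  | cons b z ih => simp only [ms_cons, map_add, ih]

theorem ms_neg (K : List α → α → List α → M) (z : List α) :
    ms (fun P a Q => -K P a Q) z = -ms K z :=
  (map_ms (negAddMonoidHom : M →+ M) K z).symm

theorem ms_sub (K K' : List α → α → List α → M) (z : List α) :
    ms (fun P a Q => K P a Q - K' P a Q) z = ms K z - ms K' z := by
  simp only [sub_eq_add_neg, ms_add, ms_neg]

theorem ms_smul {𝕜 : Type v} [Ring 𝕜] [Module 𝕜 M] (r : 𝕜) (K : List α → α → List α → M)
    (z : List α) : ms (fun P a Q => r • K P a Q) z = r • ms K z :=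
  (map_ms (DistribSMul.toAddMonoidHom M r) K z).symm

end MarkedSum

/-! ### The Poincaré lemma and constant forms -/

section Forms

variable {𝕜 : Type v} [Field 𝕜] {V : GradedSpace.{v, u} 𝕜} {M : Type u₂} [AddCommGroup M]
  [Module 𝕜 M] {c : ℤ}

theorem MarkLinear.ms {G : V.Word → V.El → V.Word → M} (hG : MarkLinear G) :
    WordLinear (AInf.ms G) := by
  intro xs
  induction xs generalizing G with
  | nil =>
    intro ys d r a b
    simp only [List.nil_append, ms_cons, hG.mark [] ys d r a b, smul_add]
    have : AInf.ms (fun P b' Q => G (⟨d, r • a + b⟩ :: P) b' Q) ys =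
        r • AInf.ms (fun P b' Q => G (⟨d, a⟩ :: P) b' Q) ys +
        AInf.ms (fun P b' Q => G (⟨d, b⟩ :: P) b' Q) ys := by
      rw [← ms_smul, ← ms_add]
      exact ms_congr fun P b' Q _ => hG.left b' Q [] P d r a b
    rw [this]
    abel
  | cons x xs ih =>
    intro ys d r a b
    have h₁ := hG.right [] x xs ys d r a b
    have h₂ := ih (G := fun P b Q => G (x :: P) b Q)
      ⟨fun v y => (hG.left v y).cons x, fun P y => hG.mark (x :: P) y,
        fun P v => hG.right (x :: P) v⟩ ys d r a b
    beta_reduce at h₁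
    simp only [List.cons_append, ms_cons, h₁, h₂, smul_add]
    abel

theorem BiMap.markLinear {N : GradedSpace.{v, u₃} 𝕜} {p : ℤ} (φ : BiMap V V N p) (e : ℤ) :
    MarkLinear fun x v y => φ.toFun x v y e where
  left v y := φ.left_linear v y e
  mark x y d r a b := φ.mid_linear x y d r a b e
  right x v := φ.right_linear x v e

theorem MarkLinear.sub {G G' : V.Word → V.El → V.Word → M} (hG : MarkLinear G)
    (hG' : MarkLinear G') : MarkLinear fun x v y => G x v y - G' x v y where
  left v y := (hG.left v y).sub (hG'.left v y)
  mark x y d r a b := by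
    have h₁ := hG.mark x y d r a b
    have h₂ := hG'.mark x y d r a b
    beta_reduce at h₁ h₂ ⊢
    rw [h₁, h₂, smul_sub]
    abel
  right x v := (hG.right x v).sub (hG'.right x v)

theorem SkewForm.sub {Φ Ψ : V.Word → V.El → V.Word → V.El → 𝕜} (h : SkewForm Φ)
    (h' : SkewForm Ψ) : SkewForm fun x v y w => Φ x v y w - Ψ x v y w := by
  intro x y v w
  linear_combination h x y v w - h' x y v w

theorem ClosedForm.sub {Φ Ψ : V.Word → V.El → V.Word → V.El → 𝕜} (h : ClosedForm Φ)
    (h' : ClosedForm Ψ) : ClosedForm fun x v y w => Φ x v y w - Ψ x v y w := by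
  intro x Q R a b d
  linear_combination h x Q R a b d - h' x Q R a b d

/-- The Poincaré lemma for closed skew symmetric forms. -/
theorem ClosedForm.ms_sub_ms {ρ : V.Word → V.El → V.Word → V.El → 𝕜} (hc : ClosedForm ρ)
    (hs : SkewForm ρ) (x : V.Word) (v : V.El) (y : V.Word) (w : V.El) :
    ms (fun P a Q => ρ P a Q w) (x ++ v :: y) - sgn 𝕜 ((wdeg x + v.1) * (wdeg y + w.1)) *
      ms (fun P a Q => ρ P a Q v) (y ++ w :: x) = (x.length + y.length + 2 : 𝕜) * ρ x v y w := by
  -- This is closedness for the marks `a`, `v`, `w`, with the term that ends in `a` rewritten by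
  -- skew symmetry.
  have h₀ : ∀ (P Q y : V.Word) (a v w : V.El), ρ P a (Q ++ v :: y) w -
      sgn 𝕜 ((wdeg (P ++ a :: Q) + v.1) * (wdeg y + w.1)) * ρ (y ++ w :: P) a Q v =
      ρ (P ++ a :: Q) v y w := by
    intro P Q y a v w
    have h₁ := hc P Q y a v w
    have h₂ := hs (Q ++ v :: y) P w a
    have h₃ : sgn 𝕜 ((wdeg P + a.1) * (wdeg Q + v.1 + wdeg y + w.1)) *
        sgn 𝕜 ((wdeg (Q ++ v :: y) + w.1) * (wdeg P + a.1)) = 1 := by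
      rw [← sgn_add, ← sgn_zero]
      apply sgn_congr
      simp only [wdeg_append, wdeg_cons]
      push_cast
      grind
    have h₄ : wdeg (P ++ a :: Q) + v.1 = wdeg P + a.1 + wdeg Q + v.1 := by
      simp only [wdeg_append, wdeg_cons]
      ring
    rw [h₂] at h₁
    rw [h₄]
    linear_combination -h₁ - h₃ * ρ P a (Q ++ v :: y) w
  -- Each letter of `x` contributes one copy of ρ. The letters of `y` do the same with the arguments
  -- exchanged, and the marks `v` and `w` themselves give the remaining two copies.
  have h₁ : ∀ (x y : V.Word) (v w : V.El), ms (fun P a Q => ρ P a (Q ++ v :: y) w) x -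
      sgn 𝕜 ((wdeg x + v.1) * (wdeg y + w.1)) * ms (fun P a Q => ρ (y ++ w :: P) a Q v) x =
      x.length * ρ x v y w := by
    intro x y v w
    rw [← smul_eq_mul (a := sgn 𝕜 _), ← ms_smul, ← ms_sub, ← nsmul_eq_mul, ← ms_const]
    exact ms_congr fun P a Q hx => by subst hx; exact h₀ P Q y a v w
  have h₂ := h₁ x y v w
  have h₃ := h₁ y x w v
  have h₄ := hs x y v w
  have h₅ : sgn 𝕜 ((wdeg x + v.1) * (wdeg y + w.1)) *
      sgn 𝕜 ((wdeg y + w.1) * (wdeg x + v.1)) = 1 := by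
    rw [mul_comm (wdeg y + w.1), sgn_mul_self]
  rw [ms_append_cons, ms_append_cons]
  linear_combination h₂ - sgn 𝕜 ((wdeg x + v.1) * (wdeg y + w.1)) * h₃ -
    (1 + y.length) * h₄ - h₅ * ms (fun P a Q => ρ (x ++ v :: P) a Q w) y

/-- The constant part of a family of maps. -/
def constPart (φ : BiMap V V (V.dual c) 0) : BiMap V V (V.dual c) 0 where
  toFun x v y e := if x = [] ∧ y = [] then φ.toFun [] v [] e else 0
  left_linear v y e := by intro xs ys d r a b; simp
  mid_linear x y d r a b e := by
    split_ifs
    · exact φ.mid_linear [] [] d r a b e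
    · simp
  right_linear x v e := by intro xs ys d r a b; simp
  degree x v y e he := by
    split_ifs with h
    · exact φ.degree _ _ _ _ (by simpa [h.1, h.2] using he)
    · rfl

theorem bform_constPart_nil (φ : BiMap V V (V.dual c) 0) (v w : V.El) :
    bform (constPart φ) [] v [] w = bform φ [] v [] w := rfl

/-- A form which depends on the marked letters only. -/
def IsConstForm (Φ : V.Word → V.El → V.Word → V.El → 𝕜) : Prop :=
  ∀ x v y w, x ≠ [] ∨ y ≠ [] → Φ x v y w = 0

theorem isConstForm_constPart (φ : BiMap V V (V.dual c) 0) :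
    IsConstForm (bform (constPart φ)) := by
  intro x v y w h
  have : ¬(x = [] ∧ y = []) := by tauto
  have e : (constPart φ).toFun x v y (wdeg x + v.1 + wdeg y) = 0 := if_neg this
  rw [← evalAt_toFun _ x v y w _ rfl, e, map_zero]

/-- Each of the three terms has a third marked letter among its unmarked arguments, so each one
vanishes. -/
theorem IsConstForm.closedForm {Φ : V.Word → V.El → V.Word → V.El → 𝕜} (h : IsConstForm Φ) :
    ClosedForm Φ := by
  intro x Q R a b d
  rw [h _ _ _ _ (Or.inl (by simp)), h _ _ _ _ (Or.inl (by simp)), h _ _ _ _ (Or.inl (by simp))]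
  simp

theorem IsConstForm.skewForm {Φ : V.Word → V.El → V.Word → V.El → 𝕜} (h : IsConstForm Φ)
    (h' : ∀ v w : V.El, Φ [] v [] w = -(sgn 𝕜 (v.1 * w.1) * Φ [] w [] v)) : SkewForm Φ := by
  intro x y v w
  by_cases hxy : x ≠ [] ∨ y ≠ []
  · rw [h x v y w hxy, h y w x v hxy.symm]
    simp
  · push Not at hxy
    obtain ⟨rfl, rfl⟩ := hxy
    simpa using h' v w

/-- No unmarked blocks are allowed, so the cyclic word is cut in just the block of `v` and the block
of `w`. -/
theorem IsConstForm.pbf {W : GradedSpace.{v, u₁} 𝕜} {Φ : V.Word → V.El → V.Word → V.El → 𝕜}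
    (h : IsConstForm Φ) (f : MultiMap W V 0) (x : W.Word) (v : W.El) (y : W.Word) (w : W.El) :
    pbf f Φ x v y w = cs (fun x₁ x₂ => cs (fun y₁ y₂ =>
      sgn 𝕜 (wdeg x₁ * (wdeg x₂ + v.1 + wdeg y₁ + wdeg y₂ + w.1)) •
        Φ [] (f.el (x₂ ++ v :: y₁)) [] (f.el (y₂ ++ w :: x₁))) y) x := by
  rw [AInf.pbf, cs3_cs3_regroup]
  refine cs_congr fun x₁ x' _ => cs_congr fun y' y₃ _ => ?_
  rw [cs_eq_left, cs_eq_right]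
  · simp [hat2]
  · intro y₁ y₂ hy
    rw [hat2, hat_nil, hat_of_nil _ _ hy, smul_zero]
    exact fun a s => h _ _ _ _ (Or.inr (by simp))
  · intro x₁ x₂ hx
    refine cs_eq_zero fun y₁ y₂ _ => ?_
    rw [hat2, hat_of_nil _ _ hx, smul_zero]
    exact fun a s => (hat_congr fun t _ => h _ _ _ _ (Or.inl (by simp))).trans (hat_zero _ _)

end Forms

open GradedSpace

/-! ### The Darboux theorem -/

theorem cs_eq_ends {α : Type u} {M : Type u₂} [AddCommGroup M] {K : List α → List α → M}
    {x : List α} (hx : x ≠ []) (h : ∀ a b, a ++ b = x → a ≠ [] → b ≠ [] → K a b = 0) :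
    cs K x = K [] x + K x [] := by
  cases x with
  | nil => exact absurd rfl hx
  | cons c x =>
    rw [cs_cons]
    congr 1
    rw [cs_congr (K' := fun a b => if b = [] then K (c :: x) [] else 0), cs_eq_right, if_pos rfl]
    · exact fun a b hb => if_neg hb
    · intro a b hab
      by_cases hb : b = []
      · subst hb
        rw [if_pos rfl, ← hab, List.append_nil]
      · rw [if_neg hb]
        exact h _ _ (by rw [List.cons_append, hab]) (by simp) hb

/-- With `b v p` and `q w a` as the two blocks, only the cuts in which one block is a single marked
letter contribute. These two cuts are distinct because `x` and `y` are not both empty. -/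
theorem cs_cs_eq_add {α : Type u} {β : Type u₁} {M : Type u₂} [AddCommGroup M]
    {K : List α → List α → List β → List β → M} {x : List α} {y : List β} (hxy : x ≠ [] ∨ y ≠ [])
    (h : ∀ a b p q, a ++ b = x → p ++ q = y → (a ≠ [] ∨ q ≠ []) → (b ≠ [] ∨ p ≠ []) →
      K a b p q = 0) :
    cs (fun a b => cs (fun p q => K a b p q) y) x = K [] x y [] + K x [] [] y := by
  by_cases hx : x = []
  · subst hx
    have hy : y ≠ [] := by simpa using hxy
    rw [cs_nil, cs_eq_ends hy, add_comm]
    exact fun p q hpq hp hq => h [] [] p q rfl hpq (Or.inr hq) (Or.inr hp)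
  · rw [cs_eq_ends hx]
    · congr 1
      · have : cs (fun p q => K [] x p q) y =
          cs (fun p q => if q = [] then K [] x y [] else 0) y := by
          refine cs_congr fun p q hpq => ?_
          by_cases hq : q = []
          · subst hq
            rw [if_pos rfl, ← hpq, List.append_nil]
          · rw [if_neg hq]
            exact h _ _ _ _ rfl hpq (Or.inr hq) (Or.inl hx)
        rw [this, cs_eq_right fun a b hb => if_neg hb, if_pos rfl]
      · have : cs (fun p q => K x [] p q) y =
          cs (fun p q => if p = [] then K x [] [] y else 0) y := by
          refine cs_congr fun p q hpq => ?_
          by_cases hp : p = []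
          · subst hp
            rw [if_pos rfl, ← hpq, List.nil_append]
          · rw [if_neg hp]
            exact h _ _ _ _ (by simp) hpq (Or.inl hx) (Or.inr hp)
        rw [this, cs_eq_left fun a b ha => if_neg ha, if_pos rfl]
    · intro a b hab ha hb
      exact cs_eq_zero fun p q hpq => h a b p q hab hpq (Or.inl ha) (Or.inl hb)

section Darboux

variable {𝕜 : Type v} [Field 𝕜] {V : GradedSpace.{v, u} 𝕜} {W : GradedSpace.{v, u₁} 𝕜} {c p : ℤ}

/-- A family of multilinear maps that is given by different families for words of different
length. -/
def MultiMap.ofLength (F : ℕ → MultiMap V W p) : MultiMap V W p where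
  toFun z e := (F z.length).toFun z e
  linear e xs ys d r a b := by
    simp only [List.length_append, List.length_cons]
    exact (F _).linear e xs ys d r a b
  degree z e he := (F z.length).degree z e he

/-- The family of multilinear maps that is the identity on words of length one. -/
def MultiMap.ident (V : GradedSpace.{v, u} 𝕜) : MultiMap V V 0 :=
  MultiMap.ofDiag fun _ => LinearMap.id

theorem MultiMap.ident_toFun (d : ℤ) (x : V.carrier d) :
    (MultiMap.ident V).toFun [⟨d, x⟩] d = x := ofDiag_toFun _ d x

/-- The sum of the values of the difference of two families over all positions of the mark,
transported along linear maps of degree zero. -/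
def markPrimitive (L : ∀ e, (V.dual c).carrier e →ₗ[𝕜] V.carrier e) (r : 𝕜)
    (φ φ' : BiMap V V (V.dual c) 0) : MultiMap V V 0 where
  toFun z e := L e (r • ms (fun P a Q => φ.toFun P a Q e - φ'.toFun P a Q e) z)
  linear e := (((φ.markLinear e).sub (φ'.markLinear e)).ms.smul r).linearMap_comp (L e)
  degree z e he := by
    rw [ms_congr (K' := fun _ _ _ => 0), ms_const, smul_zero, smul_zero, map_zero]
    rintro P a Q rfl
    simp only [wdeg_append, wdeg_cons] at he
    rw [φ.degree _ _ _ _ (by omega), φ'.degree _ _ _ _ (by omega), sub_zero]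

/-- Closed skew symmetric forms with a non-degenerate constant part are isomorphic to their
constant part. -/
theorem exists_darboux [CharZero 𝕜] (φ : BiMap V V (V.dual c) 0) (hs : SkewForm (bform φ))
    (hc : ClosedForm (bform φ))
    (hφ : ∀ d, Function.Bijective fun a : V.carrier d => φ.toFun [] ⟨d, a⟩ [] d) :
    ∃ g : MultiMap V V 0, (∀ e, g.toFun [] e = 0) ∧ (∀ a, g.el [a] = a) ∧
      pb g (constPart φ) = φ := by
  let E : ∀ e, V.carrier e ≃ₗ[𝕜] (V.dual c).carrier e := fun e =>
    LinearEquiv.ofBijective (((φ.markLinear e).mark [] []).toLinear e) (hφ e)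
  let L : ∀ e, (V.dual c).carrier e →ₗ[𝕜] V.carrier e := fun e => (E e).symm.toLinearMap
  have hL : ∀ e ζ, φ.toFun [] ⟨e, L e ζ⟩ [] e = ζ := fun e ζ => (E e).apply_symm_apply ζ
  -- The component of g on n letters is determined by those on fewer letters: φ₀₀ applied to it is
  -- 1/(n + 1) times the primitive of φ - g'^♯ φ₀, with g' the truncation of g below n. The number n
  -- + 1 counts the argument `w` too.
  obtain ⟨g, hg⟩ := MultiMap.exists_fixedPoint (fun f : MultiMap V V 0 => MultiMap.ofLength
    fun n => if n ≤ 1 then MultiMap.ident V else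
      markPrimitive L (n + 1 : 𝕜)⁻¹ φ (pb (f.restr (· < n)) (constPart φ))) (by
    intro f g w hfg e
    have : f.restr (· < w.length) = g.restr (· < w.length) := by
      refine MultiMap.ext (funext fun z => funext fun e => ?_)
      by_cases hz : z.length < w.length
      · rw [f.restr_pos (P := (· < w.length)) hz, g.restr_pos (P := (· < w.length)) hz, hfg z hz]
      · rw [f.restr_neg (P := (· < w.length)) hz, g.restr_neg (P := (· < w.length)) hz]
    simp only [MultiMap.ofLength, this])
  have hg_nil : ∀ e, g.toFun [] e = 0 := fun e => hg [] e
  have hg_one : ∀ a, g.el [a] = a := by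
    rintro ⟨d, a⟩
    rw [g.el_eq [⟨d, a⟩] d (by simp), hg]
    exact congrArg (Sigma.mk d) (MultiMap.ident_toFun d a)
  have hg_prim : ∀ (z : V.Word) (w : V.El), 2 ≤ z.length → bform φ [] (g.el z) [] w =
      (z.length + 1 : 𝕜)⁻¹ * ms (fun P a Q => bform φ P a Q w -
        pbf (g.restr (· < z.length)) (bform (constPart φ)) P a Q w) z := by
    intro z w hz
    have h₁ : g.toFun z (wdeg z) = L (wdeg z) ((z.length + 1 : 𝕜)⁻¹ • ms (fun P a Q =>
        φ.toFun P a Q (wdeg z) -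
          (pb (g.restr (· < z.length)) (constPart φ)).toFun P a Q (wdeg z)) z) := by
      rw [hg]
      simp only [MultiMap.ofLength, if_neg (show ¬z.length ≤ 1 by omega)]
      rfl
    rw [g.el_eq z (wdeg z) (add_zero _), h₁, ← evalAt_toFun _ _ _ _ _ (wdeg z) (by simp), hL,
      map_smul, map_ms, smul_eq_mul]
    congr 1
    refine ms_congr fun P a Q hz' => ?_
    have h₂ : wdeg z = wdeg P + a.1 + wdeg Q := by
      rw [← hz', wdeg_append, wdeg_cons, add_assoc]
    rw [map_sub, evalAt_toFun _ _ _ _ _ _ h₂, evalAt_toFun _ _ _ _ _ _ h₂, bform_pb]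
  have hω : IsConstForm (bform (constPart φ)) := isConstForm_constPart φ
  have hω_skew : SkewForm (bform (constPart φ)) := hω.skewForm fun v w => by
    simpa [bform_constPart_nil] using hs [] [] v w
  refine ⟨g, hg_nil, hg_one, bform_ext fun x v y w => ?_⟩
  rw [bform_pb]
  by_cases hxy : x ≠ [] ∨ y ≠ []
  · set n := (x ++ v :: y).length with hn
    have hn₁ : n = x.length + y.length + 1 := by
      rw [hn, List.length_append, List.length_cons, add_assoc]
    have hn₂ : (y ++ w :: x).length = n := by
      rw [hn₁, List.length_append, List.length_cons]
      omega
    have hn₃ : 2 ≤ n := by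
      have := hxy
      simp only [ne_eq, ← List.length_eq_zero_iff] at this
      omega
    set g' := g.restr (· < n) with hg'
    have hg'_lt : ∀ z : V.Word, z.length < n → g'.el z = g.el z := fun z hz =>
      MultiMap.el_congr fun e => g.restr_pos (P := (· < n)) hz e
    have hg'_ge : ∀ z : V.Word, z.length = n → ∀ e, g'.toFun z e = 0 := fun z hz e =>
      g.restr_neg (P := (· < n)) (by omega) e
    -- The error φ - g'^♯ φ₀ is closed and skew, so the Poincaré lemma recovers it from its
    -- primitive.
    have key := (((hc.sub (hω.closedForm.pbf g' hω_skew)).ms_sub_ms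
      (hs.sub (hω_skew.pbf g'))) x v y w)
    have p₁ := hg_prim (x ++ v :: y) w (by omega)
    have p₂ := hg_prim (y ++ w :: x) v (by omega)
    rw [← hn, ← hg'] at p₁
    rw [hn₂, ← hg'] at p₂
    have sk : sgn 𝕜 (wdeg x * (v.1 + wdeg y + w.1)) * bform φ [] v [] (g.el (y ++ w :: x)) =
        -(sgn 𝕜 ((wdeg x + v.1) * (wdeg y + w.1)) * bform φ [] (g.el (y ++ w :: x)) [] v) := by
      rw [hs [] [] v, mul_neg, ← mul_assoc, ← sgn_add]
      congr 2
      apply sgn_congr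
      simp only [wdeg_append, wdeg_cons, wdeg_nil, MultiMap.el]
      push_cast
      grind
    -- Restoring the component of g on n letters affects only the two cuts in which one block has n
    -- letters and the other is a single letter fixed by g.
    have diff : pbf g (bform (constPart φ)) x v y w - pbf g' (bform (constPart φ)) x v y w =
        bform φ [] (g.el (x ++ v :: y)) [] w +
        sgn 𝕜 (wdeg x * (v.1 + wdeg y + w.1)) * bform φ [] v [] (g.el (y ++ w :: x)) := by
      rw [hω.pbf, hω.pbf, ← cs_sub]
      simp only [← cs_sub]
      rw [cs_cs_eq_add hxy]
      · have z₁ : bform φ [] (g'.el (x ++ v :: y)) [] w = 0 :=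
          (bform_mid_linear φ [] [] w).el_eq_zero g' _ (hg'_ge _ hn.symm)
        have z₂ : bform φ [] v [] (g'.el (y ++ w :: x)) = 0 :=
          (bform_arg_linear φ [] [] v).el_eq_zero g' _ (hg'_ge _ hn₂)
        simp only [List.nil_append, wdeg_nil, zero_mul, sgn_zero, one_mul, bform_constPart_nil,
          hg'_lt [v] (by simp; omega), hg'_lt [w] (by simp; omega), hg_one, z₁, z₂, sub_zero,
          zero_add, add_zero, smul_eq_mul, mul_zero]
      · intro a b p q hab hpq h₁ h₂
        have l₁ : a.length + b.length = x.length := by rw [← hab, List.length_append]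
        have l₂ : p.length + q.length = y.length := by rw [← hpq, List.length_append]
        simp only [ne_eq, ← List.length_eq_zero_iff] at h₁ h₂
        rw [hg'_lt _ (by simp only [List.length_append, List.length_cons]; omega),
          hg'_lt _ (by simp only [List.length_append, List.length_cons]; omega), sub_self]
    have nz : (n + 1 : 𝕜) ≠ 0 := by exact_mod_cast Nat.succ_ne_zero n
    have hn₄ : (n : 𝕜) = x.length + y.length + 1 := by rw [hn₁]; push_cast; ring
    rw [sk, p₁, p₂] at diff
    have hr : (n + 1 : 𝕜)⁻¹ * (x.length + y.length + 2) = 1 := by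
      rw [show (x.length + y.length + 2 : 𝕜) = n + 1 by rw [hn₄]; ring, inv_mul_cancel₀ nz]
    -- The two new terms add up to the exterior derivative of the primitive divided by n + 1, which
    -- is exactly the error.
    linear_combination diff + (n + 1 : 𝕜)⁻¹ * key +
      (bform φ x v y w - pbf g' (bform (constPart φ)) x v y w) * hr
  · push Not at hxy
    obtain ⟨rfl, rfl⟩ := hxy
    simp [hω.pbf, hg_one, bform_constPart_nil]

end Darboux

open GradedSpace

/-! ### Transfer along families whose linear part is the identity -/

theorem eq_zero_of_hat_eq_zero {α : Type u} {M : Type u₂} [AddCommGroup M] {f : List α → α}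
    (hf : ∀ a, f [a] = a) {K : List α → M} (h : ∀ x, hat f K x = 0) (x : List α) : K x = 0 := by
  induction hn : x.length using Nat.strong_induction_on generalizing x with
  | _ n ih =>
    rw [← h x, hat_eq_self hf fun s hs => ih s.length (hn ▸ hs) s rfl]

theorem cs3_eq_mid {α : Type u} {M : Type u₂} [AddCommGroup M]
    {K : List α → List α → List α → M} {x : List α}
    (h : ∀ a b c, b.length < x.length → K a b c = 0) : cs3 K x = K [] x [] := by
  have : cs3 K x = cs3 (fun a _ c => if a = [] ∧ c = [] then K [] x [] else 0) x := by
    refine cs3_congr fun a b c hx => ?_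
    split_ifs with hac
    · obtain ⟨rfl, rfl⟩ := hac
      simp only [List.nil_append, List.append_nil] at hx
      rw [hx]
    · apply h
      have hl : a.length + (b.length + c.length) = x.length := by
        rw [← hx, List.length_append, List.length_append]
      simp only [← List.length_eq_zero_iff] at hac
      omega
  rw [this, cs3, cs_eq_left, cs_eq_right]
  · simp
  · exact fun b c hc => if_neg fun h' => hc h'.2
  · exact fun a r ha => cs_eq_zero fun b c _ => if_neg fun h' => ha h'.1

section Transfer

variable {𝕜 : Type v} [Field 𝕜] {V : GradedSpace.{v, u} 𝕜} {c : ℤ}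

/-- The leading term of the pullback, with all blocks single letters, is Φ itself, and all other
terms involve Φ on shorter words. Induction on the number of unmarked letters applies. -/
theorem eq_zero_of_pbf_eq_zero {g : MultiMap V V 0} (hg : ∀ a, g.el [a] = a)
    {Φ : V.Word → V.El → V.Word → V.El → 𝕜} (h : ∀ x v y w, pbf g Φ x v y w = 0) (x : V.Word)
    (v : V.El) (y : V.Word) (w : V.El) : Φ x v y w = 0 := by
  induction hn : x.length + y.length using Nat.strong_induction_on generalizing x v y w with
  | _ n ih =>
    have hz : ∀ (x' y' : V.Word) (v w : V.El), x'.length + y'.length < n →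
        hat2 g (fun s t => Φ s v t w) x' y' = 0 := fun x' y' v w hlt =>
      hat_eq_zero fun s hs => hat_eq_zero fun t ht =>
        ih (s.length + t.length) (by omega) s v t w rfl
    have h₁ := h x v y w
    rw [pbf, cs3_eq_mid, cs3_eq_mid] at h₁
    · simp only [wdeg_nil, zero_mul, sgn_zero, one_smul, List.nil_append, hg] at h₁
      rw [hat2, hat_eq_self hg, hat_eq_self hg] at h₁
      · exact h₁
      · exact fun t ht => ih (x.length + t.length) (by omega) x v t w rfl
      · intro s hs
        exact hat_eq_zero fun t ht => ih (s.length + t.length) (by omega) s v t w rfl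
    · intro y₁ y₂ y₃ hy
      rw [hz _ _ _ _ (by omega), smul_zero]
    · intro x₁ x₂ x₃ hx
      refine cs3_eq_zero fun y₁ y₂ y₃ hy => ?_
      have : y₂.length ≤ y.length := by rw [← hy]; simp only [List.length_append]; omega
      rw [hz _ _ _ _ (by omega), smul_zero]

/-- In the equation m' ∘ ĝ = g ∘ m̂ the cut in single letters contributes m' of the word, and all
others involve m' on shorter words, so the equation can be solved recursively. -/
theorem IsAInf.exists_transfer {m : MultiMap V V 1} (hm : IsAInf m) {g : MultiMap V V 0}
    (hg : ∀ a, g.el [a] = a) :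
    ∃ m' : MultiMap V V 1, IsAInf m' ∧ Intertwines g m m' := by
  obtain ⟨m', hm'⟩ := MultiMap.exists_fixedPoint (fun f : MultiMap V V 1 =>
    g.compDer m 1 (by norm_num) - MultiMap.ofLength fun n => (f.restr (· < n)).compHat g) (by
    intro f f' w hf e
    have : f.restr (· < w.length) = f'.restr (· < w.length) := by
      refine MultiMap.ext (funext fun z => funext fun e => ?_)
      by_cases hz : z.length < w.length
      · rw [f.restr_pos (P := (· < w.length)) hz, f'.restr_pos (P := (· < w.length)) hz, hf z hz]
      · rw [f.restr_neg (P := (· < w.length)) hz, f'.restr_neg (P := (· < w.length)) hz]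
    simp only [MultiMap.sub_toFun, MultiMap.ofLength, this])
  have key : Intertwines g m m' := by
    intro x e
    have h₁ : hat g.el (fun s => m'.toFun s e - (m'.restr (· < x.length)).toFun s e) x =
        m'.toFun x e := by
      rw [hat_eq_self hg, m'.restr_neg (P := (· < x.length)) (lt_irrefl _), sub_zero]
      intro s hs
      rw [m'.restr_pos (P := (· < x.length)) hs, sub_self]
    rw [hat_sub, hm'] at h₁
    exact sub_left_inj.1 h₁
  refine ⟨m', ⟨fun e => ?_, fun x e => ?_⟩, key⟩
  · have := key [] e
    rw [hat_nil, der_nil] at this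
    rw [this]
    exact (g.letterLinear e).el_eq_zero m [] hm.nil
  -- Composed with ĝ, the relation for m' becomes g ∘ m̂ ∘ m̂ = 0, and ĝ can be cancelled by
  -- triangularity.
  · refine eq_zero_of_hat_eq_zero hg (K := fun x => der m'.el (fun s => m'.toFun s e) x)
      (fun x => ?_) x
    rw [key.hat_der (m'.linear e), show hat g.el (fun s => m'.toFun s e) =
      der m.el (fun s => g.toFun s e) from funext fun s => key s e]
    exact der_der_of hm.relation (g.linear e) x

end Transfer

/-! ### Constant forms and cyclic inner products -/

section Cyclic

variable {𝕜 : Type v} [Field 𝕜] {B : AInfAlgebra.{v, u} 𝕜} {c : ℤ}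

/-- For a constant form only two terms of the invariance at `([], x, w, y)` survive: m absorbs `x
w`, or m absorbs `w y`. Skew symmetry brings the second one to the form of the cyclicity condition.
-/
theorem IsConstForm.cyclic {Φ : B.space.Word → B.space.El → B.space.Word → B.space.El → 𝕜}
    (hc : IsConstForm Φ) (hs : SkewForm Φ)
    (hb : ∀ x v y w, lieForm B.m.el Φ x v y w = 0) (x : B.space.El) (w : B.space.Word)
    (y : B.space.El) : Φ [] (B.m.el (x :: w)) [] y =
      sgn 𝕜 (x.1 * (wdeg w + y.1)) * Φ [] (B.m.el (w ++ [y])) [] x := by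
  have h := hb [] x w y
  have d₁ : der B.m.el (fun s => Φ s x w y) [] = 0 := by
    rw [der_nil, hc _ _ _ _ (Or.inl (by simp))]
  have d₂ : der B.m.el (fun t => Φ [] x t y) w = 0 :=
    (der_congr_ne_nil (K' := fun _ => 0) fun s hs => hc _ _ _ _ (Or.inr hs)).trans
      (der_zero _ _)
  rw [lieForm_eq, d₁, d₂, cs_nil, cs_nil, cs_eq_right, cs_eq_left] at h
  · simp only [wdeg_nil, sgn_zero, one_mul, List.nil_append, mul_zero, zero_add, add_zero,
      zero_mul, smul_eq_mul, sub_eq_zero] at h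
    rw [h, hs, mul_neg, ← mul_assoc, ← sgn_add, ← neg_mul, neg_sgn]
    congr 1
    apply sgn_congr
    simp only [wdeg_append, wdeg_cons, wdeg_nil, MultiMap.el]
    push_cast
    grind
  · intro a b ha
    rw [hc _ _ _ _ (Or.inr ha), smul_zero]
  · intro a b hb
    rw [hc _ _ _ _ (Or.inr hb), smul_zero]

/-- A family with a constant, skew symmetric, invariant and non-degenerate form, as a cyclic inner
product. -/
def DualFamily.toCyclic (ψ : DualFamily B c) (hc : IsConstForm (bform ψ)) (hs : SkewForm (bform ψ))
    (hb : ∀ x v y w, lieForm B.m.el (bform ψ) x v y w = 0) (hn : ψ.IsNondegenerate) :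
    CyclicInnerProduct B c where
  pair d e := LinearMap.mk₂ 𝕜 (fun x y => bform ψ [] ⟨d, x⟩ [] ⟨e, y⟩)
    (fun x x' y => ((bform_mid_linear ψ [] [] ⟨e, y⟩).toLinear d).map_add x x')
    (fun r x y => ((bform_mid_linear ψ [] [] ⟨e, y⟩).toLinear d).map_smul r x)
    (fun x y y' => ((bform_arg_linear ψ [] [] ⟨d, x⟩).toLinear e).map_add y y')
    (fun r x y => ((bform_arg_linear ψ [] [] ⟨d, x⟩).toLinear e).map_smul r y)
  degree d e hde := by
    ext x y
    exact bform_eq_zero ψ _ _ _ _ (by simpa using hde)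
  skew d e x y := by
    have h := hs [] [] ⟨d, x⟩ ⟨e, y⟩
    simp only [wdeg_nil, zero_add] at h
    exact h
  nondegenerate d e hde := by
    have ev : ∀ (x : B.space.carrier d) (w : B.space.El),
        dualEval (ψ.toFun [] ⟨d, x⟩ [] d) w = bform ψ [] ⟨d, x⟩ [] w := fun x w =>
      evalAt_toFun ψ [] ⟨d, x⟩ [] w d (by simp)
    constructor
    · intro x x' h
      refine (hn d).1 (dual_ext fun w => ?_)
      refine (ev x w).trans (Eq.trans ?_ (ev x' w).symm)
      by_cases hw : w.1 = e
      · obtain ⟨e', y⟩ := w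
        subst hw
        exact LinearMap.congr_fun h y
      · rw [bform_eq_zero, bform_eq_zero] <;> simp only [wdeg_nil] <;> omega
    · intro l
      -- The functional `l` is extended by zero to the other degrees.
      obtain ⟨x, hx⟩ := (hn d).2 (dualMk (fun w => if h : w.1 = e then l (h ▸ w.2) else 0)
        (by
          intro d' r a b
          by_cases h : d' = e
          · subst h
            simp
          · simp [h])
        (by
          intro w hw
          exact dif_neg (by omega)))
      refine ⟨x, LinearMap.ext fun y => ?_⟩
      refine (ev x ⟨e, y⟩).symm.trans ?_
      beta_reduce at hx
      rw [hx, dualEval_dualMk]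
      simp
  cyclic x w y := hc.cyclic hs hb x w y

theorem bform_toDualFamily (P : CyclicInnerProduct B c) (v w : B.space.El) :
    bform P.toDualFamily [] v [] w = P.pair v.1 w.1 v.2 w.2 := by
  have e : P.toDualFamily.toFun [] v [] v.1 = _ := dif_pos ⟨rfl, rfl, rfl⟩
  rw [← evalAt_toFun P.toDualFamily [] v [] w v.1 (by simp), e]
  rfl

theorem isConstForm_toDualFamily (P : CyclicInnerProduct B c) :
    IsConstForm (bform P.toDualFamily) := by
  intro x v y w h
  have e : P.toDualFamily.toFun x v y (wdeg x + v.1 + wdeg y) = 0 :=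
    dif_neg fun h' => by have := h'.1; have := h'.2.1; tauto
  rw [← evalAt_toFun _ x v y w _ rfl, e, map_zero]

theorem skewForm_toDualFamily (P : CyclicInnerProduct B c) : SkewForm (bform P.toDualFamily) :=
  (isConstForm_toDualFamily P).skewForm fun v w => by
    rw [bform_toDualFamily, bform_toDualFamily, P.skew]

theorem toDualFamily_toCyclic (ψ : DualFamily B c) (hc : IsConstForm (bform ψ))
    (hs : SkewForm (bform ψ)) (hb : ∀ x v y w, lieForm B.m.el (bform ψ) x v y w = 0)
    (hn : ψ.IsNondegenerate) : (ψ.toCyclic hc hs hb hn).toDualFamily = ψ := by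
  refine bform_ext fun x v y w => ?_
  by_cases h : x ≠ [] ∨ y ≠ []
  · rw [isConstForm_toDualFamily _ _ _ _ _ h, hc _ _ _ _ h]
  · push Not at h
    obtain ⟨rfl, rfl⟩ := h
    exact bform_toDualFamily _ _ _

end Cyclic

open GradedSpace

/-! ### Compositions -/

theorem cs3_cs_regroup {α : Type u} {M : Type u₂} [AddCommGroup M]
    (K : List α → List α → List α → List α → M) (x : List α) :
    cs3 (fun a m d => cs (fun b c => K a b c d) m) x =
      cs (fun r s => cs (fun a b => cs (fun c d => K a b c d) s) r) x := by
  rw [cs_assoc (fun a b s => cs (fun c d => K a b c d) s)]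
  refine cs_congr fun a t _ => ?_
  exact cs_assoc (fun b c d => K a b c d) t

section Composition

variable {𝕜 : Type v} [Field 𝕜] {V : GradedSpace.{v, u} 𝕜} {W : GradedSpace.{v, u₁} 𝕜}
  {U : GradedSpace.{v, u₃} 𝕜}

/-- Both sides are sums over the ways to write `x = k' l' p q` and `y = k l p' q'`: the blocks of f
at the marks are `q v k` and `q' w k'`, and those of g extend them by `p`, `l` and by `p'`, `l'`.
The common summand is `T`. -/
theorem IsConstForm.pbf_pbf {Ψ : U.Word → U.El → U.Word → U.El → 𝕜} (hc : IsConstForm Ψ)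
    (hΨ : FormLinear Ψ) (f : MultiMap V W 0) (g : MultiMap W U 0) (x : V.Word) (v : V.El)
    (y : V.Word) (w : V.El) : AInf.pbf f (AInf.pbf g Ψ) x v y w =
        AInf.pbf (g.compHat f) Ψ x v y w := by
  let T (k' l' p q k l p' q' : V.Word) : 𝕜 :=
    sgn 𝕜 ((wdeg k' + wdeg l') * (wdeg p + wdeg q + v.1 + wdeg k + wdeg l + wdeg p' + wdeg q' +
      w.1)) • hat f.el (fun s => hat f.el (fun t => hat f.el (fun s' => hat f.el (fun t' =>
        Ψ [] (g.el (s ++ f.el (q ++ v :: k) :: t)) [] (g.el (s' ++ f.el (q' ++ w :: k') :: t')))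
        l') p') l) p
  have lhs : AInf.pbf f (AInf.pbf g Ψ) x v y w = cs3 (fun k' x₂ q => cs (fun l' p =>
      cs3 (fun k y₂ q' => cs (fun l p' => T k' l' p q k l p' q') y₂) y) x₂) x := by
    rw [AInf.pbf]
    refine cs3_congr fun k' x₂ q _ => ?_
    rw [← cs3_cs_comm]
    refine cs3_congr fun k y₂ q' _ => ?_
    have e : ∀ s t, AInf.pbf g Ψ s (f.el (q ++ v :: k)) t (f.el (q' ++ w :: k')) =
        cs (fun s₁ s₂ => cs (fun t₁ t₂ => sgn 𝕜 (wdeg s₁ * (wdeg s₂ + (wdeg q + v.1 + wdeg k) +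
          wdeg t₁ + wdeg t₂ + (wdeg q' + w.1 + wdeg k'))) •
          Ψ [] (g.el (s₂ ++ f.el (q ++ v :: k) :: t₁)) []
            (g.el (t₂ ++ f.el (q' ++ w :: k') :: s₁))) t) s := by
      intro s t
      rw [hc.pbf]
      refine cs_congr fun s₁ s₂ _ => cs_congr fun t₁ t₂ _ => ?_
      congr 2
      simp only [wdeg_append, wdeg_cons, MultiMap.el]
      ring
    simp only [e, hat2]
    have e' : ∀ s, hat f.el (fun t => cs (fun s₁ s₂ => cs (fun t₁ t₂ => sgn 𝕜 (wdeg s₁ * (wdeg s₂ +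
        (wdeg q + v.1 + wdeg k) + wdeg t₁ + wdeg t₂ + (wdeg q' + w.1 + wdeg k'))) •
          Ψ [] (g.el (s₂ ++ f.el (q ++ v :: k) :: t₁)) []
            (g.el (t₂ ++ f.el (q' ++ w :: k') :: s₁))) t) s) y₂ =
        cs (fun s₁ s₂ => cs (fun l p' => hat f.el (fun t₁ => hat f.el (fun t₂ =>
          sgn 𝕜 (wdeg s₁ * (wdeg s₂ +
        (wdeg q + v.1 + wdeg k) + wdeg t₁ + wdeg t₂ + (wdeg q' + w.1 + wdeg k'))) •
          Ψ [] (g.el (s₂ ++ f.el (q ++ v :: k) :: t₁)) []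
            (g.el (t₂ ++ f.el (q' ++ w :: k') :: s₁))) p') l) y₂) s := by
      intro s
      rw [hat_cs_comm]
      refine cs_congr fun s₁ s₂ _ => ?_
      exact hat_cs _ _ _
    simp only [e']
    rw [hat_cs, ← cs_smul]
    refine cs_congr fun l' p hx => ?_
    simp only [hat_cs_comm]
    rw [← cs_smul]
    refine cs_congr fun l p' hy => ?_
    have e'' : hat f.el (fun s₁ => hat f.el (fun s₂ => hat f.el (fun t₁ => hat f.el (fun t₂ =>
          sgn 𝕜 (wdeg s₁ * (wdeg s₂ +
        (wdeg q + v.1 + wdeg k) + wdeg t₁ + wdeg t₂ + (wdeg q' + w.1 + wdeg k'))) •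
          Ψ [] (g.el (s₂ ++ f.el (q ++ v :: k) :: t₁)) []
            (g.el (t₂ ++ f.el (q' ++ w :: k') :: s₁))) p') l) p) l' =
        sgn 𝕜 (wdeg l' * (wdeg p + (wdeg q + v.1 + wdeg k) + wdeg l + wdeg p' +
          (wdeg q' + w.1 + wdeg k'))) • hat f.el (fun s₁ => hat f.el (fun s₂ => hat f.el (fun t₁ =>
          hat f.el (fun t₂ => Ψ [] (g.el (s₂ ++ f.el (q ++ v :: k) :: t₁)) []
            (g.el (t₂ ++ f.el (q' ++ w :: k') :: s₁))) p') l) p) l' := by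
      simp only [← hat_smul]
      exact hat_congr_wdeg fun s₁ h₁ => hat_congr_wdeg fun s₂ h₂ => hat_congr_wdeg fun t₁ h₃ =>
        hat_congr_wdeg fun t₂ h₄ => by rw [h₁, h₂, h₃, h₄]
    rw [e'', smul_smul, ← sgn_add]
    refine congrArg₂ _ (sgn_congr ?_) ?_
    · subst hx hy
      simp only [wdeg_append]
      push_cast
      grind
    · rw [hat_comm]
      congr 1
      funext s
      rw [hat_comm]
      congr 1
      funext t
      exact hat_comm _ _ _ _ _
  have rhs : AInf.pbf (g.compHat f) Ψ x v y w = cs (fun x₁ x₂ => cs (fun k' l' => cs (fun p q =>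
      cs (fun y₁ y₂ => cs (fun k l => cs (fun p' q' => T k' l' p q k l p' q') y₂) y₁) y) x₂) x₁)
      x := by
    rw [hc.pbf]
    refine cs_congr fun x₁ x₂ hx => ?_
    have swap : cs (fun k' l' => cs (fun p q =>
      cs (fun y₁ y₂ => cs (fun k l => cs (fun p' q' => T k' l' p q k l p' q') y₂) y₁) y) x₂) x₁ =
      cs (fun y₁ y₂ => cs (fun p q => cs (fun k l => cs (fun p' q' => cs (fun k' l' =>
        T k' l' p q k l p' q') x₁) y₂) y₁) x₂) y := by
      have s₁ : ∀ y₁ y₂ p q : V.Word, cs (fun k l => cs (fun p' q' => cs (fun k' l' =>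
          T k' l' p q k l p' q') x₁) y₂) y₁ = cs (fun k' l' => cs (fun k l => cs (fun p' q' =>
          T k' l' p q k l p' q') y₂) y₁) x₁ := fun y₁ y₂ p q =>
        (cs_congr fun k l _ => cs_comm _ _ _).trans (cs_comm _ _ _)
      simp only [s₁]
      rw [cs_comm]
      have s₂ : ∀ p q : V.Word, cs (fun y₁ y₂ => cs (fun k' l' => cs (fun k l => cs (fun p' q' =>
          T k' l' p q k l p' q') y₂) y₁) x₁) y = cs (fun k' l' => cs (fun y₁ y₂ => cs (fun k l =>
          cs (fun p' q' => T k' l' p q k l p' q') y₂) y₁) y) x₁ := fun p q => cs_comm _ _ _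
      have s₃ : cs (fun p q => cs (fun y₁ y₂ => cs (fun k' l' => cs (fun k l => cs (fun p' q' =>
          T k' l' p q k l p' q') y₂) y₁) x₁) y) x₂ = cs (fun p q => cs (fun k' l' =>
          cs (fun y₁ y₂ => cs (fun k l => cs (fun p' q' => T k' l' p q k l p' q') y₂) y₁) y)
          x₁) x₂ := cs_congr fun p q _ => s₂ p q
      rw [cs_comm (fun y₁ y₂ p q => cs (fun k' l' => cs (fun k l => cs (fun p' q' =>
          T k' l' p q k l p' q') y₂) y₁) x₁) y x₂, s₃]
    rw [swap]
    refine cs_congr fun y₁ y₂ hy => ?_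
    have e : Ψ [] ((g.compHat f).el (x₂ ++ v :: y₁)) [] ((g.compHat f).el (y₂ ++ w :: x₁)) =
        hat f.el (fun s => hat f.el (fun t => Ψ [] (g.el s) [] (g.el t)) (y₂ ++ w :: x₁))
          (x₂ ++ v :: y₁) := by
      rw [(hΨ.mid [] [] _).compHat_el]
      congr 1
      funext s
      exact (hΨ.arg [] _ []).compHat_el g f _
    rw [e]
    simp only [hat_append_cons, hat_cs_comm]
    rw [← cs_smul]
    refine cs_congr fun p q hp => ?_
    rw [← cs_smul]
    refine cs_congr fun k l hk => ?_
    rw [← cs_smul]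
    refine cs_congr fun p' q' hp' => ?_
    rw [← cs_smul]
    refine cs_congr fun k' l' hk' => ?_
    refine congrArg₂ _ (congrArg _ ?_) rfl
    subst hx hy hp hk hp' hk'
    simp only [wdeg_append]
    ring
  rw [lhs, rhs, cs3_cs_regroup]
  refine cs_congr fun x₁ x₂ _ => cs_congr fun k' l' _ => cs_congr fun p q _ => ?_
  rw [cs3_cs_regroup]

end Composition

open GradedSpace

/-! ### Quasi-isomorphisms -/

section QuasiIso

variable {𝕜 : Type v} [Field 𝕜] {A : AInfAlgebra.{v, u} 𝕜} {B : AInfAlgebra.{v, u₁} 𝕜}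
  {C : AInfAlgebra.{v, u₃} 𝕜} {c : ℤ}

theorem AInfAlgebra.m_single (A : AInfAlgebra.{v, u} 𝕜) {d e : ℤ} (h : d + 1 = e)
    (x : A.space.carrier d) : A.m.el [⟨d, x⟩] = ⟨e, A.m.linearPart d e x⟩ :=
  A.m.el_eq _ e (by simpa using h)

theorem AInfHom.f_single (f : AInfHom A B) {d : ℤ} (x : A.space.carrier d) :
    f.f.el [⟨d, x⟩] = ⟨d, f.f.linearPart d d x⟩ := f.f.el_eq _ d (by simp)

theorem AInfHom.linearPart_comm (f : AInfHom A B) {d e : ℤ} (h : d + 1 = e)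
    (x : A.space.carrier d) : B.m.linearPart d e (f.f.linearPart d d x) =
      f.f.linearPart e e (A.m.linearPart d e x) := by
  have := f.intertwines [⟨d, x⟩] e
  rw [hat_singleton, der_singleton A.m_nil (f.f.linear e), f.f_single, A.m_single h] at this
  exact this

theorem AInfHom.map_cycles (f : AInfHom A B) {d : ℤ} {x : A.space.carrier d}
    (hx : x ∈ A.cycles d) : f.f.linearPart d d x ∈ B.cycles d := by
  rw [AInfAlgebra.cycles, LinearMap.mem_ker, f.linearPart_comm rfl, LinearMap.mem_ker.1 hx,
    map_zero]

theorem AInfHom.map_boundaries (f : AInfHom A B) {d : ℤ} {x : A.space.carrier d}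
    (hx : x ∈ A.boundaries d) : f.f.linearPart d d x ∈ B.boundaries d := by
  obtain ⟨z, rfl⟩ := hx
  exact ⟨f.f.linearPart _ _ z, f.linearPart_comm (by ring) z⟩

/-- The composition of homomorphisms. -/
def AInfHom.comp (g : AInfHom B C) (f : AInfHom A B) : AInfHom A C :=
  Intertwines.toHom (f := g.f.compHat f.f) (fun x e => by
    have h₁ := hat_hat f.f g.f (C.m.linear e) x
    have h₂ := f.intertwines.hat_der (g.f.linear e) x
    rw [← h₁, show hat g.f.el (fun s => C.m.toFun s e) = der B.m.el (fun s => g.f.toFun s e) from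
      funext fun s => g.intertwines s e]
    exact h₂) fun e => by
      have h : hat f.f.el (fun s => g.f.toFun s e) [] = g.f.toFun [] e := hat_nil _ _
      exact h.trans (g.f_nil e)

theorem AInfHom.comp_linearPart (g : AInfHom B C) (f : AInfHom A B) (d : ℤ)
    (x : A.space.carrier d) : (g.comp f).f.linearPart d d x =
      g.f.linearPart d d (f.f.linearPart d d x) := by
  have : hat f.f.el (fun s => g.f.toFun s d) [⟨d, x⟩] = g.f.toFun [f.f.el [⟨d, x⟩]] d :=
    hat_singleton _ _ _
  rw [f.f_single] at this
  exact this

theorem AInfHom.IsQuasiIso.comp {g : AInfHom B C} {f : AInfHom A B} (hg : g.IsQuasiIso)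
    (hf : f.IsQuasiIso) : (g.comp f).IsQuasiIso where
  injective d x hx h := by
    rw [g.comp_linearPart] at h
    exact hf.injective d x hx (hg.injective d _ (f.map_cycles hx) h)
  surjective d y hy := by
    obtain ⟨b, hb, hyb⟩ := hg.surjective d y hy
    obtain ⟨a, ha, hba⟩ := hf.surjective d b hb
    refine ⟨a, ha, ?_⟩
    have := (C.boundaries d).add_mem hyb (g.map_boundaries hba)
    rwa [map_sub, sub_add_sub_cancel, ← g.comp_linearPart] at this

theorem bform_pullback (f : AInfHom A B) (χ : DualFamily B c) :
    bform (DualFamily.pullback f χ) = pbf f.f (bform χ) := by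
  funext x v y w
  exact bform_pb f.f χ x v y w

theorem pullback_pullback (f : AInfHom A B) (g : AInfHom B C) {χ : DualFamily C c}
    (hχ : IsConstForm (bform χ)) : DualFamily.pullback f (DualFamily.pullback g χ) =
      DualFamily.pullback (g.comp f) χ := by
  refine bform_ext fun x v y w => ?_
  rw [bform_pullback, bform_pullback, bform_pullback]
  exact hχ.pbf_pbf (formLinear_bform χ) f.f g.f x v y w

/-! ### Homological non-degeneracy -/

/-- Invariance of the bilinear form of a family under the differential. -/
def IsDiffInvariant (χ : DualFamily A c) : Prop :=
  ∀ v w : A.space.El, bform χ [] (A.m.el [v]) [] w =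
    sgn 𝕜 (1 + v.1) * bform χ [] v [] (A.m.el [w])

theorem DualFamily.IsBimoduleMap.isDiffInvariant {χ : DualFamily A c} (h : χ.IsBimoduleMap) :
    IsDiffInvariant χ := by
  intro v w
  have h₁ := DualFamily.isBimoduleMap_iff.1 h [] v [] w
  have z₁ : bform χ [A.m.el []] v [] w = 0 :=
    ((bform_left_linear χ v [] w).letter_head []).el_eq_zero A.m [] A.m_nil
  have z₂ : bform χ [] v [A.m.el []] w = 0 :=
    ((bform_right_linear χ [] v w).letter_head []).el_eq_zero A.m [] A.m_nil
  rw [lieForm_eq, der_nil, der_nil, z₁, z₂] at h₁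
  simpa [sub_eq_zero] using h₁

theorem CyclicInnerProduct.isDiffInvariant (P : CyclicInnerProduct A c) :
    IsDiffInvariant P.toDualFamily := by
  intro v w
  rw [bform_toDualFamily, bform_toDualFamily]
  have h₁ := P.cyclic v [] w
  rw [List.nil_append] at h₁
  rw [h₁, P.skew, mul_neg, ← mul_assoc, ← sgn_add, ← neg_mul, neg_sgn]
  congr 1
  apply sgn_congr
  simp only [wdeg_cons, wdeg_nil, MultiMap.el]
  push_cast
  grind

/-- Invariance moves the differential from the boundary to the cycle, where it gives zero. The form
thus descends to homology. -/
theorem IsDiffInvariant.eq_zero_of_mem_boundaries {χ : DualFamily A c} (h : IsDiffInvariant χ)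
    {d e : ℤ} {a : A.space.carrier d} {b : A.space.carrier e} (ha : a ∈ A.cycles d)
    (hb : b ∈ A.boundaries e) : bform χ [] ⟨d, a⟩ [] ⟨e, b⟩ = 0 := by
  obtain ⟨z, rfl⟩ := hb
  have h₁ := h ⟨d, a⟩ ⟨e - 1, z⟩
  rw [A.m_single rfl, A.m_single (by ring), LinearMap.mem_ker.1 ha,
    (bform_mid_linear χ [] [] _).map_zero] at h₁
  exact (mul_eq_zero.1 h₁.symm).resolve_left (sgn_ne_zero _)

theorem bform_pullback_nil (f : AInfHom A B) (χ : DualFamily B c) {d e : ℤ}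
    (a : A.space.carrier d) (b : A.space.carrier e) :
    bform (DualFamily.pullback f χ) [] ⟨d, a⟩ [] ⟨e, b⟩ =
      bform χ [] ⟨d, f.f.linearPart d d a⟩ [] ⟨e, f.f.linearPart e e b⟩ := by
  rw [bform_pullback]
  simp [pbf, cs3, hat2, f.f_single]

/-- The image of `a` is not a boundary, so some cycle `b` pairs with it; up to a boundary, which
pairs to zero, `b` comes from a cycle of A. -/
theorem DualFamily.IsHomologicallyNondegenerate.pullback {χ : DualFamily B c}
    (hχ : χ.IsHomologicallyNondegenerate) (hd : IsDiffInvariant χ) {f : AInfHom A B}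
    (hf : f.IsQuasiIso) : (DualFamily.pullback f χ).IsHomologicallyNondegenerate := by
  intro d a ha ha'
  obtain ⟨e, b, hb, hab⟩ := hχ d _ (f.map_cycles ha) fun h => ha' (hf.injective d a ha h)
  obtain ⟨b', hb', hbb'⟩ := hf.surjective e b hb
  refine ⟨e, b', hb', fun h => hab ?_⟩
  have h₁ := (bform_pullback_nil f χ a b').symm.trans h
  have h₂ := hd.eq_zero_of_mem_boundaries (f.map_cycles ha) hbb'
  have h₃ := ((bform_arg_linear χ [] [] ⟨d, f.f.linearPart d d a⟩).toLinear e).map_sub b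
    (f.f.linearPart e e b')
  simp only [LetterLinear.toLinear_apply] at h₃
  rw [h₂, h₁, sub_zero] at h₃
  exact h₃.symm

theorem CyclicInnerProduct.isHomologicallyNondegenerate (P : CyclicInnerProduct A c) :
    P.toDualFamily.IsHomologicallyNondegenerate := by
  intro d a ha ha'
  -- A functional that vanishes on the boundaries but not on `a` is represented by an element `b`.
  -- Invariance makes `b` a cycle, because it is orthogonal to all boundaries.
  obtain ⟨l, hl, hl'⟩ := Submodule.exists_le_ker_of_notMem ha'
  obtain ⟨b, rfl⟩ := (P.nondegenerate (-c - d) d (by ring)).2 l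
  refine ⟨-c - d, b, ?_, fun h => hl ?_⟩
  · rw [AInfAlgebra.cycles, LinearMap.mem_ker]
    refine (P.nondegenerate (-c - d + 1) (d - 1) (by ring)).1 (LinearMap.ext fun z => ?_)
    have h₁ := P.isDiffInvariant ⟨-c - d, b⟩ ⟨d - 1, z⟩
    rw [A.m_single rfl, A.m_single (show d - 1 + 1 = d by ring), bform_toDualFamily,
      bform_toDualFamily] at h₁
    have h₂ : P.pair (-c - d) d b (A.m.linearPart (d - 1) d z) = 0 := hl' ⟨z, rfl⟩
    rw [map_zero, LinearMap.zero_apply]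
    exact h₁.trans (by rw [h₂, mul_zero])
  · have h₁ : P.pair d (-c - d) a b = 0 := (bform_toDualFamily P ⟨d, a⟩ ⟨-c - d, b⟩).symm.trans h
    rw [P.skew, h₁, mul_zero, neg_zero]

end QuasiIso

/-! ### Strong homotopy inner products -/

section Main

variable {𝕜 : Type v} [Field 𝕜] {A : AInfAlgebra.{v, u} 𝕜} {c : ℤ}

theorem DualFamily.IsSkew.pullback {B : AInfAlgebra.{v, u₁} 𝕜} {χ : DualFamily B c}
    (h : χ.IsSkew) (f : AInfHom A B) : (DualFamily.pullback f χ).IsSkew := by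
  rw [isSkew_iff, bform_pullback]
  exact SkewForm.pbf h f.f

theorem DualFamily.IsClosed.pullback {B : AInfAlgebra.{v, u₁} 𝕜} {χ : DualFamily B c}
    (h : χ.IsClosed) (h' : χ.IsSkew) (f : AInfHom A B) : (DualFamily.pullback f χ).IsClosed := by
  rw [isClosed_iff, bform_pullback]
  exact (isClosed_iff.1 h).pbf f.f h'

theorem DualFamily.IsStrongHomotopyInnerProduct.properties {φ : DualFamily A c}
    (h : φ.IsStrongHomotopyInnerProduct) :
    φ.IsSkew ∧ φ.IsClosed ∧ φ.IsHomologicallyNondegenerate := by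
  obtain ⟨-, B, P, f, hf, rfl⟩ := h
  have hs : P.toDualFamily.IsSkew := skewForm_toDualFamily P
  have hc : P.toDualFamily.IsClosed := isClosed_iff.2 (isConstForm_toDualFamily P).closedForm
  exact ⟨hs.pullback f, hc.pullback hs f,
    P.isHomologicallyNondegenerate.pullback P.isDiffInvariant hf⟩

theorem DualFamily.exists_cyclic [CharZero 𝕜] {φ : DualFamily A c} (hb : φ.IsBimoduleMap)
    (hs : φ.IsSkew) (hc : φ.IsClosed) (hn : φ.IsNondegenerate) :
    ∃ (B : AInfAlgebra.{v, u} 𝕜) (P : CyclicInnerProduct B c) (f : AInfHom A B),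
      f.IsQuasiIso ∧ φ = DualFamily.pullback f P.toDualFamily := by
  obtain ⟨g, hg₀, hg₁, hg⟩ := exists_darboux φ hs (isClosed_iff.1 hc) hn
  obtain ⟨m', hm', hgm⟩ := A.isAInf.exists_transfer hg₁
  let B : AInfAlgebra.{v, u} 𝕜 := hm'.toAlgebra
  let f : AInfHom A B := Intertwines.toHom (A := A) (B := B) hgm hg₀
  let ψ : DualFamily B c := constPart φ
  have hψ : φ = DualFamily.pullback f ψ := hg.symm
  have hψn : ψ.IsNondegenerate := hn
  have hψc : IsConstForm (bform ψ) := isConstForm_constPart φ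
  have hψs : SkewForm (bform ψ) := hψc.skewForm fun v w => by
    have := hs [] [] v w
    simp only [wdeg_nil, zero_add] at this
    exact this
  -- Pulling back along g turns the Lie derivative of ψ along m' into that of φ along m, which is
  -- zero, and pullback along g is injective.
  have hψb : ∀ x v y w, lieForm B.m.el (bform ψ) x v y w = 0 := by
    refine eq_zero_of_pbf_eq_zero hg₁ fun x v y w => ?_
    refine (hgm.pbf_lieForm (formLinear_bform ψ) x v y w).trans ?_
    have e : pbf g (bform ψ) = bform φ := by
      funext x v y w
      rw [← bform_pb g ψ]
      exact congrArg (fun χ => bform χ x v y w) hg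
    exact (congrArg (fun Φ => lieForm A.m.el Φ x v y w) e).trans (isBimoduleMap_iff.1 hb x v y w)
  have f_lin : ∀ d (x : A.space.carrier d), f.f.linearPart d d x = x := fun d x => by
    have h₁ := hg₁ ⟨d, x⟩
    rw [g.el_eq _ d (by simp)] at h₁
    exact eq_of_heq (Sigma.mk.inj h₁).2
  -- The linear part of g is the identity, so m and m' have the same differential and f is a
  -- quasi-isomorphism.
  have m_lin : ∀ d e (x : A.space.carrier d), d + 1 = e →
      (B.m.linearPart d e x : A.space.carrier e) = A.m.linearPart d e x := fun d e x h => by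
    have h₁ := f.linearPart_comm h x
    rw [f_lin] at h₁
    exact h₁.trans (f_lin e _)
  refine ⟨B, ψ.toCyclic hψc hψs hψb hψn, f, ⟨?_, ?_⟩, ?_⟩
  · rintro d x hx ⟨z, hz⟩
    exact ⟨z, ((m_lin (d - 1) d z (by ring)).symm.trans hz).trans (f_lin d x)⟩
  · intro d (y : A.space.carrier d) hy
    refine ⟨y, (m_lin d (d + 1) y rfl).symm.trans hy, ?_⟩
    have h₀ : ∀ z y' : B.space.carrier d, z = y' → y' - z ∈ B.boundaries d := fun z y' h => by
      rw [h, sub_self]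
      exact (B.boundaries d).zero_mem
    exact h₀ _ _ (f_lin d y)
  · exact hψ.trans
      (congrArg (DualFamily.pullback f) (toDualFamily_toCyclic ψ hψc hψs hψb hψn).symm)

/-- A minimal algebra is its own homology, so h embeds each component into the homology of A. -/
theorem AInfHom.IsQuasiIso.finite_of_isMinimal {H : AInfAlgebra.{v, u₁} 𝕜} (hH : H.IsMinimal)
    {h : AInfHom H A} (hh : h.IsQuasiIso) (d : ℤ) [Module.Finite 𝕜 (A.Homology d)] :
    Module.Finite 𝕜 (H.space.carrier d) := by
  let l : H.space.carrier d →ₗ[𝕜] A.Homology d :=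
    ((A.boundaries d).submoduleOf (A.cycles d)).mkQ ∘ₗ
      (h.f.linearPart d d).codRestrict (A.cycles d) fun x => h.map_cycles (hH.mem_cycles x)
  refine Module.Finite.of_injective l ((injective_iff_map_eq_zero l).2 fun x hx => ?_)
  have h₁ := (Submodule.Quotient.mk_eq_zero _).1 hx
  exact hH.mem_boundaries.1 (hh.injective d x (hH.mem_cycles x) h₁)

theorem DualFamily.IsHomologicallyNondegenerate.isNondegenerate {φ : DualFamily A c}
    (h : φ.IsHomologicallyNondegenerate) (hA : A.IsMinimal)
    (hf : ∀ d, Module.Finite 𝕜 (A.space.carrier d)) : φ.IsNondegenerate := by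
  have ev : ∀ d (x : A.space.carrier d) (w : A.space.El),
      dualEval (φ.toFun [] ⟨d, x⟩ [] d) w = bform φ [] ⟨d, x⟩ [] w := fun d x w =>
    evalAt_toFun φ [] ⟨d, x⟩ [] w d (by simp)
  let β : ∀ d e, A.space.carrier d →ₗ[𝕜] Module.Dual 𝕜 (A.space.carrier e) := fun d e =>
    { toFun := fun x => (φ.toFun [] ⟨d, x⟩ [] d).1 e
      map_add' := fun x y => by
        have := (((φ.markLinear d).mark [] []).toLinear d).map_add x y
        exact congrArg (fun z : (A.space.dual c).carrier d => z.1 e) this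
      map_smul' := fun r x => by
        have := (((φ.markLinear d).mark [] []).toLinear d).map_smul r x
        exact congrArg (fun z : (A.space.dual c).carrier d => z.1 e) this }
  have β_inj : ∀ d e, d + e + c = 0 → Function.Injective (β d e) := by
    intro d e hde
    refine (injective_iff_map_eq_zero _).2 fun x hx => ?_
    by_contra hx'
    obtain ⟨e', b, -, hb⟩ := h d x (hA.mem_cycles x) fun h' => hx' (hA.mem_boundaries.1 h')
    have he : e' = e := by
      by_contra he
      exact hb (bform_eq_zero φ [] ⟨d, x⟩ [] ⟨e', b⟩ (by simp only [wdeg_nil]; omega))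
    subst he
    exact hb ((ev d x ⟨e', b⟩).symm.trans (LinearMap.congr_fun hx b))
  intro d
  have hde : d + (-c - d) + c = 0 := by ring
  -- The form embeds each of the two complementary components in the dual of the other. Finite
  -- dimensionality makes the dimensions equal and the embeddings bijective.
  have r₁ := LinearMap.finrank_le_finrank_of_injective (β_inj d (-c - d) hde)
  have r₂ := LinearMap.finrank_le_finrank_of_injective (β_inj (-c - d) d (by ring))
  rw [Subspace.dual_finrank_eq] at r₁ r₂
  have surj : Function.Surjective (β d (-c - d)) :=
    (LinearMap.injective_iff_surjective_of_finrank_eq_finrank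
      (by rw [Subspace.dual_finrank_eq]; omega)).1 (β_inj d (-c - d) hde)
  refine ⟨fun x y hxy => β_inj d (-c - d) hde ?_, fun ζ => ?_⟩
  · exact congrArg (fun z : (A.space.dual c).carrier d => z.1 (-c - d)) hxy
  · obtain ⟨x, hx⟩ := surj (ζ.1 (-c - d))
    refine ⟨x, dual_ext fun w => ?_⟩
    by_cases hw : w.1 = -c - d
    · obtain ⟨e, w⟩ := w
      obtain rfl : e = -c - d := hw
      exact LinearMap.congr_fun hx w
    · rw [dualEval_eq_zero, dualEval_eq_zero] <;> omega

end Main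

end AInf

theorem theorem5p1 {𝕜 : Type v} [Field 𝕜] [CharZero 𝕜] (A : AInf.AInfAlgebra.{v, u} 𝕜) (c : ℤ)
    (hA : ∀ d, Module.Finite 𝕜 (A.Homology d)) :
    ((∃ φ : AInf.DualFamily A c, φ.IsStrongHomotopyInnerProduct) ↔
      ∃ φ : AInf.DualFamily A c, φ.IsBimoduleMap ∧
        φ.IsSkew ∧ φ.IsClosed ∧ φ.IsHomologicallyNondegenerate) ∧
    (∀ φ : AInf.DualFamily A c, φ.IsStrongHomotopyInnerProduct →
      φ.IsSkew ∧ φ.IsClosed ∧ φ.IsHomologicallyNondegenerate) ∧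
    (∀ φ : AInf.DualFamily A c, φ.IsBimoduleMap → φ.IsSkew → φ.IsClosed →
      φ.IsHomologicallyNondegenerate →
      (∃ (H : AInf.AInfAlgebra.{v, u} 𝕜) (h : AInf.AInfHom H A) (w : AInf.AInfHom A H),
        H.IsMinimal ∧ h.IsQuasiIso ∧ w.IsQuasiIso ∧ w.IsLeftInverse h ∧
        (AInf.DualFamily.pullback w (AInf.DualFamily.pullback h φ)).IsStrongHomotopyInnerProduct) ∧
      (φ.IsNondegenerate → φ.IsStrongHomotopyInnerProduct)) := by
  have converse (φ : AInf.DualFamily A c) (hb : φ.IsBimoduleMap) (hs : φ.IsSkew)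
      (hc : φ.IsClosed) (hn : φ.IsHomologicallyNondegenerate) :
      ∃ (H : AInf.AInfAlgebra.{v, u} 𝕜) (h : AInf.AInfHom H A) (w : AInf.AInfHom A H),
        H.IsMinimal ∧ h.IsQuasiIso ∧ w.IsQuasiIso ∧ w.IsLeftInverse h ∧
        (AInf.DualFamily.pullback w
          (AInf.DualFamily.pullback h φ)).IsStrongHomotopyInnerProduct := by
    obtain ⟨H, h, w, hH, hh, hw, hwh⟩ := A.exists_minimalModel
    -- Non-degeneracy on homology becomes non-degeneracy at chain level on the minimal model, where
    -- the Darboux theorem can be applied.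
    have hd : (AInf.DualFamily.pullback h φ).IsNondegenerate :=
      (hn.pullback hb.isDiffInvariant hh).isNondegenerate hH fun d =>
        haveI := hA d
        hh.finite_of_isMinimal hH d
    obtain ⟨B, P, g, hg, e⟩ :=
      AInf.DualFamily.exists_cyclic (hb.pullback h) (hs.pullback h) (hc.pullback hs h) hd
    -- The target of the strong homotopy inner product on A is B, reached by the composition of w
    -- with the homomorphism g : H → B.
    exact ⟨H, h, w, hH, hh, hw, hwh, (hb.pullback h).pullback w, B, P, g.comp w, hg.comp hw,
      by rw [e, AInf.pullback_pullback w g (AInf.isConstForm_toDualFamily P)]⟩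
  refine ⟨⟨fun ⟨φ, h⟩ => ⟨φ, h.1, h.properties⟩, fun ⟨φ, hb, hs, hc, hn⟩ => ?_⟩,
    fun φ h => h.properties, fun φ hb hs hc hn =>
      ⟨converse φ hb hs hc hn, fun hd => ⟨hb, AInf.DualFamily.exists_cyclic hb hs hc hd⟩⟩⟩
  obtain ⟨H, h, w, -, -, -, -, hφ⟩ := converse φ hb hs hc hn
  exact ⟨_, hφ⟩
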